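/- **Twisted quadratic $Q$-groups: addition formula and exact sequence.** *Conventions.* Let $A$ be an associative ring with $1$ and an involution $a\mapsto\overline a$. Modules are left $A$-modules; $M^*=\mathrm{Hom}_A(M,A)$ with $(af)(x)=f(x)\overline a$; $M^t$ is $M$ with the right action $xa=\overline a x$. A finite-dimensional complex $C$ is a chain complex ($\mathbb Z$-graded) of f.g. projective $A$-modules that vanishes outside a finite range of degrees; $C^r=(C_r)^*$, and $C^{n-*}$ is the complex with $(C^{n-*})_r=C^{n-r}$, $d=(-1)^rd_C^*:C^{n-r}\to C^{n-r+1}$. On $C^t\otimes_AC$ put $d(x\otimes y)=x\otimes dy+(-1)^q\,dx\otimes y$ and $T(x\otimes y)=(-1)^{pq}y\otimes x$ for $x\in C_p$, $y\in C_q$. Elements $x\otimes y\in C_p^t\otimes_A C_q$ are regarded as morphisms $C^p\to C_q$, $f\mapsto\overline{f(x)}\,y$. Let $(W^\%C)_n$, $(W_\%C)_n$, $(\widehat W^\%C)_n$ be the groups of collections $\{\phi_s\in(C^t\otimes_AC)_{n+s}\mid s\ge0\}$, $\{\psi_s\in(C^t\otimes_AC)_{n-s}\mid s\ge0\}$, $\{\theta_s\in(C^t\otimes_AC)_{n+s}\mid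 s\in\mathbb Z\}$, with differentials $$(d\phi)_s=d\phi_s+(-1)^{n+s-1}(\phi_{s-1}+(-1)^sT\phi_{s-1})\ (\phi_{-1}=0),$$ $$(d\psi)_s=d\psi_s+(-1)^{n-s-1}(\psi_{s+1}+(-1)^{s+1}T\psi_{s+1}),$$ $$(d\theta)_s=d\theta_s+(-1)^{n+s-1}(\theta_{s-1}+(-1)^sT\theta_{s-1}),$$ and let $Q^n(C)$, $Q_n(C)$, $\widehat Q^n(C)$ be their homology groups ($n\in\mathbb Z$). Let $J:Q^n(C)\to\widehat Q^n(C)$ be extension by $0$ to $s<0$, $1+T:Q_n(C)\to Q^n(C)$ the map $\psi\mapsto((1+T)\psi_0,0,0,\dots)$, and $H:\widehat Q^{n+1}(C)\to Q_n(C)$, $(H\theta)_s=\theta_{-s-1}$. A chain map $f:C\to D$ induces $f^\%$, $\widehat f^\%$ (written $f^\%$ when no confusion arises) by $f\otimes f$ on each $\phi_s$, $\theta_s$. If $f,f':C\to D$ are chain maps, then on $(\widehat W^\%C)_n$ put $$[f,f'](\theta)_s=(-1)^{n+1}(f\otimes f')(T\theta_{s+1}),$$ which satisfies $d[f,f']+[f,f']d=\widehat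 f^\%+\widehat f'^\%-\widehat{(f+f')}^\%$; if $g:f\simeq f'$ is a chain homotopy ($f'-f=dg+gd$), put $$(g;f,f')^\%(\theta)_s=(f\otimes g+g\otimes f')(\theta_s)+(-1)^n(g\otimes g)(T\theta_{s-1}),$$ where $(g\otimes h)(x\otimes y)=(-1)^q g(x)\otimes h(y)$ for $y\in C_q$; it satisfies $d(g;f,f')^\%+(g;f,f')^\%d=\widehat f'^\%-\widehat f^\%$. A *chain bundle* $(C,\gamma)$ is a finite-dimensional complex $C$ with a cycle $\gamma\in(\widehat W^\%C^{0-*})_0$. Let $S^n:(\widehat W^\%C^{0-*})_m\to(\widehat W^\%C^{n-*})_{m+n}$ be $(S^n\gamma)_s=\gamma_{s-n}$, multiplied by $(-1)^{nq}$ on $x\otimes y$ with $y\in(C^{0-*})_q$. A *map of chain bundles* $(f,\chi):(C,\gamma)\to(C',\gamma')$ is a chain map $f:C\to C'$ with a chain $\chi\in(\widehat W^\%C^{0-*})_1$ such that $f^*\gamma'-\gamma=d\chi$, where $f^*\gamma'$ is the image of $\gamma'$ under the map induced by $f^*:C'^{0-*}\to C^{0-*}$. Composition is $(f',\chi')(f,\chi)=(f'f,\chi+f^*\chi')$.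 A *homotopy* $(f,\chi)\simeq(f',\chi')$ is a chain homotopy $g:f\simeq f'$ together with $\eta\in(\widehat W^\%C^{0-*})_2$ such that $\chi-\chi'+(g^*;f^*,f'^*)^\%(\gamma')=d\eta$, where $g^*:f^*\simeq f'^*$ is the dual homotopy, $(-1)^{i+1}$ times the dual of $g$ on $(C'^{0-*})_i$. An *equivalence* is a map with a homotopy inverse. An *$n$-dimensional symmetric structure* $(\phi,\theta)$ on $(C,\gamma)$ is a cycle $\phi\in(W^\%C)_n$ and a chain $\theta\in(\widehat W^\%C)_{n+1}$ with $$J(\phi)-(\phi_0)^\%(S^n\gamma)=d\theta,$$ $\phi_0$ being regarded as a chain map $C^{n-*}\to C$. Two such structures $(\phi,\theta)$, $(\phi',\theta')$ are *equivalent* if there are $\xi\in(W^\%C)_{n+1}$, $\eta\in(\widehat W^\%C)_{n+2}$ with $$\phi'-\phi=d\xi,\qquad \theta-\theta'+J(\xi)-(\xi_0;\phi_0,\phi'_0)^\%(S^n\gamma)=d\eta .$$ *Theorem.* For all chain bundles $(C,\gamma)$ over $A$ and all $n\in\mathbb Z$: 1. Equivalence is an equivalence relation, and the set $Q_n(C,\gamma)$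 of equivalence classes is an abelian group with the (well-defined) addition $$(\phi,\theta)+(\phi',\theta')=(\phi+\phi',\ \theta+\theta'+[\phi_0,\phi'_0](S^n\gamma)).$$ 2. There is a long exact sequence of abelian groups $$\cdots\to Q^{n+1}(C)\xrightarrow{J_\gamma}\widehat Q^{n+1}(C)\xrightarrow{H_\gamma}Q_n(C,\gamma)\xrightarrow{N_\gamma}Q^n(C)\xrightarrow{J_\gamma}\widehat Q^n(C)\to\cdots$$ with $H_\gamma(\theta)=(0,\theta)$, $N_\gamma(\phi,\theta)=\phi$, $J_\gamma(\phi)=J(\phi)-(\phi_0)^\%(S^n\gamma)$. 3. A map of chain bundles $(f,\chi):(C,\gamma)\to(C',\gamma')$ induces a well-defined homomorphism $$(f,\chi)_\%:Q_n(C,\gamma)\to Q_n(C',\gamma'),\quad(\phi,\theta)\mapsto(f^\%\phi,\ \widehat f^\%\theta-(f\phi_0)^\%(S^n\chi)),$$ functorially in $(f,\chi)$ and depending only on the homotopy class of $(f,\chi)$. Together with $f^\%$ and $\widehat f^\%$ it is a morphism of the exact sequences in 2, which is an isomorphism if $(f,\chi)$ is an equivalence. 4. If $\gamma=0$ there is an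 isomorphism $$Q_n(C)\to Q_n(C,0),\quad\psi\mapsto((1+T)\psi,\theta),\quad\theta_s=(-1)^n\psi_{-s-1}\ (s\le-1),\ \ \theta_s=0\ (s\ge0),$$ and with the identity maps of $Q^n(C)$, $\widehat Q^n(C)$ it is an isomorphism from the sequence $\cdots\to\widehat Q^{n+1}(C)\xrightarrow{H}Q_n(C)\xrightarrow{1+T}Q^n(C)\xrightarrow{J}\widehat Q^n(C)\to\cdots$ to the exact sequence in 2. -/

import Mathlib

open CategoryTheory

universe u

set_option linter.unusedSectionVars false

namespace AlgSurgery

/-! ### Modules over a ring with involution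

The ring with involution is a `Ring A` with a `StarRing A` structure, the involution being `star`.
Modules are left modules. -/

section Modules

variable (A : Type u) [Ring A] [StarRing A]

/-- The dual `M^* = Hom_A(M, A)` of a left module `M`. -/
def StarDual (M : Type u) [AddCommGroup M] [Module A M] : Type u := M →ₗ[A] A

variable (M N M' N' : Type u) [AddCommGroup M] [Module A M] [AddCommGroup N] [Module A N]
  [AddCommGroup M'] [Module A M'] [AddCommGroup N'] [Module A N']

instance : AddCommGroup (StarDual A M) := inferInstanceAs (AddCommGroup (M →ₗ[A] A))

variable {A M N M' N'}

/-- Evaluation of an element of the dual. -/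
def StarDual.eval (f : StarDual A M) : M →ₗ[A] A := f

@[ext] theorem StarDual.ext {f g : StarDual A M} (h : ∀ x, f.eval x = g.eval x) : f = g :=
  LinearMap.ext (f := f.eval) (g := g.eval) h

@[simp] theorem StarDual.eval_add (f g : StarDual A M) (x : M) :
    (f + g).eval x = f.eval x + g.eval x := rfl

@[simp] theorem StarDual.eval_zero (x : M) : (0 : StarDual A M).eval x = 0 := rfl

/-- The left action of `A` on the dual: `(a f)(x) = f(x) * star a`. -/
instance : SMul A (StarDual A M) where
  smul a f :=
    { toFun := fun x => f.eval x * star a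
      map_add' := fun x y => by simp [add_mul]
      map_smul' := fun b x => by simp [mul_assoc] }

@[simp] theorem StarDual.eval_smul (a : A) (f : StarDual A M) (x : M) :
    (a • f).eval x = f.eval x * star a := rfl

instance : Module A (StarDual A M) where
  one_smul f := by ext x; simp
  mul_smul a b f := by ext x; simp [mul_assoc]
  smul_zero a := by ext x; simp
  smul_add a f g := by ext x; simp [add_mul]
  add_smul a b f := by ext x; simp [mul_add]
  zero_smul f := by ext x; simp

/-- The dual `f^* : N^* → M^*`, `g ↦ g ∘ f`, of a morphism `f : M → N`. -/
def StarDual.map (f : M →ₗ[A] N) : StarDual A N →ₗ[A] StarDual A M where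
  toFun g := LinearMap.comp (g.eval) f
  map_add' _ _ := rfl
  map_smul' _ _ := rfl

@[simp] theorem StarDual.eval_map (f : M →ₗ[A] N) (g : StarDual A N) (x : M) :
    (StarDual.map f g).eval x = g.eval (f x) := rfl

theorem StarDual.map_comp {P : Type u} [AddCommGroup P] [Module A P] (f : M →ₗ[A] N)
    (g : N →ₗ[A] P) : (StarDual.map f).comp (StarDual.map g) = StarDual.map (g.comp f) := rfl

theorem StarDual.map_zero : StarDual.map (0 : M →ₗ[A] N) = 0 :=
  LinearMap.ext fun g => StarDual.ext fun _ => g.eval.map_zero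

theorem StarDual.map_id : StarDual.map (LinearMap.id : M →ₗ[A] M) = LinearMap.id := rfl

variable (A M N)

/-- The relations `(x a) ⊗ y = x ⊗ (a y)` defining the tensor product over `A`, where `M^t` is `M`
with the right action `x a = star a • x`. -/
def tensorRel : AddSubgroup (TensorProduct ℤ M N) :=
  AddSubgroup.closure
    {z | ∃ (a : A) (x : M) (y : N),
      z = TensorProduct.tmul ℤ (star a • x) y - TensorProduct.tmul ℤ x (a • y)}

/-- The abelian group `M^t ⊗_A N`. -/
def STensor : Type u := TensorProduct ℤ M N ⧸ tensorRel A M N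

instance : AddCommGroup (STensor A M N) :=
  inferInstanceAs (AddCommGroup (TensorProduct ℤ M N ⧸ tensorRel A M N))

variable {M N}

/-- The element `x ⊗ y` of `M^t ⊗_A N`. -/
def STensor.tmul (x : M) (y : N) : STensor A M N :=
  QuotientAddGroup.mk' (tensorRel A M N) (TensorProduct.tmul ℤ x y)

variable {A}

theorem STensor.tmul_smul (a : A) (x : M) (y : N) :
    STensor.tmul A x (a • y) = STensor.tmul A (star a • x) y := by
  refine (QuotientAddGroup.eq_iff_sub_mem.2 ?_)
  rw [← neg_mem_iff, neg_sub]
  exact AddSubgroup.subset_closure ⟨a, x, y, rfl⟩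

/-- The homomorphism out of `M^t ⊗_A N` given by a balanced biadditive map. -/
def STensor.lift {G : Type*} [AddCommGroup G] (b : M →+ N →+ G)
    (hb : ∀ (a : A) (x : M) (y : N), b (star a • x) y = b x (a • y)) : STensor A M N →+ G :=
  QuotientAddGroup.lift (tensorRel A M N)
    (TensorProduct.liftAddHom b (fun r x y => by simp))
    ((AddSubgroup.closure_le _).2 (by
      rintro z ⟨a, x, y, rfl⟩
      simp [hb]))

@[simp] theorem STensor.lift_tmul {G : Type*} [AddCommGroup G] (b : M →+ N →+ G)
    (hb : ∀ (a : A) (x : M) (y : N), b (star a • x) y = b x (a • y)) (x : M) (y : N) :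
    STensor.lift b hb (STensor.tmul A x y) = b x y := rfl

theorem STensor.hom_ext {G : Type*} [AddCommGroup G] {F F' : STensor A M N →+ G}
    (h : ∀ x y, F (STensor.tmul A x y) = F' (STensor.tmul A x y)) : F = F' := by
  refine QuotientAddGroup.addMonoidHom_ext _ (AddMonoidHom.ext fun z => ?_)
  induction z with
  | zero => simp
  | tmul x y => exact h x y
  | add x y hx hy => rw [map_add, map_add, hx, hy]

theorem STensor.tmul_add (x : M) (y y' : N) :
    STensor.tmul A x (y + y') = STensor.tmul A x y + STensor.tmul A x y' := by
  simp only [STensor.tmul, TensorProduct.tmul_add, map_add]; rfl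

theorem STensor.add_tmul (x x' : M) (y : N) :
    STensor.tmul A (x + x') y = STensor.tmul A x y + STensor.tmul A x' y := by
  simp only [STensor.tmul, TensorProduct.add_tmul, map_add]; rfl

/-- The biadditive map `(x, y) ↦ x ⊗ y`. -/
def STensor.mkHom : M →+ N →+ STensor A M N :=
  AddMonoidHom.mk' (fun x => AddMonoidHom.mk' (STensor.tmul A x) (STensor.tmul_add x))
    (fun x x' => AddMonoidHom.ext fun y => STensor.add_tmul x x' y)

@[simp] theorem STensor.mkHom_apply (x : M) (y : N) :
    STensor.mkHom (A := A) x y = STensor.tmul A x y := rfl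

/-- The map `x ⊗ y ↦ f(x) ⊗ g(y)`. -/
def STensor.map (f : M →ₗ[A] M') (g : N →ₗ[A] N') : STensor A M N →+ STensor A M' N' :=
  STensor.lift ((STensor.mkHom.comp f.toAddMonoidHom).compl₂ g.toAddMonoidHom)
    (fun a x y => by simp [STensor.tmul_smul])

@[simp] theorem STensor.map_tmul (f : M →ₗ[A] M') (g : N →ₗ[A] N') (x : M) (y : N) :
    STensor.map f g (STensor.tmul A x y) = STensor.tmul A (f x) (g y) := rfl

/-- The map `x ⊗ y ↦ y ⊗ x`. -/
def STensor.swap : STensor A M N →+ STensor A N M :=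
  STensor.lift STensor.mkHom.flip (fun a x y => by
    simpa using STensor.tmul_smul (star a) y x)

@[simp] theorem STensor.swap_tmul (x : M) (y : N) :
    STensor.swap (STensor.tmul A x y) = STensor.tmul A y x := rfl

/-- The slant map `M^t ⊗_A N → Hom_A(M^*, N)`, `x ⊗ y ↦ (f ↦ star (f x) • y)`. -/
def STensor.slant : STensor A M N →+ (StarDual A M →ₗ[A] N) :=
  STensor.lift
    { toFun := fun x =>
        { toFun := fun y =>
            { toFun := fun f => star (f.eval x) • y
              map_add' := fun f g => by simp [add_smul]
              map_smul' := fun a f => by simp [mul_smul] }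
          map_zero' := by ext f; simp
          map_add' := fun y y' => by ext f; simp }
      map_zero' := by ext y f; simp
      map_add' := fun x x' => by ext y f; simp [add_smul] }
    (fun a x y => by ext f; simp [mul_smul])

@[simp] theorem STensor.slant_tmul (x : M) (y : N) (f : StarDual A M) :
    STensor.slant (STensor.tmul A x y) f = star (f.eval x) • y := rfl

end Modules

/-! ### Chain complexes -/

variable {A : Type u} [Ring A] [StarRing A]

/-- A chain complex of left `A`-modules, indexed by `ℤ`. -/
abbrev Cx (A : Type u) [Ring A] := ChainComplex (ModuleCat.{u} A) ℤ

/-- Finite-dimensional chain complexes: finitely generated projective in each degree, and zero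
outside a finite range of degrees. -/
def FiniteDim (C : Cx A) : Prop :=
  (∀ r : ℤ, Module.Finite A (C.X r) ∧ Module.Projective A (C.X r)) ∧
    ∃ a b : ℤ, ∀ r : ℤ, r < a ∨ b < r → Subsingleton (C.X r)

/-- The `n`-dual complex `C^{n-*}`: in degree `r` it is `C^{n-r} = (C_{n-r})^*`, with differential
`(-1)^r (d_C)^* : C^{n-r} → C^{n-r+1}`. -/
def dual (n : ℤ) (C : Cx A) : Cx A where
  X r := ModuleCat.of A (StarDual A (C.X (n - r)))
  d i j := ModuleCat.ofHom ((i.negOnePow : ℤ) • StarDual.map (C.d (n - j) (n - i)).hom)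
  shape i j h := by
    rw [C.shape (n - j) (n - i) (by simp only [ComplexShape.down_Rel] at h ⊢; omega),
      ModuleCat.hom_zero, StarDual.map_zero, smul_zero, ModuleCat.ofHom_zero]
  d_comp_d' i j k _ _ := by
    rw [← ModuleCat.ofHom_comp, LinearMap.comp_smul, LinearMap.smul_comp, StarDual.map_comp,
      ← ModuleCat.hom_comp, C.d_comp_d, ModuleCat.hom_zero, StarDual.map_zero, smul_zero,
      smul_zero, ModuleCat.ofHom_zero]

/-- The dual chain map `f^* : D^{n-*} → C^{n-*}` of a chain map `f : C → D`. -/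
def dualMap (n : ℤ) {C D : Cx A} (f : C ⟶ D) : dual n D ⟶ dual n C where
  f i := ModuleCat.ofHom (StarDual.map (f.f (n - i)).hom)
  comm' i j _ := by
    simp only [dual]
    rw [← ModuleCat.ofHom_comp, ← ModuleCat.ofHom_comp, LinearMap.comp_smul, LinearMap.smul_comp,
      StarDual.map_comp, StarDual.map_comp, ← ModuleCat.hom_comp, ← ModuleCat.hom_comp, f.comm]

/-- Degree `0` families of morphisms `C_i → D_i`. -/
abbrev Fam (C D : Cx A) := ∀ i : ℤ, C.X i →ₗ[A] D.X i

/-- Families of morphisms `C_i → D_j`; only the components with `j = i + 1` of such a family will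
be used. -/
abbrev Fam₁ (C D : Cx A) := ∀ i j : ℤ, C.X i →ₗ[A] D.X j

/-- The family underlying a chain map. -/
def fam {C D : Cx A} (f : C ⟶ D) : Fam C D := fun i => (f.f i).hom

/-! ### The complex `C^t ⊗_A C` -/

/-- Families of elements of `C_p^t ⊗_A C_q`. Those that vanish for `p + q ≠ m` are the elements of
`(C^t ⊗_A C)_m = ∑_{p+q=m} C_p^t ⊗_A C_q`, when `C` is finite-dimensional. -/
abbrev Bi (C : Cx A) := ∀ p q : ℤ, STensor A (C.X p) (C.X q)

/-- The differential `d(x ⊗ y) = x ⊗ d(y) + (-1)^q d(x) ⊗ y`, for `y ∈ C_q`. -/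
def dBi (C : Cx A) : Bi C →+ Bi C where
  toFun x p q := STensor.map LinearMap.id (C.d (q + 1) q).hom (x p (q + 1)) +
    (q.negOnePow : ℤ) • STensor.map (C.d (p + 1) p).hom LinearMap.id (x (p + 1) q)
  map_zero' := by ext p q; simp
  map_add' x y := by ext p q; simp only [Pi.add_apply, map_add, smul_add]; abel

/-- The transposition involution `T(x ⊗ y) = (-1)^{pq} y ⊗ x`, for `x ∈ C_p`, `y ∈ C_q`. -/
def T (C : Cx A) : Bi C →+ Bi C where
  toFun x p q := ((p * q).negOnePow : ℤ) • STensor.swap (x q p)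
  map_zero' := by ext p q; simp
  map_add' x y := by ext p q; simp

/-- The map `x ⊗ y ↦ f(x) ⊗ f'(y)`. -/
def biMap {C D : Cx A} (f f' : Fam C D) : Bi C →+ Bi D where
  toFun x p q := STensor.map (f p) (f' q) (x p q)
  map_zero' := by ext p q; simp
  map_add' x y := by ext p q; simp

/-! ### Symmetric, quadratic and hyperquadratic chains -/

/-- Collections `{φ_s | s ≥ 0}`. -/
abbrev SymC (C : Cx A) := ℕ → Bi C

/-- Collections `{θ_s | s ∈ ℤ}`. -/
abbrev HatC (C : Cx A) := ℤ → Bi C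

/-- `(W^% C)_n`: the collections with `φ_s ∈ (C^t ⊗_A C)_{n+s}`. -/
def symChains (C : Cx A) (n : ℤ) : AddSubgroup (SymC C) where
  carrier := {φ | ∀ (s : ℕ) (p q : ℤ), p + q ≠ n + s → φ s p q = 0}
  zero_mem' _ _ _ _ := rfl
  add_mem' ha hb s p q h := by simp [ha s p q h, hb s p q h]
  neg_mem' ha s p q h := by simp [ha s p q h]

/-- `(W_% C)_n`: the collections with `ψ_s ∈ (C^t ⊗_A C)_{n-s}`, `s ≥ 0`. (For finite-dimensional
`C` only finitely many of the groups `(C^t ⊗_A C)_{n-s}` are nonzero.) -/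
def quadChains (C : Cx A) (n : ℤ) : AddSubgroup (SymC C) where
  carrier := {ψ | ∀ (s : ℕ) (p q : ℤ), p + q ≠ n - s → ψ s p q = 0}
  zero_mem' _ _ _ _ := rfl
  add_mem' ha hb s p q h := by simp [ha s p q h, hb s p q h]
  neg_mem' ha s p q h := by simp [ha s p q h]

/-- `(Ŵ^% C)_n`: the collections with `θ_s ∈ (C^t ⊗_A C)_{n+s}`, `s ∈ ℤ`. -/
def hatChains (C : Cx A) (n : ℤ) : AddSubgroup (HatC C) where
  carrier := {θ | ∀ (s : ℤ) (p q : ℤ), p + q ≠ n + s → θ s p q = 0}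
  zero_mem' _ _ _ _ := rfl
  add_mem' ha hb s p q h := by simp [ha s p q h, hb s p q h]
  neg_mem' ha s p q h := by simp [ha s p q h]

/-- The differential of `W^% C` on `(W^% C)_n`:
`(dφ)_s = d(φ_s) + (-1)^{n+s-1} (φ_{s-1} + (-1)^s T φ_{s-1})`, with `φ_{-1} = 0`. -/
def dSym (C : Cx A) (n : ℤ) : SymC C →+ SymC C where
  toFun φ s := match s with
    | 0 => dBi C (φ 0)
    | s + 1 => dBi C (φ (s + 1)) +
        ((n + s).negOnePow : ℤ) • (φ s + ((s + 1 : ℤ).negOnePow : ℤ) • T C (φ s))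
  map_zero' := by ext s : 1; cases s <;> simp
  map_add' x y := by
    ext s : 1
    cases s
    · simp
    · simp only [Pi.add_apply, map_add, smul_add]; abel

/-- The differential of `W_% C` on `(W_% C)_n`:
`(dψ)_s = d(ψ_s) + (-1)^{n-s-1} (ψ_{s+1} + (-1)^{s+1} T ψ_{s+1})`. -/
def dQuad (C : Cx A) (n : ℤ) : SymC C →+ SymC C where
  toFun ψ s := dBi C (ψ s) +
    ((n - s - 1).negOnePow : ℤ) •
      (ψ (s + 1) + ((s + 1 : ℤ).negOnePow : ℤ) • T C (ψ (s + 1)))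
  map_zero' := by ext s : 1; simp
  map_add' x y := by ext s : 1; simp only [Pi.add_apply, map_add, smul_add]; abel

/-- The differential of `Ŵ^% C` on `(Ŵ^% C)_n`:
`(dθ)_s = d(θ_s) + (-1)^{n+s-1} (θ_{s-1} + (-1)^s T θ_{s-1})`. -/
def dHat (C : Cx A) (n : ℤ) : HatC C →+ HatC C where
  toFun θ s := dBi C (θ s) +
    ((n + s - 1).negOnePow : ℤ) • (θ (s - 1) + (s.negOnePow : ℤ) • T C (θ (s - 1)))
  map_zero' := by ext s : 1; simp
  map_add' x y := by ext s : 1; simp only [Pi.add_apply, map_add, smul_add]; abel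

/-- `n`-dimensional symmetric structures on `C`: the cycles in `(W^% C)_n`. -/
def symCycles (C : Cx A) (n : ℤ) : AddSubgroup (SymC C) := symChains C n ⊓ (dSym C n).ker

/-- `n`-dimensional quadratic structures on `C`: the cycles in `(W_% C)_n`. -/
def quadCycles (C : Cx A) (n : ℤ) : AddSubgroup (SymC C) := quadChains C n ⊓ (dQuad C n).ker

/-- `n`-dimensional hyperquadratic structures on `C`: the cycles in `(Ŵ^% C)_n`. -/
def hatCycles (C : Cx A) (n : ℤ) : AddSubgroup (HatC C) := hatChains C n ⊓ (dHat C n).ker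

/-- The boundaries in `(W^% C)_n`. -/
def symBoundaries (C : Cx A) (n : ℤ) : AddSubgroup (SymC C) :=
  (symChains C (n + 1)).map (dSym C (n + 1))

/-- The boundaries in `(W_% C)_n`. -/
def quadBoundaries (C : Cx A) (n : ℤ) : AddSubgroup (SymC C) :=
  (quadChains C (n + 1)).map (dQuad C (n + 1))

/-- The boundaries in `(Ŵ^% C)_n`. -/
def hatBoundaries (C : Cx A) (n : ℤ) : AddSubgroup (HatC C) :=
  (hatChains C (n + 1)).map (dHat C (n + 1))

/-- The symmetric `Q`-group `Q^n(C) = H_n(W^% C)`. -/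
abbrev QSym (C : Cx A) (n : ℤ) : Type u :=
  symCycles C n ⧸ (symBoundaries C n).addSubgroupOf (symCycles C n)

/-- The quadratic `Q`-group `Q_n(C) = H_n(W_% C)`. -/
abbrev QQuad (C : Cx A) (n : ℤ) : Type u :=
  quadCycles C n ⧸ (quadBoundaries C n).addSubgroupOf (quadCycles C n)

/-- The hyperquadratic `Q`-group `Q̂^n(C) = H_n(Ŵ^% C)`. -/
abbrev QHat (C : Cx A) (n : ℤ) : Type u :=
  hatCycles C n ⧸ (hatBoundaries C n).addSubgroupOf (hatCycles C n)

/-- The class of a symmetric structure in `Q^n(C)`. -/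
abbrev QSym.mk {C : Cx A} {n : ℤ} (φ : symCycles C n) : QSym C n := QuotientAddGroup.mk φ

/-- The class of a quadratic structure in `Q_n(C)`. -/
abbrev QQuad.mk {C : Cx A} {n : ℤ} (ψ : quadCycles C n) : QQuad C n := QuotientAddGroup.mk ψ

/-- The class of a hyperquadratic structure in `Q̂^n(C)`. -/
abbrev QHat.mk {C : Cx A} {n : ℤ} (θ : hatCycles C n) : QHat C n := QuotientAddGroup.mk θ

/-- `J : W^% C → Ŵ^% C`, extension by zero to negative `s`. -/
def Jmap (C : Cx A) : SymC C →+ HatC C where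
  toFun φ s := if 0 ≤ s then φ s.toNat else 0
  map_zero' := by ext s : 1; simp
  map_add' x y := by ext s : 1; by_cases h : 0 ≤ s <;> simp [h]

/-- `1 + T : W_% C → W^% C`, `((1+T)ψ)_0 = (1+T)ψ_0` and `((1+T)ψ)_s = 0` for `s ≥ 1`. -/
def onePlusT (C : Cx A) : SymC C →+ SymC C where
  toFun ψ s := if s = 0 then ψ 0 + T C (ψ 0) else 0
  map_zero' := by ext s : 1; simp
  map_add' x y := by
    ext s : 1; by_cases h : s = 0
    · simp only [h, if_true, Pi.add_apply, map_add]; abel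
    · simp [h]

/-- `H : Ŵ^% C → S(W_% C)`, `(Hθ)_s = θ_{-s-1}` for `s ≥ 0`. -/
def Hmap (C : Cx A) : HatC C →+ SymC C where
  toFun θ s := θ (-s - 1)
  map_zero' := rfl
  map_add' _ _ := rfl

/-- The map `f^% : W^% C → W^% D` of a degree `0` family `f`, `(f^% φ)_s = (f ⊗ f)(φ_s)`. -/
def symPush {C D : Cx A} (f : Fam C D) : SymC C →+ SymC D where
  toFun φ s := biMap f f (φ s)
  map_zero' := by ext s : 1; simp
  map_add' x y := by ext s : 1; simp

/-- The map `f̂^% : Ŵ^% C → Ŵ^% D` of a degree `0` family `f`, `(f̂^% θ)_s = (f ⊗ f)(θ_s)`. -/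
def hatPush {C D : Cx A} (f : Fam C D) : HatC C →+ HatC D where
  toFun θ s := biMap f f (θ s)
  map_zero' := by ext s : 1; simp
  map_add' x y := by ext s : 1; simp

/-- The homotopy `(g; f, f')^% : f̂^% ≃ f̂'^%`, on `(Ŵ^% C)_n`, determined by a chain homotopy
`g : f ≃ f' : C → D` (that is, `f' - f = dg + gd`):
`θ ↦ (f ⊗ g + g ⊗ f')(θ_s) + (-1)^n (g ⊗ g)(T θ_{s-1})`, with the sign convention
`(g ⊗ h)(x ⊗ y) = (-1)^q g(x) ⊗ h(y)` for `y ∈ C_q` and `g` of degree `1`. -/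
def hatHtpy {C D : Cx A} (n : ℤ) (g : Fam₁ C D) (f f' : Fam C D) (θ : HatC C) : HatC D :=
  fun s p q =>
    STensor.map (f p) (g (q - 1) q) (θ s p (q - 1)) +
    (q.negOnePow : ℤ) • STensor.map (g (p - 1) p) (f' q) (θ s (p - 1) q) +
    ((n + q - 1).negOnePow : ℤ) •
      STensor.map (g (p - 1) p) (g (q - 1) q) (T C (θ (s - 1)) (p - 1) (q - 1))

/-- The homotopy `[f, f'] : (f + f')^% ≃ f̂^% + f̂'^%`, on `(Ŵ^% C)_n`:
`θ ↦ (-1)^{n+1} T (f θ_{s+1} f'^*) = (-1)^{n+1} (f ⊗ f')(T θ_{s+1})`. -/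
def hatBracket {C D : Cx A} (n : ℤ) (f f' : Fam C D) (θ : HatC C) : HatC D :=
  fun s => ((n + 1).negOnePow : ℤ) • biMap f f' (T C (θ (s + 1)))

/-- The identification `(C^{0-*})_{q-n} = (C^{n-*})_q` of modules. -/
def dualShift (n : ℤ) (C : Cx A) (q : ℤ) : (dual 0 C).X (q - n) →ₗ[A] (dual n C).X q :=
  StarDual.map (C.XIsoOfEq (show n - q = 0 - (q - n) by ring)).hom.hom

/-- The `n`-fold suspension isomorphism `S^n : (Ŵ^% C^{0-*})_m → (Ŵ^% C^{n-*})_{m+n}`: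
`(S^n θ)_s = θ_{s-n}`, with the sign `(-1)^{nq}` on `x ⊗ y` for `y ∈ (C^{0-*})_q` that makes it a
chain map for the differential and the transposition of `C^{n-*}`. -/
def susp (n : ℤ) (C : Cx A) : HatC (dual 0 C) →+ HatC (dual n C) where
  toFun θ s p q := ((n * (q - n)).negOnePow : ℤ) •
    STensor.map (dualShift n C p) (dualShift n C q) (θ (s - n) (p - n) (q - n))
  map_zero' := by ext s p q; simp
  map_add' x y := by ext s p q; simp

/-- The family `C^{n-*}_i = C^{n-i} → C_j` obtained from `x` by the slant maps. -/
def slant₁ (n : ℤ) {C : Cx A} (x : Bi C) : Fam₁ (dual n C) C :=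
  fun i j => STensor.slant (x (n - i) j)

/-- The family `C^{n-*}_i = C^{n-i} → C_i` obtained from `x ∈ (C^t ⊗_A C)_n` by the slant maps. -/
def slant₀ (n : ℤ) {C : Cx A} (x : Bi C) : Fam (dual n C) C := fun i => slant₁ n x i i

/-! ### Functoriality of the untwisted `Q`-groups -/

theorem dBi_biMap {C D : Cx A} (f : C ⟶ D) (x : Bi C) :
    dBi D (biMap (fam f) (fam f) x) = biMap (fam f) (fam f) (dBi C x) := by
  have hc : ∀ (i j : ℤ) (y : C.X i), (D.d i j).hom ((f.f i).hom y) =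
      (f.f j).hom ((C.d i j).hom y) := fun i j y => by
    rw [← LinearMap.comp_apply, ← LinearMap.comp_apply, ← ModuleCat.hom_comp,
      ← ModuleCat.hom_comp, f.comm]
  ext p q
  have h1 : (STensor.map LinearMap.id (D.d (q + 1) q).hom).comp
        (STensor.map (fam f p) (fam f (q + 1))) =
      (STensor.map (fam f p) (fam f q)).comp (STensor.map LinearMap.id (C.d (q + 1) q).hom) :=
    STensor.hom_ext fun x y => by simp [fam, hc]
  have h2 : (STensor.map (D.d (p + 1) p).hom LinearMap.id).comp
        (STensor.map (fam f (p + 1)) (fam f q)) =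
      (STensor.map (fam f p) (fam f q)).comp (STensor.map (C.d (p + 1) p).hom LinearMap.id) :=
    STensor.hom_ext fun x y => by simp [fam, hc]
  have e1 := DFunLike.congr_fun h1 (x p (q + 1))
  have e2 := DFunLike.congr_fun h2 (x (p + 1) q)
  simp only [AddMonoidHom.comp_apply] at e1 e2
  simp only [dBi, biMap, AddMonoidHom.coe_mk, ZeroHom.coe_mk, map_add, map_zsmul, e1, e2]

theorem T_biMap {C D : Cx A} (f : Fam C D) (x : Bi C) :
    T D (biMap f f x) = biMap f f (T C x) := by
  ext p q
  have h1 : STensor.swap.comp (STensor.map (f q) (f p)) =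
      (STensor.map (f p) (f q)).comp STensor.swap :=
    STensor.hom_ext fun x y => by simp
  have e1 := DFunLike.congr_fun h1 (x q p)
  simp only [AddMonoidHom.comp_apply] at e1
  simp only [T, biMap, AddMonoidHom.coe_mk, ZeroHom.coe_mk, map_zsmul, e1]

theorem dSym_symPush {C D : Cx A} (n : ℤ) (f : C ⟶ D) (φ : SymC C) :
    dSym D n (symPush (fam f) φ) = symPush (fam f) (dSym C n φ) := by
  ext s : 1
  cases s <;>
  simp only [dSym, symPush, AddMonoidHom.coe_mk, ZeroHom.coe_mk, dBi_biMap, T_biMap, map_add,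
    map_zsmul]

theorem dHat_hatPush {C D : Cx A} (n : ℤ) (f : C ⟶ D) (θ : HatC C) :
    dHat D n (hatPush (fam f) θ) = hatPush (fam f) (dHat C n θ) := by
  ext s : 1
  simp only [dHat, hatPush, AddMonoidHom.coe_mk, ZeroHom.coe_mk, dBi_biMap, T_biMap, map_add,
    map_zsmul]

theorem symPush_mem {C D : Cx A} {n : ℤ} (f : Fam C D) {φ : SymC C} (h : φ ∈ symChains C n) :
    symPush f φ ∈ symChains D n := fun s p q hs => by
  simp [symPush, biMap, h s p q hs]

theorem hatPush_mem {C D : Cx A} {n : ℤ} (f : Fam C D) {θ : HatC C} (h : θ ∈ hatChains C n) :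
    hatPush f θ ∈ hatChains D n := fun s p q hs => by
  simp [hatPush, biMap, h s p q hs]

theorem symPush_cycles {C D : Cx A} (f : C ⟶ D) (n : ℤ) :
    ∀ φ ∈ symCycles C n, symPush (fam f) φ ∈ symCycles D n := by
  rintro φ ⟨h1, h2⟩
  have h2' : dSym C n φ = 0 := h2
  refine ⟨symPush_mem _ h1, ?_⟩
  change dSym D n _ = 0
  rw [dSym_symPush, h2', map_zero]

theorem hatPush_cycles {C D : Cx A} (f : C ⟶ D) (n : ℤ) :
    ∀ θ ∈ hatCycles C n, hatPush (fam f) θ ∈ hatCycles D n := by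
  rintro θ ⟨h1, h2⟩
  have h2' : dHat C n θ = 0 := h2
  refine ⟨hatPush_mem _ h1, ?_⟩
  change dHat D n _ = 0
  rw [dHat_hatPush, h2', map_zero]

/-- The morphism `f^% : Q^n(C) → Q^n(D)` induced by a chain map `f : C → D`. -/
def QSym.map {C D : Cx A} (f : C ⟶ D) (n : ℤ) : QSym C n →+ QSym D n :=
  QuotientAddGroup.map _ _
    (((symPush (fam f)).comp (symCycles C n).subtype).codRestrict (symCycles D n)
      (fun φ => symPush_cycles f n φ φ.2)) (by
    rintro ⟨φ, hφ⟩ ⟨ξ, hξ, e⟩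
    exact ⟨symPush (fam f) ξ, symPush_mem _ hξ, (dSym_symPush _ _ _).trans
      (congrArg (symPush (fam f)) e)⟩)

/-- The morphism `f̂^% : Q̂^n(C) → Q̂^n(D)` induced by a chain map `f : C → D`. -/
def QHat.map {C D : Cx A} (f : C ⟶ D) (n : ℤ) : QHat C n →+ QHat D n :=
  QuotientAddGroup.map _ _
    (((hatPush (fam f)).comp (hatCycles C n).subtype).codRestrict (hatCycles D n)
      (fun θ => hatPush_cycles f n θ θ.2)) (by
    rintro ⟨θ, hθ⟩ ⟨ν, hν, e⟩
    exact ⟨hatPush (fam f) ν, hatPush_mem _ hν, (dHat_hatPush _ _ _).trans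
      (congrArg (hatPush (fam f)) e)⟩)

/-! ### The maps between the untwisted `Q`-groups -/

theorem dHat_Jmap (C : Cx A) (n : ℤ) (φ : SymC C) :
    dHat C n (Jmap C φ) = Jmap C (dSym C n φ) := by
  ext s : 1
  rcases lt_or_ge s 0 with h | h
  · have h1 : ¬ (0 ≤ s) := by omega
    have h2 : ¬ (1 ≤ s) := by omega
    simp [dHat, Jmap, h1, h2]
  · obtain ⟨k, rfl⟩ := Int.eq_ofNat_of_zero_le h
    cases k with
    | zero => simp [dHat, Jmap, dSym]
    | succ k =>
      have h1 : n + ((k + 1 : ℕ) : ℤ) - 1 = n + k := by push_cast; ring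
      have h2 : ((k + 1 : ℕ) : ℤ) - 1 = k := by push_cast; ring
      have h3 : (0 : ℤ) ≤ ((k + 1 : ℕ) : ℤ) := by omega
      have h4 : (0 : ℤ) ≤ (k : ℤ) := by omega
      simp only [dHat, Jmap, dSym, AddMonoidHom.coe_mk, ZeroHom.coe_mk, h1, h2, h3, h4, if_true,
        Int.toNat_natCast]
      push_cast
      rfl

theorem Jmap_mem {C : Cx A} {n : ℤ} {φ : SymC C} (h : φ ∈ symChains C n) :
    Jmap C φ ∈ hatChains C n := fun s p q hs => by
  by_cases h0 : 0 ≤ s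
  · simp only [Jmap, AddMonoidHom.coe_mk, ZeroHom.coe_mk, h0, if_true]
    exact h _ p q (by rwa [Int.toNat_of_nonneg h0])
  · simp [Jmap, h0]

theorem Jmap_cycles (C : Cx A) (n : ℤ) : ∀ φ ∈ symCycles C n, Jmap C φ ∈ hatCycles C n := by
  rintro φ ⟨h1, h2⟩
  have h2' : dSym C n φ = 0 := h2
  refine ⟨Jmap_mem h1, ?_⟩
  change dHat C n _ = 0
  rw [dHat_Jmap, h2', map_zero]

/-- The morphism `J : Q^n(C) → Q̂^n(C)`. -/
def QSym.J (C : Cx A) (n : ℤ) : QSym C n →+ QHat C n :=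
  QuotientAddGroup.map _ _
    (((Jmap C).comp (symCycles C n).subtype).codRestrict (hatCycles C n)
      (fun φ => Jmap_cycles C n φ φ.2)) (by
    rintro ⟨φ, hφ⟩ ⟨ξ, hξ, e⟩
    exact ⟨Jmap C ξ, Jmap_mem hξ, (dHat_Jmap _ _ _).trans (congrArg (Jmap C) e)⟩)

theorem dQuad_Hmap (C : Cx A) (n : ℤ) (θ : HatC C) :
    dQuad C n (Hmap C θ) = Hmap C (dHat C (n + 1) θ) := by
  ext s : 1
  have h1 : -(((s + 1 : ℕ) : ℤ)) - 1 = -(s : ℤ) - 1 - 1 := by push_cast; ring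
  have h2 : n + 1 + (-(s : ℤ) - 1) - 1 = n - s - 1 := by ring
  have h3 : (-(s : ℤ) - 1).negOnePow = (s + 1 : ℤ).negOnePow := by
    rw [← Int.negOnePow_neg]; congr 1; ring
  simp only [dQuad, Hmap, dHat, AddMonoidHom.coe_mk, ZeroHom.coe_mk, h1, h2, h3]

theorem Hmap_mem {C : Cx A} {n : ℤ} {θ : HatC C} (h : θ ∈ hatChains C (n + 1)) :
    Hmap C θ ∈ quadChains C n := fun s p q hs => h _ p q (by omega)

theorem Hmap_cycles (C : Cx A) (n : ℤ) :
    ∀ θ ∈ hatCycles C (n + 1), Hmap C θ ∈ quadCycles C n := by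
  rintro θ ⟨h1, h2⟩
  have h2' : dHat C (n + 1) θ = 0 := h2
  refine ⟨Hmap_mem h1, ?_⟩
  change dQuad C n _ = 0
  rw [dQuad_Hmap, h2', map_zero]

/-- The morphism `H : Q̂^{n+1}(C) → Q_n(C)`. -/
def QHat.H (C : Cx A) (n : ℤ) : QHat C (n + 1) →+ QQuad C n :=
  QuotientAddGroup.map _ _
    (((Hmap C).comp (hatCycles C (n + 1)).subtype).codRestrict (quadCycles C n)
      (fun θ => Hmap_cycles C n θ θ.2)) (by
    rintro ⟨θ, hθ⟩ ⟨ν, hν, e⟩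
    exact ⟨Hmap C ν, Hmap_mem hν, (dQuad_Hmap _ _ _).trans (congrArg (Hmap C) e)⟩)

theorem T_T (C : Cx A) (x : Bi C) : T C (T C x) = x := by
  ext p q
  have h : STensor.swap.comp STensor.swap = AddMonoidHom.id (STensor A (C.X p) (C.X q)) :=
    STensor.hom_ext fun x y => by simp
  have e := DFunLike.congr_fun h (x p q)
  simp only [AddMonoidHom.comp_apply, AddMonoidHom.id_apply] at e
  simp only [T, AddMonoidHom.coe_mk, ZeroHom.coe_mk, map_zsmul, e, smul_smul, mul_comm q p]
  simp [← Units.val_mul]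

theorem T_dBi (C : Cx A) (x : Bi C) : T C (dBi C x) = dBi C (T C x) := by
  ext p q
  have h1 : STensor.swap.comp (STensor.map LinearMap.id (C.d (p + 1) p).hom) =
      (STensor.map (C.d (p + 1) p).hom LinearMap.id).comp
        (STensor.swap (M := C.X q) (N := C.X (p + 1))) :=
    STensor.hom_ext fun x y => by simp
  have h2 : STensor.swap.comp (STensor.map (C.d (q + 1) q).hom LinearMap.id) =
      (STensor.map LinearMap.id (C.d (q + 1) q).hom).comp
        (STensor.swap (M := C.X (q + 1)) (N := C.X p)) :=
    STensor.hom_ext fun x y => by simp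
  have e1 := DFunLike.congr_fun h1 (x q (p + 1))
  have e2 := DFunLike.congr_fun h2 (x (q + 1) p)
  simp only [AddMonoidHom.comp_apply] at e1 e2
  have k1 : q.negOnePow * ((p + 1) * q).negOnePow = (p * q).negOnePow := by
    rw [← Int.negOnePow_add, show q + (p + 1) * q = p * q + 2 * q by ring, Int.negOnePow_add,
      Int.negOnePow_two_mul, mul_one]
  have k2 : (p * (q + 1)).negOnePow = (p * q).negOnePow * p.negOnePow := by
    rw [← Int.negOnePow_add]; congr 1; ring
  simp only [T, dBi, AddMonoidHom.coe_mk, ZeroHom.coe_mk, map_zsmul, map_add, smul_add, e1, e2,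
    smul_smul, ← Units.val_mul, k1, k2]
  abel

theorem dSym_onePlusT (C : Cx A) (n : ℤ) (ψ : SymC C) :
    dSym C n (onePlusT C ψ) = onePlusT C (dQuad C n ψ) := by
  ext s : 1
  rcases s with _ | _ | s
  · simp only [dSym, onePlusT, dQuad, AddMonoidHom.coe_mk, ZeroHom.coe_mk, if_true, map_add,
      map_zsmul, T_T, T_dBi]
    simp
    abel
  · simp [dSym, onePlusT, dQuad, T_T]
  · simp [dSym, onePlusT, dQuad]

theorem onePlusT_mem {C : Cx A} {n : ℤ} {ψ : SymC C} (h : ψ ∈ quadChains C n) :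
    onePlusT C ψ ∈ symChains C n := fun s p q hs => by
  by_cases h0 : s = 0
  · subst h0
    have h1 := h 0 p q (by simpa using hs)
    have h2 := h 0 q p (by simpa [add_comm] using hs)
    simp [onePlusT, T, h1, h2]
  · simp [onePlusT, h0]

theorem onePlusT_cycles (C : Cx A) (n : ℤ) :
    ∀ ψ ∈ quadCycles C n, onePlusT C ψ ∈ symCycles C n := by
  rintro ψ ⟨h1, h2⟩
  have h2' : dQuad C n ψ = 0 := h2
  refine ⟨onePlusT_mem h1, ?_⟩
  change dSym C n _ = 0
  rw [dSym_onePlusT, h2', map_zero]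

/-- The symmetrization morphism `1 + T : Q_n(C) → Q^n(C)`. -/
def QQuad.symmetrize (C : Cx A) (n : ℤ) : QQuad C n →+ QSym C n :=
  QuotientAddGroup.map _ _
    (((onePlusT C).comp (quadCycles C n).subtype).codRestrict (symCycles C n)
      (fun ψ => onePlusT_cycles C n ψ ψ.2)) (by
    rintro ⟨ψ, hψ⟩ ⟨χ, hχ, e⟩
    exact ⟨onePlusT C χ, onePlusT_mem hχ, (dSym_onePlusT _ _ _).trans
      (congrArg (onePlusT C) e)⟩)

/-! ### Chain bundles -/

/-- A chain bundle `(C, γ)`: a finite-dimensional chain complex `C` with a `0`-dimensional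
hyperquadratic structure `γ` on `C^{0-*}`. -/
structure ChainBundle (A : Type u) [Ring A] [StarRing A] where
  C : Cx A
  finiteDim : FiniteDim C
  γ : HatC (dual 0 C)
  γ_mem : γ ∈ hatCycles (dual 0 C) 0

/-- The chain bundle `(C, 0)`. -/
def ChainBundle.zero (C : Cx A) (hC : FiniteDim C) : ChainBundle A where
  C := C
  finiteDim := hC
  γ := 0
  γ_mem := zero_mem _

/-- The pullback `f^* : Ŵ^% D^{0-*} → Ŵ^% C^{0-*}` along a chain map `f : C → D`. -/
def pullback {C D : Cx A} (f : C ⟶ D) : HatC (dual 0 D) →+ HatC (dual 0 C) :=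
  hatPush (fam (dualMap 0 f))

theorem pullback_id (C : Cx A) (θ : HatC (dual 0 C)) : pullback (𝟙 C) θ = θ := by
  ext s p q
  have h : STensor.map (fam (dualMap 0 (𝟙 C)) p) (fam (dualMap 0 (𝟙 C)) q) =
      AddMonoidHom.id _ := STensor.hom_ext fun x y => rfl
  exact DFunLike.congr_fun h (θ s p q)

theorem pullback_comp {C D E : Cx A} (f : C ⟶ D) (g : D ⟶ E) (θ : HatC (dual 0 E)) :
    pullback (f ≫ g) θ = pullback f (pullback g θ) := by
  ext s p q
  have h : STensor.map (fam (dualMap 0 (f ≫ g)) p) (fam (dualMap 0 (f ≫ g)) q) =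
      (STensor.map (fam (dualMap 0 f) p) (fam (dualMap 0 f) q)).comp
        (STensor.map (fam (dualMap 0 g) p) (fam (dualMap 0 g) q)) :=
    STensor.hom_ext fun x y => rfl
  exact DFunLike.congr_fun h (θ s p q)

/-- A map of chain bundles `(f, χ) : (C, γ) → (C', γ')`: a chain map `f : C → C'` and an
equivalence `χ : γ → f^* γ'`, that is `f^* γ' - γ = d(χ)`. -/
structure BundleHom (B B' : ChainBundle A) where
  f : B.C ⟶ B'.C
  χ : HatC (dual 0 B.C)
  χ_mem : χ ∈ hatChains (dual 0 B.C) 1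
  eq : pullback f B'.γ - B.γ = dHat (dual 0 B.C) 1 χ

/-- The identity map of a chain bundle. -/
def BundleHom.id (B : ChainBundle A) : BundleHom B B where
  f := 𝟙 B.C
  χ := 0
  χ_mem := zero_mem _
  eq := by rw [pullback_id, sub_self, map_zero]

/-- The composite `(f', χ')(f, χ) = (f' f, χ + f^* χ')` of chain bundle maps. -/
def BundleHom.comp {B B' B'' : ChainBundle A} (v : BundleHom B' B'') (u : BundleHom B B') :
    BundleHom B B'' where
  f := u.f ≫ v.f
  χ := u.χ + pullback u.f v.χ
  χ_mem := add_mem u.χ_mem (hatPush_mem _ v.χ_mem)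
  eq := by
    have h : dHat (dual 0 B.C) 1 (pullback u.f v.χ) =
        pullback u.f (dHat (dual 0 B'.C) 1 v.χ) := dHat_hatPush 1 (dualMap 0 u.f) v.χ
    rw [map_add, h, ← u.eq, ← v.eq, map_sub, pullback_comp]
    abel

/-- The chain homotopy `f^* ≃ f'^* : D^{0-*} → C^{0-*}` dual to `g : f ≃ f' : C → D`. It is
`(-1)^{i+1} g^*` on `(D^{0-*})_i`. -/
def dualHtpy {C D : Cx A} (g : ∀ i j : ℤ, C.X i ⟶ D.X j) : Fam₁ (dual 0 D) (dual 0 C) :=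
  fun i j => ((i + 1).negOnePow : ℤ) • StarDual.map (g (0 - j) (0 - i)).hom

/-- Homotopy of chain bundle maps `(g, η) : (f, χ) ≃ (f', χ')`: a chain homotopy
`g : f ≃ f'`, with `f' - f = dg + gd`, and `η` with
`χ - χ' + (g^*; f^*, f'^*)^%(γ') = d(η)`. -/
def BundleHom.Homotopic {B B' : ChainBundle A} (u v : BundleHom B B') : Prop :=
  ∃ (g : Homotopy v.f u.f) (η : HatC (dual 0 B.C)), η ∈ hatChains (dual 0 B.C) 2 ∧
    u.χ - v.χ +
      hatHtpy 0 (dualHtpy g.hom) (fam (dualMap 0 u.f)) (fam (dualMap 0 v.f)) B'.γ =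
        dHat (dual 0 B.C) 2 η

/-- Equivalences of chain bundles: the maps with a homotopy inverse. -/
def BundleHom.IsEquiv {B B' : ChainBundle A} (u : BundleHom B B') : Prop :=
  ∃ v : BundleHom B' B, (v.comp u).Homotopic (BundleHom.id B) ∧
    (u.comp v).Homotopic (BundleHom.id B')

/-! ### The twisted quadratic `Q`-groups -/

/-- An `n`-dimensional symmetric structure `(φ, θ)` on a chain bundle `(C, γ)`: an
`n`-dimensional symmetric structure `φ` on `C` and a chain `θ ∈ (Ŵ^% C)_{n+1}` with
`J(φ) - (φ_0)^%(S^n γ) = d(θ)`. -/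
structure SymStr (B : ChainBundle A) (n : ℤ) where
  φ : SymC B.C
  φ_mem : φ ∈ symCycles B.C n
  θ : HatC B.C
  θ_mem : θ ∈ hatChains B.C (n + 1)
  eq : Jmap B.C φ - hatPush (slant₀ n (φ 0)) (susp n B.C B.γ) = dHat B.C (n + 1) θ

/-- Equivalence `(ξ, η) : (φ, θ) → (φ', θ')` of symmetric structures on a chain bundle:
`φ' - φ = d(ξ)` and `θ - θ' + J(ξ) - (ξ_0; φ_0, φ'_0)^%(S^n γ) = d(η)`. -/
def SymStr.Equivalent {B : ChainBundle A} {n : ℤ} (x y : SymStr B n) : Prop :=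
  ∃ ξ ∈ symChains B.C (n + 1), ∃ η ∈ hatChains B.C (n + 2),
    y.φ - x.φ = dSym B.C (n + 1) ξ ∧
    x.θ - y.θ + Jmap B.C ξ -
      hatHtpy n (slant₁ n (ξ 0)) (slant₀ n (x.φ 0)) (slant₀ n (y.φ 0)) (susp n B.C B.γ) =
        dHat B.C (n + 2) η

/-- The set `Q_n(C, γ)` of equivalence classes of `n`-dimensional symmetric structures
on `(C, γ)`. -/
def QTw (B : ChainBundle A) (n : ℤ) : Type u := Quot (SymStr.Equivalent (B := B) (n := n))

/-- The equivalence class of a symmetric structure on a chain bundle. -/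
def QTw.mk {B : ChainBundle A} {n : ℤ} (x : SymStr B n) : QTw B n := Quot.mk _ x

/-- The chain `[φ_0, φ'_0](S^n γ)`. -/
def bracket (B : ChainBundle A) (n : ℤ) (φ φ' : SymC B.C) : HatC B.C :=
  hatBracket n (slant₀ n (φ 0)) (slant₀ n (φ' 0)) (susp n B.C B.γ)

/-- The chain `(f φ_0)^%(S^n χ)`, for a map of chain bundles `(f, χ) : (C, γ) → (C', γ')`. -/
def BundleHom.twist {B B' : ChainBundle A} (u : BundleHom B B') (n : ℤ) (φ : SymC B.C) :
    HatC B'.C :=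
  hatPush (fun i => (fam u.f i).comp (slant₀ n (φ 0) i)) (susp n B.C u.χ)

/-- The hyperquadratic chain `θ` of a quadratic chain `ψ ∈ (W_% C)_n`:
`θ_s = (-1)^n ψ_{-s-1}` for `s ≤ -1` and `θ_s = 0` for `s ≥ 0`. -/
def quadToHat (C : Cx A) (n : ℤ) (ψ : SymC C) : HatC C :=
  fun s => if s < 0 then (n.negOnePow : ℤ) • ψ (-s - 1).toNat else 0

end AlgSurgery

namespace AlgSurgery

variable {A : Type u} [Ring A] [StarRing A]

/-! ### Functoriality of the tensor product and of the slant map. -/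

section Modules

variable {M N M' N' M'' N'' : Type u} [AddCommGroup M] [Module A M] [AddCommGroup N] [Module A N]
  [AddCommGroup M'] [Module A M'] [AddCommGroup N'] [Module A N']
  [AddCommGroup M''] [Module A M''] [AddCommGroup N''] [Module A N'']

/-! Write Γ for S^n γ. A symmetric structure on (C, γ) is a cycle φ together with a null-homology θ
of J(φ) - (φ_0)^%(Γ), so Q_n(C, γ) behaves like the homology of the mapping cone of J_γ. The
difficulty is that φ_0 ↦ (φ_0)^% is quadratic, so J_γ is not additive on chains. The proof controls
how f^% depends on f. To first order, `dHat_hatBracket` says that [f, f'] bounds the failure of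
additivity, and `dHat_hatHtpy` that a homotopy of f gives a homotopy of f^%. To second order, three
chains compare these: g ⊗ g' joins consecutive homotopies (`dHat_hatConcat`), g ⊗ k moves a bracket
along a homotopy (`dHat_hatBracketHtpy`), and f ⊗ f' interchanges the arguments of a bracket
(`dHat_hatBracketSwap`). They give, respectively, the equivalence relation, the well-definedness of
the sum and its commutativity. The bracket is strictly biadditive, so associativity, zero and
negatives already hold for structures, not merely for classes.

Exactness at Q_n(C, γ) and at Q^n(C) is close to the definitions. At Q̂^{n+1}(C), an equivalence
from (0, θ) to 0 is given by an (n+1)-cycle ξ, whose ξ_0 is a homotopy from 0 to 0 of maps C^{n-*} →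
C. One has to see that (ξ_0; 0, 0)^%(S^n γ) agrees with -(ξ_0)^%(S^{n+1} γ) up to a boundary. Their
difference is, up to sign, (ξ_0 ⊗ ξ_0)(1 + T) applied to Γ shifted by one, and this bounds the chain
that keeps only the even-indexed terms of (ξ_0 ⊗ ξ_0)(Γ) (`dHat_bothOp_even`,
`hatPush_slant_Γ_succ_eq`).

Covariance rests on f^*(S^n γ') = S^n γ + d(S^n χ) (`BundleHom.hatPush_Γ`). For homotopy invariance,
the homotopy from f φ_0 f^* to f' φ_0 f'^* is split into g φ_0 f^* followed by f' φ_0 g^*.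
Equivalences then induce isomorphisms by functoriality alone.

For γ = 0 the cone of J is an honest cone. Since J is the inclusion of the part s ≥ 0, it is
computed by the part s < 0, which `Hmap` identifies with the quadratic complex. -/

theorem STensor.map_map (f : M →ₗ[A] M') (g : N →ₗ[A] N') (f' : M' →ₗ[A] M'')
    (g' : N' →ₗ[A] N'') (x : STensor A M N) :
    STensor.map f' g' (STensor.map f g x) = STensor.map (f' ∘ₗ f) (g' ∘ₗ g) x :=
  DFunLike.congr_fun (STensor.hom_ext (F := (STensor.map f' g').comp (STensor.map f g))
    (F' := STensor.map (f' ∘ₗ f) (g' ∘ₗ g)) fun _ _ => rfl) x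

theorem STensor.map_add_left (f f' : M →ₗ[A] M') (g : N →ₗ[A] N') (x : STensor A M N) :
    STensor.map (f + f') g x = STensor.map f g x + STensor.map f' g x :=
  DFunLike.congr_fun (STensor.hom_ext (F' := STensor.map f g + STensor.map f' g)
    fun _ _ => STensor.add_tmul _ _ _) x

theorem STensor.map_add_right (f : M →ₗ[A] M') (g g' : N →ₗ[A] N') (x : STensor A M N) :
    STensor.map f (g + g') x = STensor.map f g x + STensor.map f g' x :=
  DFunLike.congr_fun (STensor.hom_ext (F' := STensor.map f g + STensor.map f g')
    fun _ _ => STensor.tmul_add _ _ _) x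

theorem STensor.map_zero_left (g : N →ₗ[A] N') (x : STensor A M N) :
    STensor.map (0 : M →ₗ[A] M') g x = 0 := by
  have h := STensor.map_add_left (0 : M →ₗ[A] M') 0 g x
  rwa [add_zero, left_eq_add] at h

theorem STensor.map_zero_right (f : M →ₗ[A] M') (x : STensor A M N) :
    STensor.map f (0 : N →ₗ[A] N') x = 0 := by
  have h := STensor.map_add_right f (0 : N →ₗ[A] N') 0 x
  rwa [add_zero, left_eq_add] at h

theorem STensor.map_neg_left (f : M →ₗ[A] M') (g : N →ₗ[A] N') (x : STensor A M N) :
    STensor.map (-f) g x = -STensor.map f g x := by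
  rw [eq_neg_iff_add_eq_zero, ← STensor.map_add_left, neg_add_cancel, STensor.map_zero_left]

theorem STensor.map_neg_right (f : M →ₗ[A] M') (g : N →ₗ[A] N') (x : STensor A M N) :
    STensor.map f (-g) x = -STensor.map f g x := by
  rw [eq_neg_iff_add_eq_zero, ← STensor.map_add_right, neg_add_cancel, STensor.map_zero_right]

theorem STensor.map_sub_left (f f' : M →ₗ[A] M') (g : N →ₗ[A] N') (x : STensor A M N) :
    STensor.map (f - f') g x = STensor.map f g x - STensor.map f' g x := by
  rw [sub_eq_add_neg, STensor.map_add_left, STensor.map_neg_left, sub_eq_add_neg]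

theorem STensor.map_sub_right (f : M →ₗ[A] M') (g g' : N →ₗ[A] N') (x : STensor A M N) :
    STensor.map f (g - g') x = STensor.map f g x - STensor.map f g' x := by
  rw [sub_eq_add_neg, STensor.map_add_right, STensor.map_neg_right, sub_eq_add_neg]

theorem STensor.map_units_smul_left (e : ℤˣ) (f : M →ₗ[A] M') (g : N →ₗ[A] N')
    (x : STensor A M N) : STensor.map ((e : ℤ) • f) g x = (e : ℤ) • STensor.map f g x := by
  rcases Int.units_eq_one_or e with rfl | rfl <;> simp [STensor.map_neg_left]

theorem STensor.map_units_smul_right (e : ℤˣ) (f : M →ₗ[A] M') (g : N →ₗ[A] N')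
    (x : STensor A M N) : STensor.map f ((e : ℤ) • g) x = (e : ℤ) • STensor.map f g x := by
  rcases Int.units_eq_one_or e with rfl | rfl <;> simp [STensor.map_neg_right]

theorem STensor.swap_map (f : M →ₗ[A] M') (g : N →ₗ[A] N') (x : STensor A M N) :
    STensor.swap (STensor.map f g x) = STensor.map g f (STensor.swap x) :=
  DFunLike.congr_fun (STensor.hom_ext (F := STensor.swap.comp (STensor.map f g))
    (F' := (STensor.map g f).comp STensor.swap) fun _ _ => rfl) x

theorem STensor.slant_map (f : M →ₗ[A] M') (g : N →ₗ[A] N') (x : STensor A M N) :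
    STensor.slant (STensor.map f g x) = g ∘ₗ STensor.slant x ∘ₗ StarDual.map f := by
  have h := DFunLike.congr_fun (STensor.hom_ext
    (F := STensor.slant.comp (STensor.map f g))
    (F' := (AddMonoidHom.mk' (fun z : StarDual A M →ₗ[A] N => g ∘ₗ z ∘ₗ StarDual.map f)
      (fun a b => by ext; simp)).comp STensor.slant)
    fun a b => by ext z; simp) x
  exact h

end Modules

/-! ### Degree one operators -/

variable {C D E : Cx A}

/-- The families that commute with the differentials. -/
def IsChainFam (f : Fam C D) : Prop :=
  ∀ i, (D.d (i + 1) i).hom ∘ₗ f (i + 1) = f i ∘ₗ (C.d (i + 1) i).hom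

/-- The chain homotopies `g : f ≃ f'`, that is `f' - f = d g + g d`. -/
def IsHtpyFam (g : Fam₁ C D) (f f' : Fam C D) : Prop :=
  ∀ i, f' i - f i = (D.d (i + 1) i).hom ∘ₗ g i (i + 1) + g (i - 1) i ∘ₗ (C.d i (i - 1)).hom

theorem dBi_apply (x : Bi C) (p q : ℤ) : dBi C x p q =
    STensor.map LinearMap.id (C.d (q + 1) q).hom (x p (q + 1)) +
    (q.negOnePow : ℤ) • STensor.map (C.d (p + 1) p).hom LinearMap.id (x (p + 1) q) := rfl

theorem T_apply (x : Bi C) (p q : ℤ) :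
    T C x p q = ((p * q).negOnePow : ℤ) • STensor.swap (x q p) := rfl

theorem biMap_apply (f f' : Fam C D) (x : Bi C) (p q : ℤ) :
    biMap f f' x p q = STensor.map (f p) (f' q) (x p q) := rfl

/-- The operator `f ⊗ g` for `f` of degree `0` and `g` of degree `1`. -/
def rightOp (f : Fam C D) (g : Fam₁ C D) : Bi C →+ Bi D where
  toFun x p q := STensor.map (f p) (g (q - 1) q) (x p (q - 1))
  map_zero' := by ext p q; simp
  map_add' x y := by ext p q; simp

/-- The operator `g ⊗ f` for `f` of degree `0` and `g` of degree `1`. -/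
def leftOp (g : Fam₁ C D) (f : Fam C D) : Bi C →+ Bi D where
  toFun x p q := (q.negOnePow : ℤ) • STensor.map (g (p - 1) p) (f q) (x (p - 1) q)
  map_zero' := by ext p q; simp
  map_add' x y := by ext p q; simp

/-- The operator `g ⊗ h` for `g` and `h` of degree `1`. -/
def bothOp (g h : Fam₁ C D) : Bi C →+ Bi D where
  toFun x p q := ((q - 1).negOnePow : ℤ) •
    STensor.map (g (p - 1) p) (h (q - 1) q) (x (p - 1) (q - 1))
  map_zero' := by ext p q; simp
  map_add' x y := by ext p q; simp

theorem rightOp_apply (f : Fam C D) (g : Fam₁ C D) (x : Bi C) (p q : ℤ) :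
    rightOp f g x p q = STensor.map (f p) (g (q - 1) q) (x p (q - 1)) := rfl

theorem leftOp_apply (g : Fam₁ C D) (f : Fam C D) (x : Bi C) (p q : ℤ) :
    leftOp g f x p q = (q.negOnePow : ℤ) • STensor.map (g (p - 1) p) (f q) (x (p - 1) q) := rfl

theorem bothOp_apply (g h : Fam₁ C D) (x : Bi C) (p q : ℤ) :
    bothOp g h x p q = ((q - 1).negOnePow : ℤ) •
      STensor.map (g (p - 1) p) (h (q - 1) q) (x (p - 1) (q - 1)) := rfl

theorem dBi_biMap' {f f' : Fam C D} (hf : IsChainFam f) (hf' : IsChainFam f') (x : Bi C) :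
    dBi D (biMap f f' x) = biMap f f' (dBi C x) := by
  ext p q
  simp only [dBi_apply, biMap_apply, map_add, map_zsmul, STensor.map_map, LinearMap.id_comp,
    LinearMap.comp_id, hf p, hf' q]

theorem T_biMap' (f f' : Fam C D) (x : Bi C) :
    T D (biMap f f' x) = biMap f' f (T C x) := by
  ext p q
  simp only [T_apply, biMap_apply, map_zsmul, STensor.swap_map]

theorem dBi_rightOp {f k k' : Fam C D} {g : Fam₁ C D} (hf : IsChainFam f)
    (hg : IsHtpyFam g k k') (x : Bi C) :
    dBi D (rightOp f g x) = biMap f (k' - k) x - rightOp f g (dBi C x) := by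
  ext p q
  -- The indices `q + 1 - 1` and `q - 1 + 1` are left unsimplified because the expansion of the two
  -- differentials produces them in exactly this form, inside dependent types.
  have e1 : STensor.map (f p) ((k' - k) q) (x p q) =
      STensor.map (f p) ((D.d (q + 1) q).hom ∘ₗ g (q + 1 - 1) (q + 1)) (x p (q + 1 - 1)) +
      STensor.map (f p) (g (q - 1) q ∘ₗ (C.d (q - 1 + 1) (q - 1)).hom) (x p (q - 1 + 1)) := by
    rw [add_sub_cancel_right, sub_add_cancel, ← STensor.map_add_right, ← hg]; rfl
  simp only [Pi.sub_apply] at *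
  simp only [dBi_apply, rightOp_apply, biMap_apply, map_add, map_zsmul, STensor.map_map,
    LinearMap.id_comp, LinearMap.comp_id, hf p, e1, Pi.sub_apply]
  simp [Int.negOnePow_sub]; abel

theorem T_rightOp (f : Fam C D) (g : Fam₁ C D) (x : Bi C) :
    T D (rightOp f g x) = leftOp g f (T C x) := by
  ext p q
  simp only [T_apply, rightOp_apply, leftOp_apply, map_zsmul, STensor.swap_map, smul_smul,
    ← Units.val_mul, ← Int.negOnePow_add]
  congr 3; ring

theorem T_leftOp (f : Fam C D) (g : Fam₁ C D) (x : Bi C) :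
    T D (leftOp g f x) = rightOp f g (T C x) := by
  rw [← T_T C x, ← T_rightOp, T_T, T_T]

/-- Conjugation by `T` turns this into the formula for f ⊗ g. -/
theorem dBi_leftOp {f k k' : Fam C D} {g : Fam₁ C D} (hf : IsChainFam f)
    (hg : IsHtpyFam g k k') (x : Bi C) :
    dBi D (leftOp g f x) = biMap (k' - k) f x - leftOp g f (dBi C x) := by
  rw [← T_T C x, ← T_rightOp, ← T_dBi, dBi_rightOp hf hg, map_sub, T_biMap', T_rightOp, T_dBi]

/-- Interchanging two operators of degree one costs a sign. This sign is what makes the odd case of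
`dHat_bothOp_even` work. -/
theorem T_bothOp (g h : Fam₁ C D) (x : Bi C) :
    T D (bothOp g h x) = -bothOp h g (T C x) := by
  ext p q
  simp only [T_apply, bothOp_apply, map_zsmul, STensor.swap_map, smul_smul,
    ← Units.val_mul, ← Int.negOnePow_add, Pi.neg_apply, ← neg_smul, ← Units.val_neg]
  congr 2
  rw [← neg_one_mul, ← Int.negOnePow_one, ← Int.negOnePow_add, Int.negOnePow_eq_iff]
  ring_nf
  exact ⟨p - 1, by ring⟩

/-- The Leibniz rule for two operators of degree one. The two degree-one terms it leaves over are
the source of the second order homotopies. -/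
theorem dBi_bothOp {f f' k k' : Fam C D} {g h : Fam₁ C D} (hg : IsHtpyFam g f f')
    (hh : IsHtpyFam h k k') (x : Bi C) :
    dBi D (bothOp g h x) = bothOp g h (dBi C x) + leftOp g (k' - k) x - rightOp (f' - f) h x := by
  ext p q
  have e1 : STensor.map (g (p - 1) p) ((k' - k) q) (x (p - 1) q) =
      STensor.map (g (p - 1) p) ((D.d (q + 1) q).hom ∘ₗ h (q + 1 - 1) (q + 1))
        (x (p - 1) (q + 1 - 1)) +
      STensor.map (g (p - 1) p) (h (q - 1) q ∘ₗ (C.d (q - 1 + 1) (q - 1)).hom)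
        (x (p - 1) (q - 1 + 1)) := by
    rw [add_sub_cancel_right, sub_add_cancel, ← STensor.map_add_right, ← hh]; rfl
  have e2 : STensor.map ((f' - f) p) (h (q - 1) q) (x p (q - 1)) =
      STensor.map ((D.d (p + 1) p).hom ∘ₗ g (p + 1 - 1) (p + 1)) (h (q - 1) q)
        (x (p + 1 - 1) (q - 1)) +
      STensor.map (g (p - 1) p ∘ₗ (C.d (p - 1 + 1) (p - 1)).hom) (h (q - 1) q)
        (x (p - 1 + 1) (q - 1)) := by
    rw [add_sub_cancel_right, sub_add_cancel, ← STensor.map_add_left, ← hg]; rfl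
  simp only [Pi.sub_apply, Pi.add_apply] at *
  simp only [dBi_apply, rightOp_apply, leftOp_apply, bothOp_apply, map_add, map_zsmul,
    STensor.map_map, LinearMap.id_comp, LinearMap.comp_id, e1, e2, Pi.sub_apply]
  rcases Int.units_eq_one_or q.negOnePow with hq | hq <;>
    simp [Int.negOnePow_sub, hq] <;> abel

/-! ### Chain level identities for the hyperquadratic complexes -/

variable {C D E : Cx A}

/-! ### Additivity of the tensor operators in each family. -/

section Additivity

variable (f f' k : Fam C D) (g g' h : Fam₁ C D) (x : Bi C)

theorem biMap_add_left : biMap (f + f') k x = biMap f k x + biMap f' k x := by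
  ext p q; exact STensor.map_add_left _ _ _ _

theorem biMap_add_right : biMap k (f + f') x = biMap k f x + biMap k f' x := by
  ext p q; exact STensor.map_add_right _ _ _ _

theorem biMap_sub_left : biMap (f - f') k x = biMap f k x - biMap f' k x := by
  ext p q; exact STensor.map_sub_left _ _ _ _

theorem biMap_sub_right : biMap k (f - f') x = biMap k f x - biMap k f' x := by
  ext p q; exact STensor.map_sub_right _ _ _ _

theorem rightOp_add_left : rightOp (f + f') g x = rightOp f g x + rightOp f' g x := by
  ext p q; exact STensor.map_add_left _ _ _ _

theorem rightOp_add_right : rightOp f (g + g') x = rightOp f g x + rightOp f g' x := by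
  ext p q; exact STensor.map_add_right _ _ _ _

theorem rightOp_sub_left : rightOp (f - f') g x = rightOp f g x - rightOp f' g x := by
  ext p q; exact STensor.map_sub_left _ _ _ _

theorem leftOp_add_left : leftOp (g + g') f x = leftOp g f x + leftOp g' f x := by
  ext p q; simp [leftOp_apply, STensor.map_add_left]

theorem leftOp_add_right : leftOp g (f + f') x = leftOp g f x + leftOp g f' x := by
  ext p q; simp [leftOp_apply, STensor.map_add_right]

theorem leftOp_sub_right : leftOp g (f - f') x = leftOp g f x - leftOp g f' x := by
  ext p q; simp [leftOp_apply, STensor.map_sub_right, smul_sub]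

theorem bothOp_add_left : bothOp (g + g') h x = bothOp g h x + bothOp g' h x := by
  ext p q; simp [bothOp_apply, STensor.map_add_left]

theorem bothOp_add_right : bothOp h (g + g') x = bothOp h g x + bothOp h g' x := by
  ext p q; simp [bothOp_apply, STensor.map_add_right]

theorem rightOp_zero_left : rightOp 0 g x = 0 := by
  ext p q; exact STensor.map_zero_left _ _

theorem rightOp_zero_right : rightOp f 0 x = 0 := by
  ext p q; exact STensor.map_zero_right _ _

theorem leftOp_zero_left : leftOp 0 f x = 0 := by
  ext p q; simp [leftOp_apply, STensor.map_zero_left]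

theorem leftOp_zero_right : leftOp g 0 x = 0 := by
  ext p q; simp [leftOp_apply, STensor.map_zero_right]

theorem bothOp_zero_left : bothOp 0 g x = 0 := by
  ext p q; simp [bothOp_apply, STensor.map_zero_left]

theorem biMap_zero_left : biMap 0 f x = 0 := by
  ext p q; exact STensor.map_zero_left _ _

end Additivity

theorem dHat_apply (n : ℤ) (θ : HatC C) (s : ℤ) : dHat C n θ s = dBi C (θ s) +
    ((n + s - 1).negOnePow : ℤ) • (θ (s - 1) + (s.negOnePow : ℤ) • T C (θ (s - 1))) := rfl

theorem hatPush_apply (f : Fam C D) (θ : HatC C) (s : ℤ) :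
    hatPush f θ s = biMap f f (θ s) := rfl

theorem hatHtpy_apply (n : ℤ) (g : Fam₁ C D) (f f' : Fam C D) (θ : HatC C) (s : ℤ) :
    hatHtpy n g f f' θ s = rightOp f g (θ s) + leftOp g f' (θ s) +
      (n.negOnePow : ℤ) • bothOp g g (T C (θ (s - 1))) := by
  ext p q
  simp only [hatHtpy, Pi.add_apply, Pi.smul_apply, rightOp_apply, leftOp_apply, bothOp_apply,
    smul_smul, ← Units.val_mul, ← Int.negOnePow_add]
  congr 4; ring

theorem hatBracket_apply (n : ℤ) (f f' : Fam C D) (θ : HatC C) (s : ℤ) :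
    hatBracket n f f' θ s = ((n + 1).negOnePow : ℤ) • biMap f f' (T C (θ (s + 1))) := rfl

theorem hatHtpy_add (n : ℤ) (g : Fam₁ C D) (f f' : Fam C D) (θ θ' : HatC C) :
    hatHtpy n g f f' (θ + θ') = hatHtpy n g f f' θ + hatHtpy n g f f' θ' := by
  ext s : 1
  simp only [hatHtpy_apply, Pi.add_apply, map_add, smul_add]; abel

theorem hatHtpy_zero (n : ℤ) (g : Fam₁ C D) (f f' : Fam C D) :
    hatHtpy n g f f' (0 : HatC C) = 0 := by
  ext s : 1
  simp only [hatHtpy_apply, Pi.zero_apply, map_zero, smul_zero, add_zero]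

theorem hatHtpy_sub (n : ℤ) (g : Fam₁ C D) (f f' : Fam C D) (θ θ' : HatC C) :
    hatHtpy n g f f' (θ - θ') = hatHtpy n g f f' θ - hatHtpy n g f f' θ' := by
  rw [eq_sub_iff_add_eq, ← hatHtpy_add, sub_add_cancel]

theorem hatHtpy_zero_fam (n : ℤ) (f f' : Fam C D) (θ : HatC C) :
    hatHtpy n 0 f f' θ = 0 := by
  ext s : 1
  simp only [hatHtpy_apply, rightOp_zero_right, leftOp_zero_left, bothOp_zero_left, smul_zero,
    add_zero, Pi.zero_apply]

theorem hatBracket_add (n : ℤ) (f f' : Fam C D) (θ θ' : HatC C) :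
    hatBracket n f f' (θ + θ') = hatBracket n f f' θ + hatBracket n f f' θ' := by
  ext s : 1
  simp only [hatBracket_apply, Pi.add_apply, map_add, smul_add]

theorem hatBracket_zero (n : ℤ) (f f' : Fam C D) : hatBracket n f f' (0 : HatC C) = 0 := by
  ext s : 1
  simp only [hatBracket_apply, Pi.zero_apply, map_zero, smul_zero]

theorem hatPush_zero_fam (θ : HatC C) : hatPush (0 : Fam C D) θ = 0 := by
  ext s : 1
  exact biMap_zero_left _ _

/-- The map f^% is quadratic in f, hence even. -/
theorem hatPush_neg_fam (f : Fam C D) (θ : HatC C) : hatPush (-f) θ = hatPush f θ := by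
  ext s p q
  simp [hatPush_apply, biMap_apply, STensor.map_neg_left, STensor.map_neg_right]

theorem dHat_hatPush' (n : ℤ) {f : Fam C D} (hf : IsChainFam f) (θ : HatC C) :
    dHat D n (hatPush f θ) = hatPush f (dHat C n θ) := by
  ext s : 1
  simp only [dHat_apply, hatPush_apply, dBi_biMap' hf hf, T_biMap', map_add, map_zsmul]

/-- The cross terms of (f + f') ⊗ (f + f') are f ⊗ f' and its transpose. Applied to `θ`, their sum
is a boundary because θ_s ± T θ_s occurs in the differential of a hyperquadratic chain. -/
theorem dHat_hatBracket (n : ℤ) {f f' : Fam C D} (hf : IsChainFam f) (hf' : IsChainFam f')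
    (θ : HatC C) : dHat D (n + 1) (hatBracket n f f' θ) =
      hatPush f θ + hatPush f' θ - hatPush (f + f') θ - hatBracket (n - 1) f f' (dHat C n θ) := by
  ext s : 1
  simp only [dHat_apply, hatPush_apply, hatBracket_apply, Pi.sub_apply, Pi.add_apply,
    biMap_add_left, biMap_add_right, map_add, map_zsmul, dBi_biMap' hf hf', T_biMap', T_T, T_dBi,
    sub_add_cancel, add_sub_cancel_right]
  rcases Int.units_eq_one_or n.negOnePow with hn | hn <;>
  rcases Int.units_eq_one_or s.negOnePow with hs | hs <;>
  simp [Int.negOnePow_add, Int.negOnePow_sub, hn, hs] <;> abel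

theorem dHat_hatHtpy (n : ℤ) {g : Fam₁ C D} {f f' : Fam C D} (hf : IsChainFam f)
    (hf' : IsChainFam f') (hg : IsHtpyFam g f f') (θ : HatC C) :
    dHat D (n + 1) (hatHtpy n g f f' θ) =
      hatPush f' θ - hatPush f θ - hatHtpy (n - 1) g f f' (dHat C n θ) := by
  ext s : 1
  simp only [dHat_apply, hatPush_apply, hatHtpy_apply, Pi.sub_apply,
    biMap_sub_left, biMap_sub_right, map_add, map_zsmul, dBi_rightOp hf hg, dBi_leftOp hf' hg,
    dBi_bothOp hg hg, T_rightOp, T_leftOp, T_bothOp, T_T, T_dBi, rightOp_sub_left,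
    leftOp_sub_right]
  -- Every sign is now a product of (-1)^n and (-1)^s. Once both are fixed, what remains is an
  -- identity in an abelian group.
  rcases Int.units_eq_one_or n.negOnePow with hn | hn <;>
  rcases Int.units_eq_one_or s.negOnePow with hs | hs <;>
  simp [Int.negOnePow_add, Int.negOnePow_sub, hn, hs] <;> abel

/-- The second order homotopy `(g ⊗ g')(θ_s)` comparing `(g + g'; f, f'')^%` with the sum of
`(g; f, f')^%` and `(g'; f', f'')^%`. -/
def hatConcat (g g' : Fam₁ C D) (θ : HatC C) : HatC D := fun s => bothOp g g' (θ s)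

-- The term (g + g') ⊗ (g + g') of the combined homotopy contains the cross terms g ⊗ g' and g' ⊗ g,
-- which are absent from the two separate homotopies. The chain g ⊗ g' bounds them, and its Leibniz
-- terms account for the change of end points.
set_option maxHeartbeats 1000000 in
theorem dHat_hatConcat (n : ℤ) {g g' : Fam₁ C D} {f f' f'' : Fam C D}
    (hg : IsHtpyFam g f f') (hg' : IsHtpyFam g' f' f'') (θ : HatC C) :
    dHat D (n + 2) (hatConcat g g' θ) = hatConcat g g' (dHat C n θ) +
      hatHtpy n (g + g') f f'' θ - hatHtpy n g f f' θ - hatHtpy n g' f' f'' θ := by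
  ext s : 1
  simp only [dHat_apply, hatHtpy_apply, hatConcat, Pi.sub_apply, Pi.add_apply,
    map_add, map_zsmul, dBi_bothOp hg hg', T_bothOp, rightOp_sub_left, leftOp_sub_right,
    rightOp_add_right, leftOp_add_left, bothOp_add_left, bothOp_add_right]
  rcases Int.units_eq_one_or n.negOnePow with hn | hn <;>
  rcases Int.units_eq_one_or s.negOnePow with hs | hs <;>
  simp [Int.negOnePow_add, Int.negOnePow_sub, Int.negOnePow_even 2 even_two, hn, hs] <;> abel

/-- The second order homotopy comparing `[f, k]` with `[f', k]` for `g : f ≃ f'`. -/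
def hatBracketHtpy (g : Fam₁ C D) (k : Fam C D) (θ : HatC C) : HatC D :=
  fun s => leftOp g k (T C (θ (s + 1)))

/-- Adding k to both ends changes the homotopy by k ⊗ g + g ⊗ k, while the brackets differ by (f' -
f) ⊗ k applied to T θ_{s+1}. Both come from the boundary of g ⊗ k on T θ_{s+1}. -/
theorem dHat_hatBracketHtpy (n : ℤ) {g : Fam₁ C D} {f f' k : Fam C D} (hk : IsChainFam k)
    (hg : IsHtpyFam g f f') (θ : HatC C) :
    (n.negOnePow : ℤ) • dHat D (n + 2) (hatBracketHtpy g k θ) =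
      -((n.negOnePow : ℤ) • hatBracketHtpy g k (dHat C n θ)) +
      hatHtpy n g f f' θ - hatHtpy n g (f + k) (f' + k) θ +
      hatBracket n f k θ - hatBracket n f' k θ := by
  ext s : 1
  simp only [dHat_apply, hatHtpy_apply, hatBracketHtpy, hatBracket_apply, Pi.sub_apply,
    Pi.add_apply, Pi.neg_apply, Pi.smul_apply, map_add, map_zsmul, dBi_leftOp hk hg, T_leftOp,
    T_dBi, T_T, biMap_sub_left, rightOp_add_left, leftOp_add_right, sub_add_cancel,
    add_sub_cancel_right]
  rcases Int.units_eq_one_or n.negOnePow with hn | hn <;>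
  rcases Int.units_eq_one_or s.negOnePow with hs | hs <;>
  simp [Int.negOnePow_add, Int.negOnePow_sub, Int.negOnePow_even 2 even_two, hn, hs] <;> abel

/-- The second order homotopy comparing `[f, f']` with `[f', f]`. -/
def hatBracketSwap (f f' : Fam C D) (θ : HatC C) : HatC D := fun s => biMap f f' (θ (s + 2))

/-- With the index moved by two, the term θ_{s+1} ± T θ_{s+1} of the differential gives f ⊗ f' both
on T θ_{s+1} and, through `T`, with its factors interchanged. These are the two brackets. -/
theorem dHat_hatBracketSwap (n : ℤ) {f f' : Fam C D} (hf : IsChainFam f) (hf' : IsChainFam f')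
    (θ : HatC C) : dHat D (n + 2) (hatBracketSwap f f' θ) =
      hatBracketSwap f f' (dHat C n θ) - hatBracket n f f' θ + hatBracket n f' f θ := by
  ext s : 1
  have e : s - 1 + 2 = s + 1 := by ring
  have e' : s + 2 - 1 = s + 1 := by ring
  simp only [dHat_apply, hatBracketSwap, hatBracket_apply, Pi.sub_apply,
    Pi.add_apply, map_add, map_zsmul, dBi_biMap' hf hf', T_biMap', e, e']
  rcases Int.units_eq_one_or n.negOnePow with hn | hn <;>
  rcases Int.units_eq_one_or s.negOnePow with hs | hs <;>
  simp [Int.negOnePow_add, Int.negOnePow_sub, Int.negOnePow_even 2 even_two, hn, hs] <;> abel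

theorem hatPush_hatHtpy {D E : Cx A} (n : ℤ) (k : Fam D E) (g : Fam₁ C D) (f f' : Fam C D)
    (θ : HatC C) : hatPush k (hatHtpy n g f f' θ) =
      hatHtpy n (fun i j => k j ∘ₗ g i j) (fun i => k i ∘ₗ f i) (fun i => k i ∘ₗ f' i) θ := by
  ext s p q
  simp only [hatPush_apply, biMap_apply, hatHtpy, map_add, map_zsmul, STensor.map_map]

theorem hatHtpy_hatPush {B : Cx A} (n : ℤ) (k : Fam B C) (g : Fam₁ C D) (f f' : Fam C D)
    (θ : HatC B) : hatHtpy n g f f' (hatPush k θ) =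
      hatHtpy n (fun i j => g i j ∘ₗ k i) (fun i => f i ∘ₗ k i) (fun i => f' i ∘ₗ k i) θ := by
  ext s p q
  simp only [hatPush_apply, biMap_apply, hatHtpy, STensor.map_map, T_biMap']

theorem hatPush_hatBracket (n : ℤ) (k : Fam D E) (f f' : Fam C D)
    (θ : HatC C) : hatPush k (hatBracket n f f' θ) =
      hatBracket n (fun i => k i ∘ₗ f i) (fun i => k i ∘ₗ f' i) θ := by
  ext s p q
  simp only [hatPush_apply, biMap_apply, hatBracket_apply, Pi.smul_apply, map_zsmul,
    STensor.map_map]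

theorem hatBracket_hatPush {B : Cx A} (n : ℤ) (k : Fam B C) (f f' : Fam C D)
    (θ : HatC B) : hatBracket n f f' (hatPush k θ) =
      hatBracket n (fun i => f i ∘ₗ k i) (fun i => f' i ∘ₗ k i) θ := by
  ext s p q
  simp only [hatPush_apply, biMap_apply, hatBracket_apply, Pi.smul_apply,
    STensor.map_map, T_biMap']

theorem hatPush_hatPush {B : Cx A} (k : Fam C D) (f : Fam B C) (θ : HatC B) :
    hatPush k (hatPush f θ) = hatPush (fun i => k i ∘ₗ f i) θ := by
  ext s p q
  simp only [hatPush_apply, biMap_apply, STensor.map_map]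

/-! #### Degrees -/

theorem hatHtpy_mem {m : ℤ} (n : ℤ) (g : Fam₁ C D) (f f' : Fam C D) {θ : HatC C}
    (h : θ ∈ hatChains C m) : hatHtpy n g f f' θ ∈ hatChains D (m + 1) := fun s p q hs => by
  simp only [hatHtpy, T_apply]
  rw [h s p (q - 1) (by omega), h s (p - 1) q (by omega),
    h (s - 1) (q - 1) (p - 1) (by omega)]
  simp

theorem hatBracket_mem {m : ℤ} (n : ℤ) (f f' : Fam C D) {θ : HatC C}
    (h : θ ∈ hatChains C m) : hatBracket n f f' θ ∈ hatChains D (m + 1) := fun s p q hs => by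
  simp only [hatBracket_apply, Pi.smul_apply, biMap_apply, T_apply]
  rw [h (s + 1) q p (by omega)]
  simp

theorem hatConcat_mem {m : ℤ} (g g' : Fam₁ C D) {θ : HatC C}
    (h : θ ∈ hatChains C m) : hatConcat g g' θ ∈ hatChains D (m + 2) := fun s p q hs => by
  simp only [hatConcat, bothOp_apply]
  rw [h s (p - 1) (q - 1) (by omega)]
  simp

theorem hatBracketHtpy_mem {m : ℤ} (g : Fam₁ C D) (k : Fam C D) {θ : HatC C}
    (h : θ ∈ hatChains C m) : hatBracketHtpy g k θ ∈ hatChains D (m + 2) := fun s p q hs => by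
  simp only [hatBracketHtpy, leftOp_apply, T_apply]
  rw [h (s + 1) q (p - 1) (by omega)]
  simp

theorem hatBracketSwap_mem {m : ℤ} (f f' : Fam C D) {θ : HatC C}
    (h : θ ∈ hatChains C m) : hatBracketSwap f f' θ ∈ hatChains D (m + 2) := fun s p q hs => by
  simp only [hatBracketSwap, biMap_apply]
  rw [h (s + 2) p q (by omega)]
  simp

/-! ### Chain families and homotopies -/

variable {C D E : Cx A}

theorem isChainFam_fam (f : C ⟶ D) : IsChainFam (fam f) := fun i => by
  simp only [fam]
  rw [← ModuleCat.hom_comp, ← ModuleCat.hom_comp, f.comm]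

theorem biMap_id (x : Bi C) : biMap (fam (𝟙 C)) (fam (𝟙 C)) x = x := by
  ext p q
  have h : STensor.map (fam (𝟙 C) p) (fam (𝟙 C) q) = AddMonoidHom.id _ :=
    STensor.hom_ext fun x y => rfl
  exact DFunLike.congr_fun h (x p q)

theorem IsChainFam.comp {k : Fam D E} {f : Fam C D} (hk : IsChainFam k) (hf : IsChainFam f) :
    IsChainFam (fun i => k i ∘ₗ f i) := fun i => by
  rw [← LinearMap.comp_assoc, hk, LinearMap.comp_assoc, hf, LinearMap.comp_assoc]

theorem isChainFam_zero : IsChainFam (0 : Fam C D) := fun i => by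
  simp only [Pi.zero_apply, LinearMap.comp_zero, LinearMap.zero_comp]

theorem IsHtpyFam.postcomp {k : Fam D E} {g : Fam₁ C D} {f f' : Fam C D} (hk : IsChainFam k)
    (hg : IsHtpyFam g f f') :
    IsHtpyFam (fun i j => k j ∘ₗ g i j) (fun i => k i ∘ₗ f i) (fun i => k i ∘ₗ f' i) :=
  fun i => by
  rw [← LinearMap.comp_sub, hg, LinearMap.comp_add, ← LinearMap.comp_assoc, ← hk,
    LinearMap.comp_assoc, LinearMap.comp_assoc]

theorem IsHtpyFam.precomp {k : Fam C D} {g : Fam₁ D E} {f f' : Fam D E} (hk : IsChainFam k)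
    (hg : IsHtpyFam g f f') :
    IsHtpyFam (fun i j => g i j ∘ₗ k i) (fun i => f i ∘ₗ k i) (fun i => f' i ∘ₗ k i) :=
  fun i => by
  have h := hk (i - 1)
  rw [sub_add_cancel] at h
  rw [← LinearMap.sub_comp, hg, LinearMap.add_comp, LinearMap.comp_assoc, LinearMap.comp_assoc,
    LinearMap.comp_assoc, h]

theorem isHtpyFam_of_homotopy {f f' : C ⟶ D} (g : Homotopy f' f) :
    IsHtpyFam (fun i j => (g.hom i j).hom) (fam f) (fam f') := fun i => by
  have h := g.comm i
  rw [dNext_eq g.hom (show (ComplexShape.down ℤ).Rel i (i - 1) by simp),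
    prevD_eq g.hom (show (ComplexShape.down ℤ).Rel (i + 1) i by simp)] at h
  simp only [fam]
  rw [h]
  simp only [ModuleCat.hom_add, ModuleCat.hom_comp]
  abel

/-- Needed because the slant maps of f ⊗ g and g ⊗ f have their composite form only in the
components from degree q - 1 to degree q. -/
theorem hatHtpy_congr (n : ℤ) {g g' : Fam₁ C D} (h : ∀ q, g (q - 1) q = g' (q - 1) q)
    (f f' : Fam C D) (θ : HatC C) : hatHtpy n g f f' θ = hatHtpy n g' f f' θ := by
  ext s p q
  simp only [hatHtpy, h]

/-! ### Slant maps -/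

theorem comp_units_smul {M N P : Type u} [AddCommGroup M] [Module A M] [AddCommGroup N]
    [Module A N] [AddCommGroup P] [Module A P] (e : ℤˣ) (f : N →ₗ[A] P) (g : M →ₗ[A] N) :
    f ∘ₗ ((e : ℤ) • g) = (e : ℤ) • (f ∘ₗ g) := LinearMap.comp_smul _ _ _

/-- The slant map carries the differential of the tensor product to ξ ↦ dξ + ξd; the sign (-1)^q on
the left factor is the sign in the differential of C^{n-*}. -/
theorem isHtpyFam_slant (n : ℤ) {x y ξ : Bi C} (h : y - x = dBi C ξ) :
    IsHtpyFam (slant₁ n ξ) (slant₀ n x) (slant₀ n y) := fun i => by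
  have h1 : y (n - i) i - x (n - i) i = dBi C ξ (n - i) i := by rw [← h]; rfl
  have e : n - (i - 1) = n - i + 1 := by ring
  have key : STensor.slant (y (n - i) i) - STensor.slant (x (n - i) i) =
      (C.d (i + 1) i).hom ∘ₗ STensor.slant (ξ (n - i) (i + 1)) +
      STensor.slant (ξ (n - (i - 1)) i) ∘ₗ
        ((i.negOnePow : ℤ) • StarDual.map (C.d (n - (i - 1)) (n - i)).hom) := by
    rw [← map_sub, h1, dBi_apply, map_add, map_zsmul, STensor.slant_map, STensor.slant_map,
      StarDual.map_id, LinearMap.comp_id, LinearMap.id_comp, e, comp_units_smul]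
  exact key

theorem isChainFam_slant (n : ℤ) {x : Bi C} (h : dBi C x = 0) :
    IsChainFam (slant₀ n x) := fun i => by
  have h1 : STensor.slant (dBi C x (n - (i + 1)) i) = 0 := by rw [h]; exact map_zero _
  have e : n - (i + 1) + 1 = n - i := by ring
  have key : (C.d (i + 1) i).hom ∘ₗ STensor.slant (x (n - (i + 1)) (i + 1)) =
      STensor.slant (x (n - i) i) ∘ₗ
        (((i + 1).negOnePow : ℤ) • StarDual.map (C.d (n - i) (n - (i + 1))).hom) := by
    rw [dBi_apply, map_add, map_zsmul, STensor.slant_map, STensor.slant_map,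
      StarDual.map_id, LinearMap.comp_id, LinearMap.id_comp, e, ← eq_neg_iff_add_eq_zero] at h1
    rw [h1, ← neg_smul, ← Units.val_neg, ← comp_units_smul, Int.negOnePow_succ]
  exact key

theorem slant₀_add (n : ℤ) (x y : Bi C) : slant₀ n (x + y) = slant₀ n x + slant₀ n y := by
  ext i : 1; simp only [slant₀, slant₁, Pi.add_apply, map_add]; rfl

theorem slant₀_neg (n : ℤ) (x : Bi C) : slant₀ n (-x) = -slant₀ n x := by
  ext i : 1; simp only [slant₀, slant₁, Pi.neg_apply, map_neg]; rfl

theorem slant₀_zero (n : ℤ) : slant₀ n (0 : Bi C) = 0 := by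
  ext i : 1; simp only [slant₀, slant₁, Pi.zero_apply, map_zero]; rfl

theorem slant₁_add (n : ℤ) (x y : Bi C) : slant₁ n (x + y) = slant₁ n x + slant₁ n y := by
  ext i j : 2; simp only [slant₁, Pi.add_apply, map_add]; rfl

theorem slant₁_zero (n : ℤ) : slant₁ n (0 : Bi C) = 0 := by
  ext i j : 2; simp only [slant₁, Pi.zero_apply, map_zero]; rfl

theorem slant₀_biMap (n : ℤ) (f : C ⟶ D) (x : Bi C) : slant₀ n (biMap (fam f) (fam f) x) =
    fun i => fam f i ∘ₗ slant₀ n x i ∘ₗ fam (dualMap n f) i := by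
  ext i : 1
  exact STensor.slant_map _ _ _

theorem slant₁_biMap (n : ℤ) (f : C ⟶ D) (x : Bi C) : slant₁ n (biMap (fam f) (fam f) x) =
    fun i j => fam f j ∘ₗ slant₁ n x i j ∘ₗ fam (dualMap n f) i := by
  ext i j : 2
  exact STensor.slant_map _ _ _

/-- The dual homotopy `(-1)^{i+1} g^*` on `(D^{n-*})_i`. -/
def dualHtpyFam (n : ℤ) {C D : Cx A} (g : ∀ i j : ℤ, C.X i ⟶ D.X j) :
    Fam₁ (dual n D) (dual n C) :=
  fun i j => ((i + 1).negOnePow : ℤ) • StarDual.map (g (n - j) (n - i)).hom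

theorem slant₁_rightOp (n : ℤ) (f : C ⟶ D) (g : Fam₁ C D) (x : Bi C) (q : ℤ) :
    slant₁ n (rightOp (fam f) g x) (q - 1) q =
      g (q - 1) q ∘ₗ slant₀ n x (q - 1) ∘ₗ fam (dualMap n f) (q - 1) :=
  STensor.slant_map _ _ _

/-- The sign (-1)^q of g ⊗ f becomes the sign (-1)^{i+1} of the dual homotopy, with i = q - 1. -/
theorem slant₁_leftOp (n : ℤ) (f : Fam C D) (g : ∀ i j : ℤ, C.X i ⟶ D.X j) (x : Bi C) (q : ℤ) :
    slant₁ n (leftOp (fun i j => (g i j).hom) f x) (q - 1) q =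
      f q ∘ₗ slant₀ n x q ∘ₗ dualHtpyFam n g (q - 1) q := by
  have e : n - (q - 1) - 1 = n - q := by ring
  have key : STensor.slant (leftOp (fun i j => (g i j).hom) f x (n - (q - 1)) q) =
      f q ∘ₗ STensor.slant (x (n - q) q) ∘ₗ
        (((q - 1 + 1).negOnePow : ℤ) • StarDual.map (g (n - q) (n - (q - 1))).hom) := by
    rw [leftOp_apply, map_zsmul, STensor.slant_map, e, sub_add_cancel, comp_units_smul,
      comp_units_smul]
  exact key

theorem StarDual.map_add {M N : Type u} [AddCommGroup M] [Module A M] [AddCommGroup N]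
    [Module A N] (f g : M →ₗ[A] N) : StarDual.map (f + g) = StarDual.map f + StarDual.map g :=
  LinearMap.ext fun z => StarDual.ext fun x => by simp

theorem StarDual.map_sub {M N : Type u} [AddCommGroup M] [Module A M] [AddCommGroup N]
    [Module A N] (f g : M →ₗ[A] N) : StarDual.map (f - g) = StarDual.map f - StarDual.map g := by
  rw [eq_sub_iff_add_eq, ← StarDual.map_add, sub_add_cancel]

/-- In each of the two composites the sign of the dual homotopy equals the sign of the dual
differential, so they cancel. -/
theorem isHtpyFam_dualHtpyFam (n : ℤ) {f f' : C ⟶ D} (g : Homotopy f' f) :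
    IsHtpyFam (dualHtpyFam n g.hom) (fam (dualMap n f)) (fam (dualMap n f')) := fun i => by
  have h := isHtpyFam_of_homotopy g (n - i)
  have h2 := congrArg StarDual.map h
  rw [StarDual.map_sub, StarDual.map_add, ← StarDual.map_comp, ← StarDual.map_comp] at h2
  have e1 : n - (i - 1) = n - i + 1 := by ring
  have e2 : n - (i + 1) = n - i - 1 := by ring
  have key : StarDual.map (fam f' (n - i)) - StarDual.map (fam f (n - i)) =
      (((i + 1).negOnePow : ℤ) • StarDual.map (C.d (n - i) (n - (i + 1))).hom) ∘ₗ
        (((i + 1).negOnePow : ℤ) • StarDual.map (g.hom (n - (i + 1)) (n - i)).hom) +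
      (((i - 1 + 1).negOnePow : ℤ) • StarDual.map (g.hom (n - i) (n - (i - 1))).hom) ∘ₗ
        ((i.negOnePow : ℤ) • StarDual.map (D.d (n - (i - 1)) (n - i)).hom) := by
    rw [h2, e1, e2, sub_add_cancel, comp_units_smul, LinearMap.smul_comp, comp_units_smul,
      LinearMap.smul_comp, smul_smul, smul_smul, ← Units.val_mul, ← Units.val_mul,
      Int.units_mul_self, Int.units_mul_self, Units.val_one, one_smul, one_smul, add_comm]
  exact key

/-! ### Suspension -/

/-- The suspension isomorphism on a single element. -/
def suspBi (n : ℤ) (C : Cx A) : Bi (dual 0 C) →+ Bi (dual n C) where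
  toFun x p q := ((n * (q - n)).negOnePow : ℤ) •
    STensor.map (dualShift n C p) (dualShift n C q) (x (p - n) (q - n))
  map_zero' := by ext p q; simp
  map_add' x y := by ext p q; simp

theorem suspBi_apply (n : ℤ) (x : Bi (dual 0 C)) (p q : ℤ) : suspBi n C x p q =
    ((n * (q - n)).negOnePow : ℤ) •
      STensor.map (dualShift n C p) (dualShift n C q) (x (p - n) (q - n)) := rfl

theorem susp_apply (n : ℤ) (θ : HatC (dual 0 C)) (s : ℤ) :
    susp n C θ s = suspBi n C (θ (s - n)) := rfl

/-- The factor (-1)^n compensates the shift of s by n in the signs (-1)^s `T` of the hyperquadratic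
differential, so that `susp` commutes with it. -/
theorem T_suspBi (n : ℤ) (x : Bi (dual 0 C)) :
    T (dual n C) (suspBi n C x) = (n.negOnePow : ℤ) • suspBi n C (T (dual 0 C) x) := by
  ext p q
  simp only [T_apply, suspBi_apply, map_zsmul, STensor.swap_map, smul_smul,
    ← Units.val_mul, ← Int.negOnePow_add, Pi.smul_apply]
  congr 2
  rw [Int.negOnePow_eq_iff]
  have e : p * q + n * (p - n) - (n + (n * (q - n) + (p - n) * (q - n))) =
    2 * (n * p) - n * (n + 1) := by ring
  rw [e]
  exact (even_two_mul _).sub (Int.even_mul_succ_self n)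

theorem dualShift_d (n : ℤ) (C : Cx A) (q : ℤ) :
    ((dual n C).d (q + 1) q).hom ∘ₗ dualShift n C (q + 1) =
      (n.negOnePow : ℤ) • (dualShift n C q ∘ₗ ((dual 0 C).d (q + 1 - n) (q - n)).hom) := by
  have key : (((q + 1).negOnePow : ℤ) • StarDual.map (C.d (n - q) (n - (q + 1))).hom) ∘ₗ
        StarDual.map (C.XIsoOfEq (show n - (q + 1) = 0 - (q + 1 - n) by ring)).hom.hom =
      (n.negOnePow : ℤ) • (StarDual.map (C.XIsoOfEq (show n - q = 0 - (q - n) by ring)).hom.hom ∘ₗ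
        (((q + 1 - n).negOnePow : ℤ) •
          StarDual.map (C.d (0 - (q - n)) (0 - (q + 1 - n))).hom)) := by
    rw [LinearMap.smul_comp, comp_units_smul, StarDual.map_comp, StarDual.map_comp,
      ← ModuleCat.hom_comp, ← ModuleCat.hom_comp, HomologicalComplex.XIsoOfEq_hom_comp_d,
      HomologicalComplex.d_comp_XIsoOfEq_hom, smul_smul, ← Units.val_mul, ← Int.negOnePow_add]
    congr 3; ring
  exact key

theorem dBi_suspBi (n : ℤ) (x : Bi (dual 0 C)) :
    dBi (dual n C) (suspBi n C x) = suspBi n C (dBi (dual 0 C) x) := by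
  ext p q
  simp only [dBi_apply, suspBi_apply, map_add, map_zsmul, STensor.map_map, LinearMap.id_comp,
    LinearMap.comp_id, dualShift_d, STensor.map_units_smul_left, STensor.map_units_smul_right]
  have e (q : ℤ) : q - n + 1 = q + 1 - n := by ring
  rw [e, e]
  simp only [smul_add, smul_smul, ← Units.val_mul, ← Int.negOnePow_add]
  congr 3
  · rw [Int.negOnePow_eq_iff]
    exact ⟨n, by ring⟩
  · rw [Int.negOnePow_eq_iff]
    exact ⟨n, by ring⟩

theorem dHat_susp (n m k : ℤ) (hk : k = m + n) (θ : HatC (dual 0 C)) :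
    dHat (dual n C) k (susp n C θ) = susp n C (dHat (dual 0 C) m θ) := by
  subst hk
  ext s : 1
  have e : s - 1 - n = s - n - 1 := by ring
  have e' : m + n + s - 1 = m + (s - n) - 1 + 2 * n := by ring
  simp only [dHat_apply, susp_apply, dBi_suspBi, T_suspBi, map_add, map_zsmul, e, e',
    Int.negOnePow_sub, Int.negOnePow_add _ (2 * n), Int.negOnePow_two_mul, mul_one, smul_smul,
    ← Units.val_mul]

theorem susp_mem {n m k : ℤ} (hk : k = m + n) {θ : HatC (dual 0 C)}
    (h : θ ∈ hatChains (dual 0 C) m) : susp n C θ ∈ hatChains (dual n C) k := fun s p q hs => by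
  rw [susp_apply, suspBi_apply, h (s - n) (p - n) (q - n) (by omega)]
  simp

theorem dualShift_dualMap (n : ℤ) (f : C ⟶ D) (q : ℤ) :
    fam (dualMap n f) q ∘ₗ dualShift n D q = dualShift n C q ∘ₗ fam (dualMap 0 f) (q - n) := by
  simp only [dualShift, fam]
  change StarDual.map _ ∘ₗ StarDual.map _ = StarDual.map _ ∘ₗ StarDual.map _
  rw [StarDual.map_comp, StarDual.map_comp, ← ModuleCat.hom_comp, ← ModuleCat.hom_comp]
  congr 2
  have h : ∀ {i j : ℤ} (h : i = j), f.f i ≫ (D.XIsoOfEq h).hom = (C.XIsoOfEq h).hom ≫ f.f j := by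
    rintro i _ rfl; simp
  exact h _

theorem susp_hatPush (n : ℤ) (f : C ⟶ D) (θ : HatC (dual 0 D)) :
    susp n C (pullback f θ) = hatPush (fam (dualMap n f)) (susp n D θ) := by
  ext s p q
  simp only [susp_apply, suspBi_apply, pullback, hatPush_apply, biMap_apply, map_zsmul,
    STensor.map_map, dualShift_dualMap]

theorem dualShift_dualHtpy (n : ℤ) (g : ∀ i j : ℤ, C.X i ⟶ D.X j) (q : ℤ) :
    dualHtpyFam n g (q - 1) q ∘ₗ dualShift n D (q - 1) =
      (n.negOnePow : ℤ) • (dualShift n C q ∘ₗ dualHtpy g (q - 1 - n) (q - n)) := by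
  have h : ∀ {i j i' j' : ℤ} (h : i = j) (h' : i' = j'),
      g i i' ≫ (D.XIsoOfEq h').hom = (C.XIsoOfEq h).hom ≫ g j j' := by
    rintro i _ i' _ rfl rfl; simp
  have key : (((q - 1 + 1).negOnePow : ℤ) • StarDual.map (g (n - q) (n - (q - 1))).hom) ∘ₗ
        StarDual.map (D.XIsoOfEq (show n - (q - 1) = 0 - (q - 1 - n) by ring)).hom.hom =
      (n.negOnePow : ℤ) • (StarDual.map (C.XIsoOfEq (show n - q = 0 - (q - n) by ring)).hom.hom ∘ₗ
        (((q - 1 - n + 1).negOnePow : ℤ) •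
          StarDual.map (g (0 - (q - n)) (0 - (q - 1 - n))).hom)) := by
    rw [LinearMap.smul_comp, comp_units_smul, StarDual.map_comp, StarDual.map_comp,
      ← ModuleCat.hom_comp, ← ModuleCat.hom_comp, ← h _ (show n - (q - 1) = 0 - (q - 1 - n) by ring),
      smul_smul, ← Units.val_mul,
      ← Int.negOnePow_add]
    congr 3; ring
  exact key

/-- Each degree-one dual homotopy acquires (-1)^n from the shift. In the linear terms this matches
the change in the suspension and Koszul signs; in the quadratic term the two factors cancel and `T`
supplies the (-1)^n that distinguishes the homotopy on n-chains from that on 0-chains. -/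
theorem susp_hatHtpy (n : ℤ) (g : ∀ i j : ℤ, C.X i ⟶ D.X j) (f f' : C ⟶ D)
    (θ : HatC (dual 0 D)) :
    susp n C (hatHtpy 0 (dualHtpy g) (fam (dualMap 0 f)) (fam (dualMap 0 f')) θ) =
      hatHtpy n (dualHtpyFam n g) (fam (dualMap n f)) (fam (dualMap n f')) (susp n D θ) := by
  ext s p q
  have e (q : ℤ) : q - n - 1 = q - 1 - n := by ring
  simp only [susp_apply, suspBi_apply, hatHtpy, map_add, map_zsmul,
    STensor.map_map, dualShift_dualMap, dualShift_dualHtpy, T_suspBi, Pi.smul_apply,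
    STensor.map_units_smul_left, STensor.map_units_smul_right]
  rw [e p, e q, show s - n - 1 = s - 1 - n by ring]
  simp only [smul_add, smul_smul, ← Units.val_mul, ← Int.negOnePow_add]
  refine congrArg₂ _ (congrArg₂ _ ?_ ?_) ?_
  all_goals congr 2; rw [Int.negOnePow_eq_iff]
  · exact ⟨0, by ring⟩
  · exact ⟨-n, by ring⟩
  · exact ⟨-n - n, by ring⟩

/-! ### Symmetric structures on chain bundles -/

section Chains

variable {C D : Cx A}

theorem hatBracket_add_left (n : ℤ) (f f' k : Fam C D) (θ : HatC C) :
    hatBracket n (f + f') k θ = hatBracket n f k θ + hatBracket n f' k θ := by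
  ext s : 1
  simp only [hatBracket_apply, Pi.add_apply, biMap_add_left, smul_add]

theorem hatBracket_add_right (n : ℤ) (k f f' : Fam C D) (θ : HatC C) :
    hatBracket n k (f + f') θ = hatBracket n k f θ + hatBracket n k f' θ := by
  ext s : 1
  simp only [hatBracket_apply, Pi.add_apply, biMap_add_right, smul_add]

theorem hatBracket_zero_left (n : ℤ) (k : Fam C D) (θ : HatC C) :
    hatBracket n 0 k θ = 0 := by
  have h := hatBracket_add_left n 0 0 k θ
  rwa [add_zero, left_eq_add] at h

theorem hatBracket_neg_left (n : ℤ) (f k : Fam C D) (θ : HatC C) :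
    hatBracket n (-f) k θ = -hatBracket n f k θ := by
  rw [eq_neg_iff_add_eq_zero, ← hatBracket_add_left, neg_add_cancel, hatBracket_zero_left]

theorem Jmap_symPush (f : Fam C D) (φ : SymC C) :
    Jmap D (symPush f φ) = hatPush f (Jmap C φ) := by
  ext s : 1
  by_cases h : 0 ≤ s <;> simp [Jmap, symPush, hatPush, h]

theorem Jmap_natCast (φ : SymC C) (s : ℕ) : Jmap C φ s = φ s := by
  simp [Jmap]

theorem Jmap_of_neg (φ : SymC C) {s : ℤ} (h : s < 0) : Jmap C φ s = 0 := by
  simp [Jmap, not_le.2 h]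

theorem Jmap_zero_apply (φ : SymC C) : Jmap C φ 0 = φ 0 := rfl

/-- Identities between symmetric chains can therefore be checked in the hyperquadratic complex,
where there is no special case at s = 0. -/
theorem Jmap_injective : Function.Injective (Jmap C) := fun φ φ' h => by
  ext s : 1
  rw [← Jmap_natCast φ, h, Jmap_natCast]

theorem Jmap_restrict {θ : HatC C} (h : ∀ s < 0, θ s = 0) :
    Jmap C (fun s : ℕ => θ s) = θ := by
  ext s : 1
  rcases lt_or_ge s 0 with hs | hs
  · rw [Jmap_of_neg _ hs, h s hs]
  · lift s to ℕ using hs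
    rw [Jmap_natCast]

theorem restrict_mem {n : ℤ} {θ : HatC C} (h : θ ∈ hatChains C n) :
    (fun s : ℕ => θ s) ∈ symChains C n := fun s p q hs => h s p q hs

theorem dBi_eq_zero_of_mem {n : ℤ} {φ : SymC C} (h : φ ∈ symCycles C n) : dBi C (φ 0) = 0 :=
  congrFun (AddMonoidHom.mem_ker.1 h.2) 0

theorem isChainFam_of_mem {n : ℤ} {φ : SymC C} (h : φ ∈ symCycles C n) :
    IsChainFam (slant₀ n (φ 0)) := isChainFam_slant n (dBi_eq_zero_of_mem h)

/-- Only the component s = 0 of the hypothesis matters, and there the differential is that of the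
tensor product alone. -/
theorem isHtpyFam_of_eq {n k : ℤ} {φ φ' ξ : SymC C} (h : φ' - φ = dSym C k ξ) :
    IsHtpyFam (slant₁ n (ξ 0)) (slant₀ n (φ 0)) (slant₀ n (φ' 0)) :=
  isHtpyFam_slant n (congrFun h 0)

theorem dHat_hatHtpy_cycle {n : ℤ} {g : Fam₁ C D} {f f' : Fam C D} (hf : IsChainFam f)
    (hf' : IsChainFam f') (hg : IsHtpyFam g f f') {θ : HatC C} (h : dHat C n θ = 0) :
    dHat D (n + 1) (hatHtpy n g f f' θ) = hatPush f' θ - hatPush f θ := by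
  rw [dHat_hatHtpy n hf hf' hg, h, hatHtpy_zero, sub_zero]

theorem dHat_hatHtpy_succ (n : ℤ) {g : Fam₁ C D} {f f' : Fam C D} (hf : IsChainFam f)
    (hf' : IsChainFam f') (hg : IsHtpyFam g f f') (θ : HatC C) :
    dHat D (n + 2) (hatHtpy (n + 1) g f f' θ) =
      hatPush f' θ - hatPush f θ - hatHtpy n g f f' (dHat C (n + 1) θ) := by
  have h := dHat_hatHtpy (n + 1) hf hf' hg θ
  rwa [add_sub_cancel_right, add_assoc, one_add_one_eq_two] at h

theorem hatHtpy_mem_succ {n : ℤ} (m : ℤ) (g : Fam₁ C D) (f f' : Fam C D) {θ : HatC C}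
    (h : θ ∈ hatChains C (n + 1)) : hatHtpy m g f f' θ ∈ hatChains D (n + 2) := by
  have h := hatHtpy_mem m g f f' h
  rwa [add_assoc, one_add_one_eq_two] at h

theorem dHat_hatBracket_cycle {n : ℤ} {f f' : Fam C D} (hf : IsChainFam f)
    (hf' : IsChainFam f') {θ : HatC C} (h : dHat C n θ = 0) :
    dHat D (n + 1) (hatBracket n f f' θ) = hatPush f θ + hatPush f' θ - hatPush (f + f') θ := by
  rw [dHat_hatBracket n hf hf', h, hatBracket_zero, sub_zero]

theorem dHat_hatBracket_succ (n : ℤ) {f f' : Fam C D} (hf : IsChainFam f) (hf' : IsChainFam f')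
    (θ : HatC C) : dHat D (n + 2) (hatBracket (n + 1) f f' θ) = hatPush f θ + hatPush f' θ -
      hatPush (f + f') θ - hatBracket n f f' (dHat C (n + 1) θ) := by
  have h := dHat_hatBracket (n + 1) hf hf' θ
  rwa [add_sub_cancel_right, add_assoc, one_add_one_eq_two] at h

theorem hatBracket_mem_succ {n : ℤ} (m : ℤ) (f f' : Fam C D) {θ : HatC C}
    (h : θ ∈ hatChains C (n + 1)) : hatBracket m f f' θ ∈ hatChains D (n + 2) := by
  have h := hatBracket_mem m f f' h
  rwa [add_assoc, one_add_one_eq_two] at h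

theorem dHat_hatConcat_cycle {n : ℤ} {g g' : Fam₁ C D} {f f' f'' : Fam C D}
    (hg : IsHtpyFam g f f') (hg' : IsHtpyFam g' f' f'') {θ : HatC C} (h : dHat C n θ = 0) :
    dHat D (n + 2) (hatConcat g g' θ) =
      hatHtpy n (g + g') f f'' θ - hatHtpy n g f f' θ - hatHtpy n g' f' f'' θ := by
  have e : hatConcat g g' (0 : HatC C) = 0 := by ext s : 1; exact map_zero _
  rw [dHat_hatConcat n hg hg', h, e, zero_add]

end Chains

namespace ChainBundle

variable (B : ChainBundle A) (n : ℤ)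

/-- The suspension `S^n γ` of the bundle `γ`. -/
abbrev Γ : HatC (dual n B.C) := susp n B.C B.γ

theorem Γ_mem : B.Γ n ∈ hatChains (dual n B.C) n := susp_mem (zero_add n).symm B.γ_mem.1

theorem dHat_Γ : dHat (dual n B.C) n (B.Γ n) = 0 := by
  rw [dHat_susp n 0 n (zero_add n).symm, AddMonoidHom.mem_ker.1 B.γ_mem.2, map_zero]

end ChainBundle

/-! ### Equivalence and addition of symmetric structures. -/

namespace SymStr

variable {B : ChainBundle A} {n : ℤ}

theorem ext' {x y : SymStr B n} (h : x.φ = y.φ) (h' : x.θ = y.θ) : x = y := by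
  cases x; cases y; cases h; cases h'; rfl

theorem isChainFam (x : SymStr B n) : IsChainFam (slant₀ n (x.φ 0)) := isChainFam_of_mem x.φ_mem

theorem equivalent_of_eq {x y : SymStr B n} (h : x.φ = y.φ) {η : HatC B.C}
    (hη : η ∈ hatChains B.C (n + 2)) (e : x.θ - y.θ = dHat B.C (n + 2) η) : x.Equivalent y := by
  refine ⟨0, zero_mem _, η, hη, by rw [h, sub_self, map_zero], ?_⟩
  rw [Pi.zero_apply, slant₁_zero, hatHtpy_zero_fam, map_zero, sub_zero, add_zero, e]

theorem Equivalent.refl (x : SymStr B n) : x.Equivalent x :=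
  equivalent_of_eq rfl (zero_mem _) (by rw [sub_self, map_zero])

theorem Equivalent.symm {x y : SymStr B n} (h : x.Equivalent y) : y.Equivalent x := by
  obtain ⟨ξ, hξ, η, hη, e, e'⟩ := h
  have e1 : x.φ - y.φ = dSym B.C (n + 1) (-ξ) := by rw [map_neg, ← e, neg_sub]
  have k := dHat_hatConcat_cycle (isHtpyFam_of_eq e) (isHtpyFam_of_eq e1) (B.dHat_Γ n)
  rw [← slant₁_add, Pi.neg_apply, add_neg_cancel, slant₁_zero, hatHtpy_zero_fam] at k
  -- The homotopies of ξ and -ξ concatenate to the zero homotopy, so their sum is a boundary, up to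
  -- sign that of the chain ξ_0 ⊗ (-ξ_0).
  refine ⟨-ξ, neg_mem hξ, hatConcat (slant₁ n (ξ 0)) (slant₁ n (-ξ 0)) (B.Γ n) - η,
    sub_mem (hatConcat_mem _ _ (B.Γ_mem n)) hη, e1, ?_⟩
  rw [map_sub, k, ← e', map_neg, Pi.neg_apply]
  abel

theorem Equivalent.trans {x y z : SymStr B n} (h : x.Equivalent y) (h' : y.Equivalent z) :
    x.Equivalent z := by
  obtain ⟨ξ, hξ, η, hη, e, e'⟩ := h
  obtain ⟨ξ', hξ', η', hη', e1, e1'⟩ := h'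
  have k := dHat_hatConcat_cycle (isHtpyFam_of_eq e) (isHtpyFam_of_eq e1) (B.dHat_Γ n)
  -- The homotopy term is not additive in ξ; the concatenation chain corrects η + η'.
  refine ⟨ξ + ξ', add_mem hξ hξ', η + η' - hatConcat (slant₁ n (ξ 0)) (slant₁ n (ξ' 0)) (B.Γ n),
    sub_mem (add_mem hη hη') (hatConcat_mem _ _ (B.Γ_mem n)), ?_, ?_⟩
  · rw [map_add, ← e, ← e1]; abel
  · rw [map_sub, map_add (dHat _ _), k, ← e', ← e1', Pi.add_apply, slant₁_add, map_add]
    abel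

theorem equivalence : _root_.Equivalence (Equivalent (B := B) (n := n)) :=
  ⟨Equivalent.refl, Equivalent.symm, Equivalent.trans⟩

/-- The sum of two symmetric structures. -/
def add (x y : SymStr B n) : SymStr B n where
  φ := x.φ + y.φ
  φ_mem := add_mem x.φ_mem y.φ_mem
  θ := x.θ + y.θ + bracket B n x.φ y.φ
  θ_mem := add_mem (add_mem x.θ_mem y.θ_mem) (hatBracket_mem _ _ _ (B.Γ_mem n))
  eq := by
    rw [map_add (dHat _ _), map_add (dHat _ _), bracket,
      dHat_hatBracket_cycle x.isChainFam y.isChainFam (B.dHat_Γ n), ← x.eq, ← y.eq, map_add,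
      Pi.add_apply, slant₀_add]
    abel

/-- Doubling f multiplies f^% by 4. Hence [φ_0, φ_0](Γ) has boundary -2 (φ_0)^%(Γ), the correction
required in the inverse: J changes sign under φ ↦ -φ while (φ_0)^%(Γ) does not. -/
theorem hatPush_two_smul {C D : Cx A} (f : Fam C D) (θ : HatC C) :
    hatPush (f + f) θ = 2 • (hatPush f θ + hatPush f θ) := by
  ext s : 1
  simp only [hatPush_apply, biMap_add_left, biMap_add_right, Pi.smul_apply, Pi.add_apply, two_smul]

/-- The zero symmetric structure. -/
def zero (B : ChainBundle A) (n : ℤ) : SymStr B n where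
  φ := 0
  φ_mem := zero_mem _
  θ := 0
  θ_mem := zero_mem _
  eq := by rw [Pi.zero_apply, slant₀_zero, hatPush_zero_fam, map_zero, map_zero, sub_zero]

/-- The inverse of a symmetric structure. -/
def neg (x : SymStr B n) : SymStr B n where
  φ := -x.φ
  φ_mem := neg_mem x.φ_mem
  θ := -x.θ + bracket B n x.φ x.φ
  θ_mem := add_mem (neg_mem x.θ_mem) (hatBracket_mem _ _ _ (B.Γ_mem n))
  eq := by
    rw [map_add (dHat _ _), map_neg (dHat _ _), bracket,
      dHat_hatBracket_cycle x.isChainFam x.isChainFam (B.dHat_Γ n),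
      ← x.eq, map_neg, Pi.neg_apply, slant₀_neg, hatPush_neg_fam, hatPush_two_smul]
    abel

theorem zero_add (x : SymStr B n) : (zero B n).add x = x := by
  refine ext' (_root_.zero_add _) ?_
  change 0 + x.θ + hatBracket n (slant₀ n 0) _ _ = _
  rw [slant₀_zero, hatBracket_zero_left, _root_.zero_add, add_zero]

theorem neg_add (x : SymStr B n) : (neg x).add x = zero B n := by
  refine ext' (neg_add_cancel _) ?_
  change -x.θ + bracket B n x.φ x.φ + x.θ + hatBracket n (slant₀ n (-x.φ 0)) _ _ = 0
  rw [slant₀_neg, hatBracket_neg_left, bracket]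
  abel

theorem add_assoc (x y z : SymStr B n) : (x.add y).add z = x.add (y.add z) := by
  refine ext' (_root_.add_assoc _ _ _) ?_
  change x.θ + y.θ + bracket B n x.φ y.φ + z.θ + bracket B n (x.φ + y.φ) z.φ =
    x.θ + (y.θ + z.θ + bracket B n y.φ z.φ) + bracket B n x.φ (y.φ + z.φ)
  simp only [bracket, Pi.add_apply, slant₀_add, hatBracket_add_left, hatBracket_add_right]
  abel

theorem add_comm_equivalent (x y : SymStr B n) : (x.add y).Equivalent (y.add x) := by
  refine equivalent_of_eq (add_comm _ _) (neg_mem (hatBracketSwap_mem (slant₀ n (x.φ 0))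
    (slant₀ n (y.φ 0)) (B.Γ_mem n))) ?_
  have e : hatBracketSwap (slant₀ n (x.φ 0)) (slant₀ n (y.φ 0)) (0 : HatC (dual n B.C)) = 0 := by
    ext s : 1; exact map_zero _
  rw [map_neg, dHat_hatBracketSwap n x.isChainFam y.isChainFam, B.dHat_Γ n, e]
  simp only [add, bracket]
  abel

/-- The same ξ serves for the sums; the bracket and the homotopy term both change, and g ⊗ k, with g
from ξ_0 and k from the added structure, bounds the total change. -/
theorem Equivalent.add_right {x x' : SymStr B n} (h : x.Equivalent x') (y : SymStr B n) :
    (x.add y).Equivalent (x'.add y) := by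
  obtain ⟨ξ, hξ, η, hη, e, e'⟩ := h
  have k := dHat_hatBracketHtpy n y.isChainFam (isHtpyFam_of_eq e) (B.Γ n)
  have e0 : hatBracketHtpy (slant₁ n (ξ 0)) (slant₀ n (y.φ 0)) (0 : HatC (dual n B.C)) = 0 := by
    ext s : 1; simp only [hatBracketHtpy, Pi.zero_apply, map_zero]
  rw [B.dHat_Γ n, e0, smul_zero, neg_zero, _root_.zero_add] at k
  refine ⟨ξ, hξ, η + (n.negOnePow : ℤ) •
    hatBracketHtpy (slant₁ n (ξ 0)) (slant₀ n (y.φ 0)) (B.Γ n),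
    add_mem hη (zsmul_mem (hatBracketHtpy_mem _ _ (B.Γ_mem n)) _), ?_, ?_⟩
  · rw [← e]; simp only [add]; abel
  · rw [map_add, map_zsmul, k, ← e']
    simp only [add, bracket, Pi.add_apply, slant₀_add]
    abel

/-- Addition on the left reduces to addition on the right, at the price of commutativity up to
equivalence. -/
theorem Equivalent.add_left {y y' : SymStr B n} (h : y.Equivalent y') (x : SymStr B n) :
    (x.add y).Equivalent (x.add y') :=
  (add_comm_equivalent x y).trans ((h.add_right x).trans (add_comm_equivalent y' x))

end SymStr

/-! ### The abelian group of equivalence classes. -/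

namespace QTw

variable {B : ChainBundle A} {n : ℤ}

theorem mk_eq_iff {x y : SymStr B n} : mk x = mk y ↔ x.Equivalent y :=
  SymStr.equivalence.quot_mk_eq_iff x y

local instance : Zero (QTw B n) := ⟨mk (SymStr.zero B n)⟩

local instance : Add (QTw B n) := ⟨Quot.map₂ SymStr.add (fun x _ _ h => h.add_left x)
  (fun _ _ y h => h.add_right y)⟩

local instance : Neg (QTw B n) := ⟨Quot.lift (fun x => mk x.neg) (fun x y h => by
  -- Uniqueness of inverses replaces a chain computation: -x = -x + (y - y) = -x + (x - y) = -y.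
  have h1 : mk (x.neg.add (x.add y.neg)) = mk (x.neg.add (y.add y.neg)) :=
    mk_eq_iff.2 ((h.add_right y.neg).add_left _)
  have h2 : mk (y.add y.neg) = mk (SymStr.zero B n) := by
    rw [mk_eq_iff.2 (SymStr.add_comm_equivalent y y.neg), y.neg_add]
  have h3 : mk (x.neg.add (y.add y.neg)) = mk x.neg := by
    rw [mk_eq_iff.2 ((mk_eq_iff.1 h2).add_left x.neg),
      mk_eq_iff.2 (SymStr.add_comm_equivalent _ _), SymStr.zero_add]
  rw [← h3, ← h1, ← SymStr.add_assoc, SymStr.neg_add, SymStr.zero_add])⟩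

theorem mk_add (x y : SymStr B n) : mk x + mk y = mk (x.add y) := rfl

theorem add_comm' (a b : QTw B n) : a + b = b + a := by
  rcases a with ⟨x⟩; rcases b with ⟨y⟩
  exact mk_eq_iff.2 (SymStr.add_comm_equivalent x y)

theorem zero_add' (a : QTw B n) : 0 + a = a := by
  rcases a with ⟨x⟩
  exact congrArg mk x.zero_add

/-- The group structure of `Q_n(C, γ)`. -/
abbrev addCommGroup : AddCommGroup (QTw B n) where
  add_assoc := by
    rintro ⟨x⟩ ⟨y⟩ ⟨z⟩
    exact congrArg mk (SymStr.add_assoc x y z)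
  zero_add := zero_add'
  add_zero a := by rw [add_comm', zero_add']
  nsmul := nsmulRec
  zsmul := zsmulRec
  neg_add_cancel := by
    rintro ⟨x⟩
    exact congrArg mk x.neg_add
  add_comm := add_comm'

end QTw

attribute [local instance] QTw.addCommGroup

/-! ### Covariance -/

namespace BundleHom

variable {B B' B'' : ChainBundle A}

/-- The suspended form of f^* γ' = γ + dχ. Every correction by S^n χ in the covariance comes from
this equation. -/
theorem hatPush_Γ (u : BundleHom B B') (n : ℤ) : hatPush (fam (dualMap n u.f)) (B'.Γ n) =
    B.Γ n + dHat (dual n B.C) (n + 1) (susp n B.C u.χ) := by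
  rw [dHat_susp n 1 (n + 1) (add_comm _ _), ← u.eq, map_sub, add_sub_cancel, susp_hatPush]

theorem susp_χ_mem (u : BundleHom B B') (n : ℤ) :
    susp n B.C u.χ ∈ hatChains (dual n B.C) (n + 1) := susp_mem (add_comm _ _) u.χ_mem

theorem hatPush_slant (n : ℤ) {C D : Cx A} (f : C ⟶ D) (x : Bi C) (θ : HatC (dual n D)) :
    hatPush (slant₀ n (biMap (fam f) (fam f) x)) θ =
      hatPush (fun i => fam f i ∘ₗ slant₀ n x i) (hatPush (fam (dualMap n f)) θ) := by
  rw [slant₀_biMap, hatPush_hatPush]; rfl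

/-- The symmetric structure induced by a map of chain bundles. -/
def push (u : BundleHom B B') {n : ℤ} (x : SymStr B n) : SymStr B' n where
  φ := symPush (fam u.f) x.φ
  φ_mem := symPush_cycles u.f n _ x.φ_mem
  θ := hatPush (fam u.f) x.θ - u.twist n x.φ
  θ_mem := sub_mem (hatPush_mem _ x.θ_mem) (hatPush_mem _ (u.susp_χ_mem n))
  eq := by
    rw [map_sub (dHat _ _), dHat_hatPush, ← x.eq, twist,
      dHat_hatPush' _ ((isChainFam_fam u.f).comp x.isChainFam), Jmap_symPush]
    change _ - hatPush (slant₀ n (biMap (fam u.f) (fam u.f) (x.φ 0))) _ = _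
    rw [hatPush_slant, u.hatPush_Γ n, map_add, map_sub, hatPush_hatPush]
    abel

/-- The homotopy term over γ' pulls back to one over Γ + d(S^n χ). The part over d(S^n χ) is
exchanged, by the homotopy formula one degree higher, for the difference of the two twist terms. -/
theorem push_equivalent (u : BundleHom B B') {n : ℤ} {x y : SymStr B n} (h : x.Equivalent y) :
    (u.push x).Equivalent (u.push y) := by
  obtain ⟨ξ, hξ, η, hη, e, e'⟩ := h
  have hf := isChainFam_fam u.f
  have k := dHat_hatHtpy_succ n (hf.comp x.isChainFam) (hf.comp y.isChainFam)
    ((isHtpyFam_of_eq e).postcomp hf) (susp n B.C u.χ)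
  refine ⟨symPush (fam u.f) ξ, symPush_mem _ hξ, hatPush (fam u.f) η +
    hatHtpy (n + 1) (fun i j => fam u.f j ∘ₗ slant₁ n (ξ 0) i j)
      (fun i => fam u.f i ∘ₗ slant₀ n (x.φ 0) i) (fun i => fam u.f i ∘ₗ slant₀ n (y.φ 0) i)
      (susp n B.C u.χ),
    add_mem (hatPush_mem _ hη) (hatHtpy_mem_succ _ _ _ _ (u.susp_χ_mem n)), ?_, ?_⟩
  · rw [dSym_symPush, ← e, map_sub]; rfl
  · have h1 : hatHtpy n (slant₁ n (symPush (fam u.f) ξ 0)) (slant₀ n ((u.push x).φ 0))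
        (slant₀ n ((u.push y).φ 0)) (B'.Γ n) =
        hatHtpy n (fun i j => fam u.f j ∘ₗ slant₁ n (ξ 0) i j)
          (fun i => fam u.f i ∘ₗ slant₀ n (x.φ 0) i) (fun i => fam u.f i ∘ₗ slant₀ n (y.φ 0) i)
          (B.Γ n + dHat (dual n B.C) (n + 1) (susp n B.C u.χ)) := by
      rw [← u.hatPush_Γ n, hatHtpy_hatPush]
      change hatHtpy n (slant₁ n (biMap (fam u.f) (fam u.f) (ξ 0)))
        (slant₀ n (biMap (fam u.f) (fam u.f) (x.φ 0)))
        (slant₀ n (biMap (fam u.f) (fam u.f) (y.φ 0))) _ = _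
      rw [slant₁_biMap, slant₀_biMap, slant₀_biMap]; rfl
    rw [h1, hatHtpy_add, ← hatPush_hatHtpy, map_add (dHat _ _), k, dHat_hatPush, ← e',
      Jmap_symPush]
    simp only [push, twist, map_sub, map_add]
    abel

/-- The twist is quadratic in φ_0, so it is not additive. The bracket of f φ_0 and f φ'_0 on S^n χ
bounds its failure of additivity together with the part of the bracket over d(S^n χ). -/
theorem push_add_equivalent (u : BundleHom B B') {n : ℤ} (x y : SymStr B n) :
    ((u.push x).add (u.push y)).Equivalent (u.push (x.add y)) := by
  have hf := isChainFam_fam u.f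
  have k := dHat_hatBracket_succ n (hf.comp x.isChainFam) (hf.comp y.isChainFam) (susp n B.C u.χ)
  refine SymStr.equivalent_of_eq (η := -hatBracket (n + 1)
      (fun i => fam u.f i ∘ₗ slant₀ n (x.φ 0) i) (fun i => fam u.f i ∘ₗ slant₀ n (y.φ 0) i)
      (susp n B.C u.χ)) (map_add _ _ _).symm
    (neg_mem (hatBracket_mem_succ _ _ _ (u.susp_χ_mem n))) ?_
  have h1 : bracket B' n (u.push x).φ (u.push y).φ =
      hatBracket n (fun i => fam u.f i ∘ₗ slant₀ n (x.φ 0) i)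
        (fun i => fam u.f i ∘ₗ slant₀ n (y.φ 0) i)
        (B.Γ n + dHat (dual n B.C) (n + 1) (susp n B.C u.χ)) := by
    rw [← u.hatPush_Γ n, hatBracket_hatPush]
    change hatBracket n (slant₀ n (biMap (fam u.f) (fam u.f) (x.φ 0)))
      (slant₀ n (biMap (fam u.f) (fam u.f) (y.φ 0))) _ = _
    rw [slant₀_biMap, slant₀_biMap]; rfl
  have h2 : (fun i => fam u.f i ∘ₗ slant₀ n ((x.φ + y.φ) 0) i) =
      (fun i => fam u.f i ∘ₗ slant₀ n (x.φ 0) i) + (fun i => fam u.f i ∘ₗ slant₀ n (y.φ 0) i) := by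
    ext i : 1
    rw [Pi.add_apply, slant₀_add, Pi.add_apply, LinearMap.comp_add]; rfl
  simp only [SymStr.add, h1]
  rw [map_neg, k, hatBracket_add]
  simp only [push, twist, map_add, bracket, h2, hatPush_hatBracket]
  abel

theorem push_id {n : ℤ} (x : SymStr B n) : (BundleHom.id B).push x = x := by
  refine SymStr.ext' ?_ ?_
  · ext s : 1
    exact biMap_id _
  · change hatPush (fam (𝟙 B.C)) x.θ - hatPush _ (susp n B.C 0) = x.θ
    rw [map_zero, map_zero, sub_zero]
    ext s : 1
    exact biMap_id _

theorem fam_comp {C D E : Cx A} (f : C ⟶ D) (g : D ⟶ E) :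
    fam (f ≫ g) = fun i => fam g i ∘ₗ fam f i := rfl

theorem push_comp (v : BundleHom B' B'') (u : BundleHom B B') {n : ℤ} (x : SymStr B n) :
    (v.comp u).push x = v.push (u.push x) := by
  refine SymStr.ext' ?_ ?_
  · ext s p q
    exact (STensor.map_map _ _ _ _ _).symm
  · change hatPush (fam (u.f ≫ v.f)) x.θ - hatPush (fun i => fam (u.f ≫ v.f) i ∘ₗ _)
      (susp n B.C (u.χ + pullback u.f v.χ)) = hatPush (fam v.f) (hatPush (fam u.f) x.θ -
        hatPush (fun i => fam u.f i ∘ₗ slant₀ n (x.φ 0) i) (susp n B.C u.χ)) -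
      hatPush (fun i => fam v.f i ∘ₗ slant₀ n (biMap (fam u.f) (fam u.f) (x.φ 0)) i)
        (susp n B'.C v.χ)
    rw [map_add, map_add, susp_hatPush, map_sub, slant₀_biMap, hatPush_hatPush, hatPush_hatPush,
      hatPush_hatPush, fam_comp]
    simp only [LinearMap.comp_assoc]
    abel

/-- The homotopy at s involves only the entries s and s - 1, so it preserves the chains supported in
s ≥ 0 and restricts to the symmetric complex. -/
theorem hatHtpy_Jmap_of_neg {C D : Cx A} (n : ℤ) (g : Fam₁ C D) (f f' : Fam C D) (φ : SymC C)
    (s : ℤ) (hs : s < 0) : hatHtpy n g f f' (Jmap C φ) s = 0 := by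
  rw [hatHtpy_apply, Jmap_of_neg _ hs, Jmap_of_neg _ (show s - 1 < 0 by omega)]
  simp only [map_zero, smul_zero, add_zero]

/-- The homotopy `(g; f, f')^%` on symmetric chains. -/
def _root_.AlgSurgery.symHtpy {C D : Cx A} (n : ℤ) (g : Fam₁ C D) (f f' : Fam C D) (φ : SymC C) :
    SymC D := fun s => hatHtpy n g f f' (Jmap C φ) s

theorem Jmap_symHtpy {C D : Cx A} (n : ℤ) (g : Fam₁ C D) (f f' : Fam C D) (φ : SymC C) :
    Jmap D (symHtpy n g f f' φ) = hatHtpy n g f f' (Jmap C φ) :=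
  Jmap_restrict (hatHtpy_Jmap_of_neg n g f f' φ)

theorem symHtpy_mem {C D : Cx A} {n : ℤ} (g : Fam₁ C D) (f f' : Fam C D) {φ : SymC C}
    (h : φ ∈ symChains C n) : symHtpy n g f f' φ ∈ symChains D (n + 1) :=
  restrict_mem (hatHtpy_mem n g f f' (Jmap_mem h))

/-- The quadratic term disappears because φ_{-1} = 0. The slant maps of what is left are g φ_0 f^*
and f' φ_0 g^*. -/
theorem symHtpy_apply_zero {C D : Cx A} (n : ℤ) (g : Fam₁ C D) (f f' : Fam C D) (φ : SymC C) :
    symHtpy n g f f' φ 0 = rightOp f g (φ 0) + leftOp g f' (φ 0) := by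
  change hatHtpy n g f f' (Jmap C φ) 0 = _
  rw [hatHtpy_apply, Jmap_of_neg _ (show (0 : ℤ) - 1 < 0 by omega), map_zero, map_zero, smul_zero,
    add_zero, Jmap_zero_apply]

theorem dSym_symHtpy {C D : Cx A} {n : ℤ} {f f' : C ⟶ D} (g : Homotopy f' f) {φ : SymC C}
    (h : φ ∈ symCycles C n) :
    symPush (fam f') φ - symPush (fam f) φ =
      dSym D (n + 1) (symHtpy n (fun i j => (g.hom i j).hom) (fam f) (fam f') φ) := by
  apply Jmap_injective
  rw [← dHat_Jmap, Jmap_symHtpy, map_sub, Jmap_symPush, Jmap_symPush, dHat_hatHtpy_cycle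
    (isChainFam_fam f) (isChainFam_fam f') (isHtpyFam_of_homotopy g)]
  rw [dHat_Jmap, AddMonoidHom.mem_ker.1 h.2, map_zero]

theorem Homotopic.push_equivalent {u v : BundleHom B B'} (h : u.Homotopic v) {n : ℤ}
    (x : SymStr B n) : (u.push x).Equivalent (v.push x) := by
  obtain ⟨g, η, hη, e⟩ := h
  have hf := isChainFam_fam u.f
  have hf' := isChainFam_fam v.f
  have hg := isHtpyFam_of_homotopy g
  have hx := x.isChainFam
  have hgx := hg.precomp hx
  have hD := isChainFam_fam (dualMap n u.f)
  have hP := isHtpyFam_dualHtpyFam n g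
  have e2 : susp n B.C u.χ - susp n B.C v.χ + hatHtpy n (dualHtpyFam n g.hom)
      (fam (dualMap n u.f)) (fam (dualMap n v.f)) (B'.Γ n) =
      dHat (dual n B.C) (n + 2) (susp n B.C η) := by
    rw [dHat_susp n 2 (n + 2) (add_comm _ _), ← e, map_add, map_sub, susp_hatHtpy]
  have k4 := dHat_hatHtpy_succ n hf hf' hg x.θ
  have k6 := dHat_hatHtpy_succ n (hf.comp hx) (hf'.comp hx) hgx (susp n B.C u.χ)
  have k7 := congrArg (hatPush (fun i => fam v.f i ∘ₗ slant₀ n (x.φ 0) i)) e2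
  rw [← dHat_hatPush' _ (hf'.comp hx), map_add, map_sub, hatPush_hatHtpy] at k7
  -- The homotopy from f φ_0 f^* to f' φ_0 f'^* passes through f' φ_0 f^*.
  have k8 := dHat_hatConcat_cycle (hgx.precomp hD) (hP.postcomp (hf'.comp hx)) (B'.dHat_Γ n)
  have k9 : hatHtpy n (slant₁ n (symHtpy n (fun i j => (g.hom i j).hom) (fam u.f) (fam v.f) x.φ 0))
      (slant₀ n ((u.push x).φ 0)) (slant₀ n ((v.push x).φ 0)) (B'.Γ n) = _ :=
    hatHtpy_congr n (g' := (fun i j => ((g.hom i j).hom ∘ₗ slant₀ n (x.φ 0) i) ∘ₗ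
      fam (dualMap n u.f) i) + (fun i j => (fam v.f j ∘ₗ slant₀ n (x.φ 0) j) ∘ₗ
        dualHtpyFam n g.hom i j)) (fun q => by
      rw [symHtpy_apply_zero, slant₁_add, Pi.add_apply, Pi.add_apply, slant₁_rightOp,
        slant₁_leftOp]
      rfl) _ _ _
  have s1 : slant₀ n ((u.push x).φ 0) = fun i => (fam u.f i ∘ₗ slant₀ n (x.φ 0) i) ∘ₗ
      fam (dualMap n u.f) i := slant₀_biMap n u.f _
  have s2 : slant₀ n ((v.push x).φ 0) = fun i => (fam v.f i ∘ₗ slant₀ n (x.φ 0) i) ∘ₗ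
      fam (dualMap n v.f) i := slant₀_biMap n v.f _
  have k5 : hatHtpy n (fun i j => (g.hom i j).hom) (fam u.f) (fam v.f) (Jmap B.C x.φ) =
      hatHtpy n (fun i j => (g.hom i j).hom) (fam u.f) (fam v.f) (dHat B.C (n + 1) x.θ) +
      (hatHtpy n (fun i j => ((g.hom i j).hom ∘ₗ slant₀ n (x.φ 0) i) ∘ₗ fam (dualMap n u.f) i)
        (fun i => (fam u.f i ∘ₗ slant₀ n (x.φ 0) i) ∘ₗ fam (dualMap n u.f) i)
        (fun i => (fam v.f i ∘ₗ slant₀ n (x.φ 0) i) ∘ₗ fam (dualMap n u.f) i) (B'.Γ n) -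
      hatHtpy n (fun i j => (g.hom i j).hom ∘ₗ slant₀ n (x.φ 0) i)
        (fun i => fam u.f i ∘ₗ slant₀ n (x.φ 0) i) (fun i => fam v.f i ∘ₗ slant₀ n (x.φ 0) i)
        (dHat (dual n B.C) (n + 1) (susp n B.C u.χ))) := by
    rw [← hatHtpy_hatPush n (fam (dualMap n u.f))
        (fun i j => (g.hom i j).hom ∘ₗ slant₀ n (x.φ 0) i),
      ← hatHtpy_sub, u.hatPush_Γ n, add_sub_cancel_right,
      ← hatHtpy_hatPush n (slant₀ n (x.φ 0)) (fun i j => (g.hom i j).hom), ← hatHtpy_add, ← x.eq,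
      sub_add_cancel]
  -- The four parts of η come from homotoping θ along g, homotoping S^n χ along g φ_0, concatenating
  -- the two halves of the homotopy of f φ_0 f^*, and pushing the suspended homotopy of bundle maps
  -- along f' φ_0.
  refine ⟨symHtpy n (fun i j => (g.hom i j).hom) (fam u.f) (fam v.f) x.φ,
    symHtpy_mem _ _ _ x.φ_mem.1,
    -hatHtpy (n + 1) (fun i j => (g.hom i j).hom) (fam u.f) (fam v.f) x.θ +
      hatHtpy (n + 1) (fun i j => (g.hom i j).hom ∘ₗ slant₀ n (x.φ 0) i)
        (fun i => fam u.f i ∘ₗ slant₀ n (x.φ 0) i) (fun i => fam v.f i ∘ₗ slant₀ n (x.φ 0) i)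
        (susp n B.C u.χ) -
      hatConcat (fun i j => ((g.hom i j).hom ∘ₗ slant₀ n (x.φ 0) i) ∘ₗ fam (dualMap n u.f) i)
        (fun i j => (fam v.f j ∘ₗ slant₀ n (x.φ 0) j) ∘ₗ dualHtpyFam n g.hom i j) (B'.Γ n) -
      hatPush (fun i => fam v.f i ∘ₗ slant₀ n (x.φ 0) i) (susp n B.C η),
    sub_mem (sub_mem (add_mem (neg_mem (hatHtpy_mem_succ _ _ _ _ x.θ_mem))
      (hatHtpy_mem_succ _ _ _ _ (u.susp_χ_mem n))) (hatConcat_mem _ _ (B'.Γ_mem n)))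
      (hatPush_mem _ (susp_mem (add_comm _ _) hη)), dSym_symHtpy g x.φ_mem, ?_⟩
  rw [map_sub, map_sub, map_add, map_neg, k4, k6, k8, ← k7, k9, Jmap_symHtpy, k5, s1, s2]
  simp only [push, twist]
  abel

end BundleHom

namespace QTw

variable {B B' B'' : ChainBundle A}

/-- The homomorphism `(f, χ)_%`. -/
def push (u : BundleHom B B') (n : ℤ) : QTw B n →+ QTw B' n :=
  AddMonoidHom.mk' (Quot.map u.push fun _ _ h => u.push_equivalent h) (by
    rintro ⟨x⟩ ⟨y⟩
    exact (mk_eq_iff.2 (u.push_add_equivalent x y)).symm)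

theorem push_id (B : ChainBundle A) (n : ℤ) : push (BundleHom.id B) n = AddMonoidHom.id _ := by
  ext ⟨x⟩
  exact congrArg mk (BundleHom.push_id x)

theorem push_comp (v : BundleHom B' B'') (u : BundleHom B B') (n : ℤ) :
    push (v.comp u) n = (push v n).comp (push u n) := by
  ext ⟨x⟩
  exact congrArg mk (BundleHom.push_comp v u x)

theorem push_eq_of_homotopic {u v : BundleHom B B'} (h : u.Homotopic v) (n : ℤ) :
    push u n = push v n := by
  ext ⟨x⟩
  exact mk_eq_iff.2 (h.push_equivalent x)

end QTw

/-! ### Functoriality and homotopy invariance of the untwisted groups -/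

section Untwisted

variable {C D E : Cx A}

theorem mem_symCycles {n : ℤ} {φ : SymC C} :
    φ ∈ symCycles C n ↔ φ ∈ symChains C n ∧ dSym C n φ = 0 := Iff.rfl

theorem mem_hatCycles {n : ℤ} {θ : HatC C} :
    θ ∈ hatCycles C n ↔ θ ∈ hatChains C n ∧ dHat C n θ = 0 := Iff.rfl

theorem QSym.mk_eq_mk {n : ℤ} {φ φ' : symCycles C n} {ξ : SymC C} (hξ : ξ ∈ symChains C (n + 1))
    (h : (φ' : SymC C) - φ = dSym C (n + 1) ξ) : QSym.mk φ = QSym.mk φ' := by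
  refine QuotientAddGroup.eq.2 ⟨ξ, hξ, ?_⟩
  rw [← h]
  change _ = -(φ : SymC C) + φ'
  abel

theorem QHat.mk_eq_mk {n : ℤ} {θ θ' : hatCycles C n} {η : HatC C} (hη : η ∈ hatChains C (n + 1))
    (h : (θ' : HatC C) - θ = dHat C (n + 1) η) : QHat.mk θ = QHat.mk θ' := by
  refine QuotientAddGroup.eq.2 ⟨η, hη, ?_⟩
  rw [← h]
  change _ = -(θ : HatC C) + θ'
  abel

theorem QSym.mk_eq_mk_iff {n : ℤ} {φ φ' : symCycles C n} : QSym.mk φ = QSym.mk φ' ↔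
    ∃ ξ ∈ symChains C (n + 1), (φ' : SymC C) - φ = dSym C (n + 1) ξ := by
  refine ⟨fun h => ?_, fun ⟨ξ, hξ, h⟩ => mk_eq_mk hξ h⟩
  obtain ⟨ξ, hξ, e⟩ := QuotientAddGroup.eq.1 h
  refine ⟨ξ, hξ, ?_⟩
  rw [e]
  change _ = -(φ : SymC C) + φ'
  abel

theorem QHat.mk_eq_mk_iff {n : ℤ} {θ θ' : hatCycles C n} : QHat.mk θ = QHat.mk θ' ↔
    ∃ η ∈ hatChains C (n + 1), (θ' : HatC C) - θ = dHat C (n + 1) η := by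
  refine ⟨fun h => ?_, fun ⟨η, hη, h⟩ => mk_eq_mk hη h⟩
  obtain ⟨η, hη, e⟩ := QuotientAddGroup.eq.1 h
  refine ⟨η, hη, ?_⟩
  rw [e]
  change _ = -(θ : HatC C) + θ'
  abel

theorem QSym.map_id (n : ℤ) : QSym.map (𝟙 C) n = AddMonoidHom.id _ :=
  QuotientAddGroup.addMonoidHom_ext _ (AddMonoidHom.ext fun _ => congrArg QSym.mk
    (Subtype.ext (funext fun _ => biMap_id _)))

theorem QHat.map_id (n : ℤ) : QHat.map (𝟙 C) n = AddMonoidHom.id _ :=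
  QuotientAddGroup.addMonoidHom_ext _ (AddMonoidHom.ext fun _ => congrArg QHat.mk
    (Subtype.ext (funext fun _ => biMap_id _)))

theorem biMap_comp (f : C ⟶ D) (g : D ⟶ E) (x : Bi C) :
    biMap (fam (f ≫ g)) (fam (f ≫ g)) x = biMap (fam g) (fam g) (biMap (fam f) (fam f) x) := by
  ext p q
  exact (STensor.map_map _ _ _ _ _).symm

theorem QSym.map_comp (f : C ⟶ D) (g : D ⟶ E) (n : ℤ) :
    QSym.map (f ≫ g) n = (QSym.map g n).comp (QSym.map f n) :=
  QuotientAddGroup.addMonoidHom_ext _ (AddMonoidHom.ext fun _ => congrArg QSym.mk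
    (Subtype.ext (funext fun _ => biMap_comp f g _)))

theorem QHat.map_comp (f : C ⟶ D) (g : D ⟶ E) (n : ℤ) :
    QHat.map (f ≫ g) n = (QHat.map g n).comp (QHat.map f n) :=
  QuotientAddGroup.addMonoidHom_ext _ (AddMonoidHom.ext fun _ => congrArg QHat.mk
    (Subtype.ext (funext fun _ => biMap_comp f g _)))

theorem QSym.map_eq_of_homotopy {f f' : C ⟶ D} (g : Homotopy f' f) (n : ℤ) :
    QSym.map f n = QSym.map f' n :=
  QuotientAddGroup.addMonoidHom_ext _ (AddMonoidHom.ext fun φ =>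
    QSym.mk_eq_mk (BundleHom.symHtpy_mem _ _ _ φ.2.1) (BundleHom.dSym_symHtpy g φ.2))

theorem QHat.map_eq_of_homotopy {f f' : C ⟶ D} (g : Homotopy f' f) (n : ℤ) :
    QHat.map f n = QHat.map f' n :=
  QuotientAddGroup.addMonoidHom_ext _ (AddMonoidHom.ext fun θ =>
    QHat.mk_eq_mk (hatHtpy_mem n _ _ _ θ.2.1) (dHat_hatHtpy_cycle (isChainFam_fam f)
      (isChainFam_fam f') (isHtpyFam_of_homotopy g) (AddMonoidHom.mem_ker.1 θ.2.2)).symm)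

end Untwisted

theorem bijective_of_comp_eq_id {G G' : Type*} [AddCommGroup G] [AddCommGroup G'] {f : G →+ G'}
    {g : G' →+ G} (h : g.comp f = AddMonoidHom.id _) (h' : f.comp g = AddMonoidHom.id _) :
    Function.Bijective f :=
  Function.bijective_iff_has_inverse.2 ⟨g, DFunLike.congr_fun h, DFunLike.congr_fun h'⟩

/-- All three inverses are induced by a homotopy inverse; no five lemma is needed. -/
theorem BundleHom.IsEquiv.bijective {B B' : ChainBundle A} {u : BundleHom B B'} (h : u.IsEquiv)
    (n : ℤ) : Function.Bijective (QTw.push u n) ∧ Function.Bijective (QSym.map u.f n) ∧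
      Function.Bijective (QHat.map u.f n) := by
  obtain ⟨v, h, h'⟩ := h
  refine ⟨bijective_of_comp_eq_id (g := QTw.push v n) ?_ ?_,
    bijective_of_comp_eq_id (g := QSym.map v.f n) ?_ ?_,
    bijective_of_comp_eq_id (g := QHat.map v.f n) ?_ ?_⟩
  · rw [← QTw.push_comp, QTw.push_eq_of_homotopic h, QTw.push_id]
  · rw [← QTw.push_comp, QTw.push_eq_of_homotopic h', QTw.push_id]
  · rw [← QSym.map_comp, ← QSym.map_id]
    obtain ⟨g, -⟩ := h
    exact QSym.map_eq_of_homotopy g n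
  · rw [← QSym.map_comp, ← QSym.map_id]
    obtain ⟨g, -⟩ := h'
    exact QSym.map_eq_of_homotopy g n
  · rw [← QHat.map_comp, ← QHat.map_id]
    obtain ⟨g, -⟩ := h
    exact QHat.map_eq_of_homotopy g n
  · rw [← QHat.map_comp, ← QHat.map_id]
    obtain ⟨g, -⟩ := h'
    exact QHat.map_eq_of_homotopy g n

/-! ### The exact sequence -/

namespace QTw

variable {B B' : ChainBundle A} {n : ℤ}

/-- The symmetric structure `(0, θ)` of a cycle `θ`. -/
def _root_.AlgSurgery.SymStr.ofHat {B : ChainBundle A} {n : ℤ} (θ : hatCycles B.C (n + 1)) :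
    SymStr B n where
  φ := 0
  φ_mem := zero_mem _
  θ := θ
  θ_mem := θ.2.1
  eq := by
    rw [Pi.zero_apply, slant₀_zero, hatPush_zero_fam, map_zero, sub_zero]
    exact (AddMonoidHom.mem_ker.1 θ.2.2).symm

/-- The homomorphism `H_γ`. -/
def H (B : ChainBundle A) (n : ℤ) : QHat B.C (n + 1) →+ QTw B n :=
  QuotientAddGroup.lift _
    (AddMonoidHom.mk' (fun θ => mk (SymStr.ofHat θ)) (fun θ θ' => by
      rw [mk_add]
      refine congrArg mk (SymStr.ext' (add_zero _).symm ?_)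
      change (θ : HatC B.C) + (θ' : HatC B.C) = (θ : HatC B.C) + (θ' : HatC B.C) +
        hatBracket n (slant₀ n 0) _ _
      rw [slant₀_zero, hatBracket_zero_left, add_zero])) (by
    rintro θ ⟨η, hη, e⟩
    rw [add_assoc, one_add_one_eq_two] at hη e
    exact mk_eq_iff.2 (SymStr.equivalent_of_eq rfl hη (by
      rw [e]; exact sub_zero _)))

/-- The homomorphism `N_γ`. -/
def N (B : ChainBundle A) (n : ℤ) : QTw B n →+ QSym B.C n :=
  AddMonoidHom.mk' (Quot.lift (fun x => QSym.mk ⟨x.φ, x.φ_mem⟩) (by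
    rintro x y ⟨ξ, hξ, η, hη, e, -⟩
    exact QSym.mk_eq_mk hξ e)) (by
    rintro ⟨x⟩ ⟨y⟩
    rfl)

/-- The cycle `J(φ) - (φ_0)^%(S^n γ)`. -/
def Jcycle (B : ChainBundle A) (n : ℤ) (φ : symCycles B.C n) : hatCycles B.C n :=
  ⟨Jmap B.C φ - hatPush (slant₀ n ((φ : SymC B.C) 0)) (B.Γ n),
    mem_hatCycles.2 ⟨sub_mem (Jmap_mem φ.2.1) (hatPush_mem _ (B.Γ_mem n)), by
    rw [map_sub, dHat_Jmap, (mem_symCycles.1 φ.2).2,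
      dHat_hatPush' n (isChainFam_of_mem φ.2), B.dHat_Γ, map_zero, map_zero, sub_zero]⟩⟩

/-- The homomorphism `J_γ`. -/
def J (B : ChainBundle A) (n : ℤ) : QSym B.C n →+ QHat B.C n :=
  QuotientAddGroup.lift _
    (AddMonoidHom.mk' (fun φ => QHat.mk (Jcycle B n φ)) (fun φ φ' => by
      have h := isChainFam_of_mem φ.2
      have h' := isChainFam_of_mem φ'.2
      -- J_γ is additive only on homology: the bracket bounds the defect.
      refine QHat.mk_eq_mk (θ' := Jcycle B n φ + Jcycle B n φ')
        (neg_mem (hatBracket_mem n (slant₀ n ((φ : SymC B.C) 0))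
          (slant₀ n ((φ' : SymC B.C) 0)) (B.Γ_mem n))) ?_
      rw [map_neg, dHat_hatBracket_cycle h h' (B.dHat_Γ n)]
      simp only [Jcycle, AddSubgroup.coe_add, map_add, Pi.add_apply, slant₀_add]
      abel)) (by
    rintro φ ⟨ξ, hξ, e⟩
    have h0 : (φ : SymC B.C) - 0 = dSym B.C (n + 1) ξ := (sub_zero _).trans e.symm
    have hφ := isChainFam_of_mem φ.2
    have hg := isHtpyFam_of_eq (n := n) h0
    -- If φ = dξ, then ξ_0 is a homotopy from 0 to φ_0, which makes (φ_0)^%(Γ) a boundary.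
    rw [Pi.zero_apply, slant₀_zero] at hg
    refine (QHat.mk_eq_mk (θ := 0) (θ' := Jcycle B n φ) (sub_mem (Jmap_mem hξ)
      (hatHtpy_mem n (slant₁ n (ξ 0)) 0 (slant₀ n ((φ : SymC B.C) 0)) (B.Γ_mem n))) ?_).symm
    rw [map_sub, dHat_hatHtpy_cycle isChainFam_zero hφ hg (B.dHat_Γ n), hatPush_zero_fam,
      dHat_Jmap, ← h0, sub_zero, sub_zero]
    exact sub_zero _)

theorem exact_H_N (B : ChainBundle A) (n : ℤ) : Function.Exact (H B n) (N B n) := by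
  rintro ⟨x⟩
  constructor
  · intro h
    obtain ⟨ξ, hξ, e⟩ := QSym.mk_eq_mk_iff.1 (show QSym.mk ⟨x.φ, x.φ_mem⟩ = QSym.mk 0 from h)
    have e' : 0 - x.φ = dSym B.C (n + 1) ξ := e
    have hg := isHtpyFam_of_eq (n := n) e'
    rw [Pi.zero_apply, slant₀_zero] at hg
    -- With φ replaced by 0 through ξ, this θ is forced by the equivalence relation with η = 0.
    let θ : hatCycles B.C (n + 1) := ⟨x.θ + Jmap B.C ξ -
      hatHtpy n (slant₁ n (ξ 0)) (slant₀ n (x.φ 0)) 0 (B.Γ n),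
      mem_hatCycles.2 ⟨sub_mem (add_mem x.θ_mem (Jmap_mem hξ)) (hatHtpy_mem n _ _ _ (B.Γ_mem n)), by
      rw [map_sub, map_add,
        dHat_hatHtpy_cycle x.isChainFam isChainFam_zero hg (B.dHat_Γ n), ← x.eq, dHat_Jmap, ← e',
        hatPush_zero_fam, zero_sub, zero_sub, map_neg]
      abel⟩⟩
    refine ⟨QHat.mk θ, (mk_eq_iff (x := x) (y := SymStr.ofHat θ)).2
      ⟨ξ, hξ, 0, zero_mem _, e', ?_⟩ |>.symm⟩
    change x.θ - (x.θ + Jmap B.C ξ -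
      hatHtpy n (slant₁ n (ξ 0)) (slant₀ n (x.φ 0)) 0 (B.Γ n)) + Jmap B.C ξ -
      hatHtpy n (slant₁ n (ξ 0)) (slant₀ n (x.φ 0)) (slant₀ n 0) (B.Γ n) = _
    rw [slant₀_zero, map_zero]
    abel
  · rintro ⟨θ, hθ⟩
    induction θ using QuotientAddGroup.induction_on with
    | H θ => rw [← hθ]; rfl

/-- A chain θ completing φ to a symmetric structure is precisely a null-homology of the cycle
representing J_γ(φ). -/
theorem exact_N_J (B : ChainBundle A) (n : ℤ) : Function.Exact (N B n) (J B n) := by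
  intro φ
  induction φ using QuotientAddGroup.induction_on with
  | H φ =>
  constructor
  · intro h
    obtain ⟨θ, hθ, e⟩ := QHat.mk_eq_mk_iff.1 (show QHat.mk 0 = QHat.mk (Jcycle B n φ) from h.symm)
    exact ⟨mk ⟨φ, φ.2, θ, hθ, (sub_zero _).symm.trans e⟩, rfl⟩
  · rintro ⟨⟨x⟩, hx⟩
    rw [← hx]
    refine (QHat.mk_eq_mk (θ := 0) (θ' := Jcycle B n ⟨x.φ, x.φ_mem⟩) x.θ_mem ?_).symm
    exact (sub_zero _).trans x.eq

/-- Transport along equal indices: it lets (n + 1) - p be read as n - (p - 1). -/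
theorem map_slant_congr {C : Cx A} (x : Bi C) (θ : HatC (dual 0 C))
    {p q s s' i i' j j' k k' l l' : ℤ}
    (hs : s = s') (hi : i = i') (hj : j = j') (hk : k = k') (hl : l = l') (e : i = 0 - j)
    (e' : i' = 0 - j') (h : k = 0 - l) (h' : k' = 0 - l') :
    STensor.map (STensor.slant (x i p) ∘ₗ StarDual.map (C.XIsoOfEq e).hom.hom)
      (STensor.slant (x k q) ∘ₗ StarDual.map (C.XIsoOfEq h).hom.hom) (θ s j l) =
    STensor.map (STensor.slant (x i' p) ∘ₗ StarDual.map (C.XIsoOfEq e').hom.hom)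
      (STensor.slant (x k' q) ∘ₗ StarDual.map (C.XIsoOfEq h').hom.hom) (θ s' j' l') := by
  subst hs hi hj hk hl
  rfl

/-- One element x is read both as a degree 0 family on C^{(n+1)-*} and as a degree 1 family on
C^{n-*}. The extra suspension moves s by one and contributes the sign. -/
theorem hatPush_slant_Γ_succ (B : ChainBundle A) (n : ℤ) (x : Bi B.C) (s : ℤ) :
    hatPush (slant₀ (n + 1) x) (B.Γ (n + 1)) s =
      (n.negOnePow : ℤ) • bothOp (slant₁ n x) (slant₁ n x) (B.Γ n (s - 1)) := by
  ext p q
  have key := map_slant_congr x B.γ (p := p) (q := q) (show s - (n + 1) = s - 1 - n by ring)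
    (show n + 1 - p = n - (p - 1) by ring) (show p - (n + 1) = p - 1 - n by ring)
    (show n + 1 - q = n - (q - 1) by ring) (show q - (n + 1) = q - 1 - n by ring)
    (by ring) (by ring) (by ring) (by ring)
  simp only [hatPush_apply, biMap_apply, susp_apply, suspBi_apply, Pi.smul_apply, bothOp_apply,
    map_zsmul, STensor.map_map, smul_smul, ← Units.val_mul, ← Int.negOnePow_add]
  refine congrArg₂ _ ?_ key
  congr 1
  rw [Int.negOnePow_eq_iff]
  have e : (n + 1) * (q - (n + 1)) - (n + (q - 1 + n * (q - 1 - n))) = -(n + n) := by ring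
  rw [e]
  exact ⟨-n, by ring⟩

/-- For a cycle `θ` and `g : 0 ≃ 0`, the chain `(g ⊗ g)(θ_s + T θ_s)` shifted by one is a
boundary. -/
theorem dHat_bothOp_even {C D : Cx A} (n : ℤ) {g : Fam₁ C D} (hg : IsHtpyFam g 0 0) {θ : HatC C}
    (h : dHat C n θ = 0) :
    dHat D (n + 2) (fun s => if Even s then bothOp g g (θ s) else 0) =
      fun s => (n.negOnePow : ℤ) •
        (bothOp g g (θ (s - 1)) + bothOp g g (T C (θ (s - 1)))) := by
  ext s : 1
  have h1 : dBi C (θ s) = _ := eq_neg_of_add_eq_zero_left (congrFun h s)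
  have h2 : dBi D (bothOp g g (θ s)) = bothOp g g (dBi C (θ s)) := by
    rw [dBi_bothOp hg hg, sub_zero, leftOp_zero_right, rightOp_zero_left, add_zero, sub_zero]
  rw [dHat_apply]
  rcases Int.even_or_odd s with hs | hs
  -- For even s only d(θ_s) contributes, and the cycle condition rewrites it as (-1)^n (θ_{s-1} + T
  -- θ_{s-1}).
  · have hs' : ¬ Even (s - 1) := by
      rw [Int.not_even_iff_odd]; exact hs.sub_odd odd_one
    rw [if_pos hs, if_neg hs', h2, h1]
    rcases Int.units_eq_one_or n.negOnePow with hn | hn <;>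
    simp [Int.negOnePow_add, Int.negOnePow_sub, Int.negOnePow_even s hs, hn] <;> abel
  -- For odd s only the terms in θ_{s-1} contribute; the sign (-1)^s cancels the sign by which `T`
  -- anticommutes with g ⊗ g.
  · have hs' : Even (s - 1) := hs.sub_odd odd_one
    rw [if_neg (Int.not_even_iff_odd.2 hs), if_pos hs', T_bothOp]
    rcases Int.units_eq_one_or n.negOnePow with hn | hn <;>
    simp [Int.negOnePow_add, Int.negOnePow_sub, Int.negOnePow_odd s hs,
      Int.negOnePow_even 2 even_two, hn]

theorem even_bothOp_mem {C D : Cx A} {n : ℤ} (g : Fam₁ C D) {θ : HatC C}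
    (h : θ ∈ hatChains C n) :
    (fun s => if Even s then bothOp g g (θ s) else 0) ∈ hatChains D (n + 2) := fun s p q hs => by
  dsimp only
  split_ifs
  · exact hatConcat_mem g g h s p q hs
  · rfl

/-- For homotopies from 0 to 0 only the quadratic term g ⊗ g on T Γ_{s-1} survives. Added to g ⊗ g
on Γ_{s-1}, it gives the boundary of the even-indexed chain. -/
theorem hatPush_slant_Γ_succ_eq (B : ChainBundle A) (n : ℤ) {φ : SymC B.C}
    (hφ : φ ∈ symCycles B.C (n + 1)) :
    ∃ η ∈ hatChains B.C (n + 2), hatPush (slant₀ (n + 1) (φ 0)) (B.Γ (n + 1)) +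
      hatHtpy n (slant₁ n (φ 0)) 0 0 (B.Γ n) = dHat B.C (n + 2) η := by
  have e : (0 : SymC B.C) - 0 = dSym B.C (n + 1) φ := by
    rw [sub_zero, (mem_symCycles.1 hφ).2]
  have hg := isHtpyFam_of_eq (n := n) e
  rw [Pi.zero_apply, slant₀_zero] at hg
  refine ⟨_, even_bothOp_mem (slant₁ n (φ 0)) (B.Γ_mem n), ?_⟩
  rw [dHat_bothOp_even n hg (B.dHat_Γ n)]
  ext s : 1
  rw [Pi.add_apply, hatPush_slant_Γ_succ, hatHtpy_apply, rightOp_zero_left, leftOp_zero_right,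
    zero_add, zero_add, smul_add]

theorem exact_J_H (B : ChainBundle A) (n : ℤ) : Function.Exact (J B (n + 1)) (H B n) := by
  intro θ
  induction θ using QuotientAddGroup.induction_on with
  | H θ =>
  constructor
  · intro h
    obtain ⟨ξ, hξ, η, hη, e, e'⟩ :=
      (mk_eq_iff (x := SymStr.ofHat θ) (y := SymStr.zero B n)).1 h
    have e : (0 : SymC B.C) - 0 = dSym B.C (n + 1) ξ := e
    have hξ' : -ξ ∈ symCycles B.C (n + 1) := neg_mem (mem_symCycles.2 ⟨hξ, by rw [← e, sub_zero]⟩)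
    have e' : (θ : HatC B.C) - 0 + Jmap B.C ξ - hatHtpy n (slant₁ n (ξ 0)) (slant₀ n 0)
      (slant₀ n 0) (B.Γ n) = dHat B.C (n + 2) η := e'
    obtain ⟨ν, hν, k⟩ := hatPush_slant_Γ_succ_eq B n (neg_mem hξ')
    rw [neg_neg] at k
    -- The sign on ξ is forced: in the equivalence J(ξ) stands on the same side as θ. The quadratic
    -- term does not see it.
    refine ⟨QSym.mk ⟨-ξ, hξ'⟩, QHat.mk_eq_mk (η := η + ν) ?_ ?_⟩
    · rw [add_assoc, one_add_one_eq_two]; exact add_mem hη hν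
    · rw [add_assoc, one_add_one_eq_two, map_add, ← e', ← k, slant₀_zero]
      simp only [Jcycle, Pi.neg_apply, slant₀_neg, hatPush_neg_fam, map_neg]
      abel
  · rintro ⟨φ, hφ⟩
    rw [← hφ]
    induction φ using QuotientAddGroup.induction_on with
    | H φ =>
    obtain ⟨ν, hν, k⟩ := hatPush_slant_Γ_succ_eq B n (neg_mem φ.2)
    refine mk_eq_iff.2 ⟨-φ, neg_mem φ.2.1, -ν, neg_mem hν, ?_, ?_⟩
    · change (0 : SymC B.C) - 0 = _
      rw [map_neg, (mem_symCycles.1 φ.2).2, neg_zero, sub_zero]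
    · change Jmap B.C φ - hatPush (slant₀ (n + 1) ((φ : SymC B.C) 0)) (B.Γ (n + 1)) - 0 +
        Jmap B.C (-φ) - hatHtpy n (slant₁ n ((-φ : SymC B.C) 0)) (slant₀ n 0) (slant₀ n 0)
          (B.Γ n) = _
      rw [map_neg (dHat _ _), ← k, slant₀_zero]
      simp only [Pi.neg_apply, slant₀_neg, hatPush_neg_fam, map_neg]
      abel

/-! ### Naturality -/

theorem push_H (u : BundleHom B B') (n : ℤ) :
    (push u n).comp (H B n) = (H B' n).comp (QHat.map u.f (n + 1)) := by
  refine QuotientAddGroup.addMonoidHom_ext _ (AddMonoidHom.ext fun θ => congrArg mk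
    (SymStr.ext' (map_zero _) ?_))
  change hatPush (fam u.f) θ - hatPush (fun i => fam u.f i ∘ₗ slant₀ n 0 i) _ =
    hatPush (fam u.f) θ
  have e : (fun i => fam u.f i ∘ₗ slant₀ n (0 : Bi B.C) i) = 0 := by
    ext i : 1
    rw [slant₀_zero, Pi.zero_apply, LinearMap.comp_zero]; rfl
  rw [e, hatPush_zero_fam, sub_zero]

theorem N_push (u : BundleHom B B') (n : ℤ) :
    (N B' n).comp (push u n) = (QSym.map u.f n).comp (N B n) := by
  ext ⟨x⟩
  rfl

/-- On representatives the square commutes only up to the boundary of (f φ_0)^%(S^n χ), the twist of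
the covariance formula. -/
theorem J_map (u : BundleHom B B') (n : ℤ) :
    (J B' n).comp (QSym.map u.f n) = (QHat.map u.f n).comp (J B n) := by
  refine QuotientAddGroup.addMonoidHom_ext _ (AddMonoidHom.ext fun φ => ?_)
  refine QHat.mk_eq_mk (θ := Jcycle B' n ⟨symPush (fam u.f) φ, symPush_cycles u.f n _ φ.2⟩)
    (θ' := ⟨hatPush (fam u.f) (Jcycle B n φ), hatPush_cycles u.f n _ (Jcycle B n φ).2⟩)
    (hatPush_mem (fun i => fam u.f i ∘ₗ slant₀ n ((φ : SymC B.C) 0) i) (u.susp_χ_mem n)) ?_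
  rw [dHat_hatPush' _ ((isChainFam_fam u.f).comp (isChainFam_of_mem φ.2))]
  change hatPush (fam u.f) (Jmap B.C φ - hatPush (slant₀ n ((φ : SymC B.C) 0)) (B.Γ n)) -
    (Jmap B'.C (symPush (fam u.f) φ) -
      hatPush (slant₀ n (biMap (fam u.f) (fam u.f) ((φ : SymC B.C) 0))) (B'.Γ n)) = _
  rw [BundleHom.hatPush_slant, u.hatPush_Γ n, map_add, map_sub, hatPush_hatPush, Jmap_symPush]
  abel

end QTw

/-! ### The untwisted case -/

section ZeroBundle

variable {C : Cx A} {n : ℤ}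

theorem QQuad.mk_eq_mk_iff {ψ ψ' : quadCycles C n} : QQuad.mk ψ = QQuad.mk ψ' ↔
    ∃ χ ∈ quadChains C (n + 1), (ψ' : SymC C) - ψ = dQuad C (n + 1) χ := by
  constructor
  · intro h
    obtain ⟨ξ, hξ, e⟩ := QuotientAddGroup.eq.1 h
    refine ⟨ξ, hξ, ?_⟩
    rw [e]
    change _ = -(ψ : SymC C) + ψ'
    abel
  · rintro ⟨ξ, hξ, h⟩
    refine QuotientAddGroup.eq.2 ⟨ξ, hξ, ?_⟩
    rw [← h]
    change _ = -(ψ : SymC C) + ψ'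
    abel

theorem quadToHat_of_neg (ψ : SymC C) {s : ℤ} (hs : s < 0) :
    quadToHat C n ψ s = (n.negOnePow : ℤ) • ψ (-s - 1).toNat := if_pos hs

theorem quadToHat_of_nonneg (ψ : SymC C) {s : ℤ} (hs : 0 ≤ s) :
    quadToHat C n ψ s = 0 := if_neg (not_lt.2 hs)

theorem quadToHat_add (ψ ψ' : SymC C) :
    quadToHat C n (ψ + ψ') = quadToHat C n ψ + quadToHat C n ψ' := by
  ext s : 1
  by_cases h : s < 0 <;> simp [quadToHat, h]

theorem quadToHat_mem {ψ : SymC C} (h : ψ ∈ quadChains C n) :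
    quadToHat C n ψ ∈ hatChains C (n + 1) := fun s p q hs => by
  rcases lt_or_ge s 0 with h0 | h0
  · rw [quadToHat_of_neg _ h0, Pi.smul_apply, Pi.smul_apply, h _ p q (by omega), smul_zero]
  · rw [quadToHat_of_nonneg _ h0]; rfl

/-- Truncation at s < 0 fails to be a chain map only at s = 0, where the entry at s = -1 contributes
(1 + T)ψ_0. The factor (-1)^n in `quadToHat` makes this contribution exactly J((1 + T)ψ). -/
theorem dHat_quadToHat (ψ : SymC C) : dHat C (n + 1) (quadToHat C n ψ) =
    Jmap C (onePlusT C ψ) + quadToHat C n (dQuad C n ψ) := by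
  ext s : 1
  rw [Pi.add_apply, dHat_apply]
  rcases lt_trichotomy s 0 with h | rfl | h
  · obtain ⟨k, rfl⟩ : ∃ k : ℕ, s = -(k : ℤ) - 1 := ⟨(-s - 1).toNat, by omega⟩
    have e1 : (-(-(k : ℤ) - 1) - 1).toNat = k := by omega
    have e2 : (-(-(k : ℤ) - 1 - 1) - 1).toNat = k + 1 := by omega
    have e3 : n + 1 + (-(k : ℤ) - 1) - 1 = n - k - 1 := by ring
    have e4 : (-(k : ℤ) - 1).negOnePow = (k + 1 : ℤ).negOnePow := by
      rw [← Int.negOnePow_neg]; congr 1; ring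
    rw [Jmap_of_neg _ h, quadToHat_of_neg _ h, quadToHat_of_neg _ h,
      quadToHat_of_neg _ (by omega : -(k : ℤ) - 1 - 1 < 0), e1, e2, e3, e4, zero_add]
    simp only [dQuad, AddMonoidHom.coe_mk, ZeroHom.coe_mk]
    rcases Int.units_eq_one_or n.negOnePow with hn | hn <;> simp [hn]
  · rw [quadToHat_of_nonneg _ le_rfl, quadToHat_of_nonneg _ le_rfl,
      quadToHat_of_neg _ (by omega : (0 : ℤ) - 1 < 0), Jmap_zero_apply]
    rcases Int.units_eq_one_or n.negOnePow with hn | hn <;> simp [hn, onePlusT]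
  · obtain ⟨k, rfl⟩ : ∃ k : ℕ, s = (k + 1 : ℕ) := ⟨(s - 1).toNat, by omega⟩
    rw [quadToHat_of_nonneg _ h.le, quadToHat_of_nonneg _ h.le,
      quadToHat_of_nonneg _ (by omega : (0 : ℤ) ≤ ((k + 1 : ℕ) : ℤ) - 1), Jmap_natCast]
    simp [onePlusT]

theorem zero_Γ (hC : FiniteDim C) (n : ℤ) : (ChainBundle.zero C hC).Γ n = 0 := map_zero _

theorem Hmap_quadToHat (ψ : SymC C) :
    Hmap C (quadToHat C n ψ) = (n.negOnePow : ℤ) • ψ := by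
  ext s : 1
  have e : (-(-(s : ℤ) - 1) - 1).toNat = s := by omega
  change quadToHat C n ψ (-(s : ℤ) - 1) = _
  rw [quadToHat_of_neg _ (by omega), e]; rfl

theorem Hmap_Jmap (φ : SymC C) : Hmap C (Jmap C φ) = 0 := by
  ext s : 1
  exact Jmap_of_neg _ (by omega)

/-- The symmetric structure `((1+T)ψ, θ)` of a quadratic structure `ψ`. -/
def SymStr.ofQuad (hC : FiniteDim C) (ψ : quadCycles C n) : SymStr (ChainBundle.zero C hC) n where
  φ := onePlusT C ψ
  φ_mem := onePlusT_cycles C n ψ ψ.2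
  θ := quadToHat C n ψ
  θ_mem := quadToHat_mem ψ.2.1
  eq := by
    have h : dQuad C n ψ = 0 := ψ.2.2
    have h0 : quadToHat C n (0 : SymC C) = 0 := by ext s : 1; simp [quadToHat]
    have key : Jmap C (onePlusT C ψ) - hatPush (slant₀ n (onePlusT C ψ 0)) (susp n C 0) =
        dHat C (n + 1) (quadToHat C n ψ) := by
      rw [map_zero, map_zero, sub_zero, dHat_quadToHat, h, h0, add_zero]
    exact key

namespace QTw

theorem zero_mk_add (hC : FiniteDim C) (x y : SymStr (ChainBundle.zero C hC) n) :
    (x.add y).φ = x.φ + y.φ ∧ (x.add y).θ = x.θ + y.θ := by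
  refine ⟨rfl, ?_⟩
  change x.θ + y.θ + hatBracket n _ _ ((ChainBundle.zero C hC).Γ n) = _
  rw [zero_Γ, hatBracket_zero, add_zero]

/-- The symmetric structure `φ` on `C` of a structure on `(C, 0)`. -/
def _root_.AlgSurgery.SymStr.sym {hC : FiniteDim C} (x : SymStr (ChainBundle.zero C hC) n) :
    SymC C := x.φ

/-- The chain `θ` on `C` of a structure on `(C, 0)`. -/
def _root_.AlgSurgery.SymStr.hat {hC : FiniteDim C} (x : SymStr (ChainBundle.zero C hC) n) :
    HatC C := x.θ

theorem hat_mem {hC : FiniteDim C} (x : SymStr (ChainBundle.zero C hC) n) :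
    x.hat ∈ hatChains C (n + 1) := x.θ_mem

theorem dHat_hat {hC : FiniteDim C} (x : SymStr (ChainBundle.zero C hC) n) :
    dHat C (n + 1) x.hat = Jmap C x.sym := by
  have h : Jmap C x.sym - hatPush (slant₀ n (x.sym 0)) (susp n C 0) = dHat C (n + 1) x.hat := x.eq
  rw [← h, map_zero, map_zero, sub_zero]

/-- All terms quadratic in φ or ξ vanish, leaving homology in the mapping cone of J. -/
theorem equivalent_zero_iff (hC : FiniteDim C) (x y : SymStr (ChainBundle.zero C hC) n) :
    x.Equivalent y ↔ ∃ ξ ∈ symChains C (n + 1), ∃ η ∈ hatChains C (n + 2),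
      y.sym - x.sym = dSym C (n + 1) ξ ∧ x.hat - y.hat + Jmap C ξ = dHat C (n + 2) η := by
  have h (ξ : SymC C) : x.hat - y.hat + Jmap C ξ - hatHtpy n (slant₁ n (ξ 0))
      (slant₀ n (x.sym 0)) (slant₀ n (y.sym 0)) (susp n C 0) = x.hat - y.hat + Jmap C ξ := by
    rw [map_zero, hatHtpy_zero, sub_zero]
  constructor
  · rintro ⟨ξ, hξ, η, hη, e, e'⟩
    exact ⟨ξ, hξ, η, hη, e, (h ξ).symm.trans e'⟩
  · rintro ⟨ξ, hξ, η, hη, e, e'⟩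
    exact ⟨ξ, hξ, η, hη, e, (h ξ).trans e'⟩

theorem quadToHat_succ (χ : SymC C) : quadToHat C (n + 1) χ = -quadToHat C n χ := by
  ext s : 1
  by_cases h : s < 0 <;> simp [quadToHat, h, Int.negOnePow_succ]

/-- The homomorphism `Q_n(C) → Q_n(C, 0)`, `ψ ↦ ((1+T)ψ, θ)`. -/
def quadHom (C : Cx A) (hC : FiniteDim C) (n : ℤ) :
    QQuad C n →+ QTw (ChainBundle.zero C hC) n :=
  QuotientAddGroup.lift _
    (AddMonoidHom.mk' (fun ψ => mk (SymStr.ofQuad hC ψ)) (fun ψ ψ' => by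
      rw [mk_add]
      obtain ⟨h, h'⟩ := zero_mk_add hC (SymStr.ofQuad hC ψ) (SymStr.ofQuad hC ψ')
      refine congrArg mk (SymStr.ext' ?_ ?_)
      · rw [h]; exact map_add (onePlusT C) _ _
      · rw [h']; exact quadToHat_add _ _)) (by
    rintro ψ ⟨χ, hχ, e⟩
    have e : dQuad C (n + 1) χ = ψ := e
    refine mk_eq_iff.2 ((equivalent_zero_iff hC _ (SymStr.zero _ n)).2
      ⟨-onePlusT C χ, neg_mem (onePlusT_mem hχ), -quadToHat C (n + 1) χ, ?_, ?_, ?_⟩)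
    · have h := neg_mem (quadToHat_mem hχ)
      rwa [add_assoc, one_add_one_eq_two] at h
    · change 0 - onePlusT C ψ = _
      rw [map_neg, dSym_onePlusT, e, zero_sub]
    · change quadToHat C n ψ - 0 + Jmap C (-onePlusT C χ) = _
      have k := dHat_quadToHat (n := n + 1) χ
      rw [add_assoc, one_add_one_eq_two] at k
      rw [map_neg, map_neg, k, e, quadToHat_succ]
      abel)

theorem quadHom_injective (hC : FiniteDim C) (n : ℤ) : Function.Injective (quadHom C hC n) := by
  rw [injective_iff_map_eq_zero]
  intro ψ
  induction ψ using QuotientAddGroup.induction_on with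
  | H ψ =>
  intro h
  obtain ⟨ξ, hξ, η, hη, e, e'⟩ :=
    (equivalent_zero_iff hC (SymStr.ofQuad hC ψ) (SymStr.zero _ n)).1 (mk_eq_iff.1 h)
  have e' : quadToHat C n ψ - 0 + Jmap C ξ = dHat C (n + 2) η := e'
  -- `Hmap` kills the image of J and recovers ±ψ from its hyperquadratic chain, so `η` yields a
  -- quadratic chain bounding ψ.
  have k := congrArg (Hmap C) e'
  have k' := dQuad_Hmap C (n + 1) η
  rw [add_assoc, one_add_one_eq_two] at k'
  rw [sub_zero, map_add, Hmap_quadToHat, Hmap_Jmap, add_zero, ← k'] at k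
  rw [show n + 2 = n + 1 + 1 by ring] at hη
  refine (QQuad.mk_eq_mk_iff (ψ := 0) (ψ' := ψ)).2 ⟨(n.negOnePow : ℤ) • Hmap C η,
    zsmul_mem (Hmap_mem hη) _, ?_⟩ |>.symm
  rw [map_zsmul, ← k, smul_smul, ← Units.val_mul, Int.units_mul_self, Units.val_one, one_smul]
  exact sub_zero _

/-- The quadratic cycle `ψ_s = (-1)^n θ_{-s-1}` of a symmetric structure `(φ, θ)` on `(C, 0)`. -/
def toQuad (hC : FiniteDim C) (x : SymStr (ChainBundle.zero C hC) n) : quadCycles C n :=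
  ⟨(n.negOnePow : ℤ) • Hmap C x.hat, zsmul_mem (K := quadCycles C n)
    (show Hmap C x.hat ∈ quadCycles C n from ⟨Hmap_mem (hat_mem x), by
      change dQuad C n (Hmap C x.hat) = 0
      rw [dQuad_Hmap, dHat_hat, Hmap_Jmap]⟩) _⟩

theorem quadHom_toQuad (hC : FiniteDim C) (x : SymStr (ChainBundle.zero C hC) n) :
    quadHom C hC n (QQuad.mk (toQuad hC x)) = mk x := by
  have hq : dQuad C n (toQuad hC x) = 0 := (toQuad hC x).2.2
  have h0 : quadToHat C n (0 : SymC C) = 0 := by ext s : 1; simp [quadToHat]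
  have d1 := dHat_quadToHat (n := n) ((toQuad hC x : quadCycles C n) : SymC C)
  rw [hq, h0, add_zero] at d1
  -- `θ` and the chain rebuilt from its negative part differ only in s ≥ 0. That difference is a
  -- symmetric chain, and it serves as ξ.
  have r : Jmap C (fun s : ℕ => x.hat s) = x.hat - quadToHat C n (toQuad hC x) := by
    ext s : 1
    rcases lt_or_ge s 0 with hs | hs
    · have e1 : -(((-s - 1).toNat : ℕ) : ℤ) - 1 = s := by omega
      rw [Jmap_of_neg _ hs, Pi.sub_apply, quadToHat_of_neg _ hs]
      change 0 = x.hat s - (n.negOnePow : ℤ) • (n.negOnePow : ℤ) •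
        x.hat (-(((-s - 1).toNat : ℕ) : ℤ) - 1)
      rw [e1, smul_smul, ← Units.val_mul, Int.units_mul_self, Units.val_one, one_smul, sub_self]
    · rw [Pi.sub_apply, quadToHat_of_nonneg _ hs]
      lift s to ℕ using hs
      exact (Jmap_natCast _ _).trans (sub_zero _).symm
  refine mk_eq_iff.2 ((equivalent_zero_iff hC _ x).2 ⟨fun s : ℕ => x.hat s,
    restrict_mem (hat_mem x), 0, zero_mem _, ?_, ?_⟩)
  · change x.sym - onePlusT C (toQuad hC x) = _
    apply Jmap_injective
    rw [← dHat_Jmap, r, map_sub, map_sub, d1, dHat_hat]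
  · change quadToHat C n (toQuad hC x) - x.hat + _ = _
    rw [r, map_zero]
    abel

theorem quadHom_surjective (hC : FiniteDim C) (n : ℤ) : Function.Surjective (quadHom C hC n) := by
  rintro ⟨x⟩
  exact ⟨_, quadHom_toQuad hC x⟩

/-- The isomorphism `Q_n(C) ≃ Q_n(C, 0)`. -/
noncomputable def quadEquiv (C : Cx A) (hC : FiniteDim C) (n : ℤ) :
    QQuad C n ≃+ QTw (ChainBundle.zero C hC) n :=
  AddEquiv.ofBijective (quadHom C hC n) ⟨quadHom_injective hC n, quadHom_surjective hC n⟩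

/-- Shifting a cycle by one with alternating signs cancels its `T` terms and doubles the others.
Hence the hyperquadratic groups have exponent two. -/
theorem dHat_shift {n : ℤ} {θ : HatC C} (h : dHat C n θ = 0) :
    dHat C (n + 1) (fun s => (n.negOnePow : ℤ) • (s.negOnePow : ℤ) • θ (s + 1)) = -θ - θ := by
  ext s : 1
  have h1 : dBi C (θ (s + 1)) = _ := eq_neg_of_add_eq_zero_left (congrFun h (s + 1))
  rw [dHat_apply]
  simp only [map_zsmul, h1, sub_add_cancel, add_sub_cancel_right]
  rcases Int.units_eq_one_or n.negOnePow with hn | hn <;>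
  rcases Int.units_eq_one_or s.negOnePow with hs | hs <;>
  simp [Int.negOnePow_add, Int.negOnePow_sub, hn, hs] <;> abel

theorem _root_.AlgSurgery.QHat.neg_eq_self (α : QHat C n) : -α = α := by
  induction α using QuotientAddGroup.induction_on with
  | H θ =>
  refine (QHat.mk_eq_mk (θ := θ) (θ' := -θ) ?_
    (dHat_shift (mem_hatCycles.1 θ.2).2).symm).symm
  intro s p q hs
  have := θ.2.1 (s + 1) p q (by omega)
  simp [this]

/-- On representatives the square commutes only up to (-1)^n, which is harmless because -α = α in
the hyperquadratic group. -/
theorem quadHom_H (hC : FiniteDim C) (α : QHat C (n + 1)) :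
    quadHom C hC n (QHat.H C n α) = H (ChainBundle.zero C hC) n α := by
  induction α using QuotientAddGroup.induction_on with
  | H θ =>
  have k := quadHom_toQuad hC (SymStr.ofHat (B := ChainBundle.zero C hC) (n := n) θ)
  have e : QQuad.mk (toQuad hC (SymStr.ofHat (B := ChainBundle.zero C hC) (n := n) θ)) =
      (n.negOnePow : ℤ) • QHat.H C n (QHat.mk θ) := rfl
  rw [e, map_zsmul] at k
  rcases Int.units_eq_one_or n.negOnePow with hn | hn
  · rw [hn, Units.val_one, one_smul] at k
    exact k
  · rw [hn, Units.val_neg, Units.val_one, neg_smul, one_smul, ← map_neg, ← map_neg,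
      QHat.neg_eq_self] at k
    exact k

theorem N_quadHom (hC : FiniteDim C) (ψ : QQuad C n) :
    N (ChainBundle.zero C hC) n (quadHom C hC n ψ) = QQuad.symmetrize C n ψ := by
  induction ψ using QuotientAddGroup.induction_on with
  | H ψ => rfl

theorem J_zero (hC : FiniteDim C) (φ : QSym C n) :
    J (ChainBundle.zero C hC) n φ = QSym.J C n φ := by
  induction φ using QuotientAddGroup.induction_on with
  | H φ =>
  refine congrArg QHat.mk (Subtype.ext ?_)
  refine Eq.trans ?_ (sub_zero _)
  exact congrArg (fun z : HatC C => Jmap C φ - z)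
    ((congrArg (hatPush (slant₀ n ((φ : SymC C) 0))) (zero_Γ hC n)).trans (map_zero _))

end QTw

end ZeroBundle

end AlgSurgery

/-! ### The main theorem. -/

open AlgSurgery in
theorem mainTheorem1 (A : Type u) [Ring A] [StarRing A] :
    -- equivalence of symmetric structures on a chain bundle is an equivalence relation
    (∀ (B : ChainBundle A) (n : ℤ), _root_.Equivalence (SymStr.Equivalent (B := B) (n := n))) ∧
    ∃ _ : ∀ (B : ChainBundle A) (n : ℤ), AddCommGroup (QTw B n),
      -- the addition formula
      (∀ (B : ChainBundle A) (n : ℤ) (x y : SymStr B n), ∃ z : SymStr B n,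
        z.φ = x.φ + y.φ ∧ z.θ = x.θ + y.θ + bracket B n x.φ y.φ ∧
        QTw.mk x + QTw.mk y = QTw.mk z) ∧
      ∃ (H : ∀ (B : ChainBundle A) (n : ℤ), QHat B.C (n + 1) →+ QTw B n)
        (N : ∀ (B : ChainBundle A) (n : ℤ), QTw B n →+ QSym B.C n)
        (J : ∀ (B : ChainBundle A) (n : ℤ), QSym B.C n →+ QHat B.C n)
        (push : ∀ {B B' : ChainBundle A} (_ : BundleHom B B') (n : ℤ), QTw B n →+ QTw B' n),
        -- the formulas for the maps in the exact sequence
        (∀ (B : ChainBundle A) (n : ℤ) (θ : hatCycles B.C (n + 1)), ∃ z : SymStr B n,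
          z.φ = 0 ∧ z.θ = θ ∧ H B n (QHat.mk θ) = QTw.mk z) ∧
        (∀ (B : ChainBundle A) (n : ℤ) (x : SymStr B n),
          N B n (QTw.mk x) = QSym.mk ⟨x.φ, x.φ_mem⟩) ∧
        (∀ (B : ChainBundle A) (n : ℤ) (φ : symCycles B.C n), ∃ α : hatCycles B.C n,
          (α : HatC B.C) =
            Jmap B.C φ - hatPush (slant₀ n ((φ : SymC B.C) 0)) (susp n B.C B.γ) ∧
          J B n (QSym.mk φ) = QHat.mk α) ∧
        -- exactness
        (∀ (B : ChainBundle A) (n : ℤ),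
          Function.Exact (H B n) (N B n) ∧ Function.Exact (N B n) (J B n) ∧
          Function.Exact (J B (n + 1)) (H B n)) ∧
        -- covariance
        (∀ {B B' : ChainBundle A} (u : BundleHom B B') (n : ℤ) (x : SymStr B n),
          ∃ z : SymStr B' n, z.φ = symPush (fam u.f) x.φ ∧
            z.θ = hatPush (fam u.f) x.θ - u.twist n x.φ ∧
            push u n (QTw.mk x) = QTw.mk z) ∧
        (∀ (B : ChainBundle A) (n : ℤ), push (BundleHom.id B) n = AddMonoidHom.id _) ∧
        (∀ {B B' B'' : ChainBundle A} (v : BundleHom B' B'') (u : BundleHom B B') (n : ℤ),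
          push (v.comp u) n = (push v n).comp (push u n)) ∧
        (∀ {B B' : ChainBundle A} (u v : BundleHom B B') (n : ℤ), u.Homotopic v →
          push u n = push v n) ∧
        -- naturality of the exact sequence
        (∀ {B B' : ChainBundle A} (u : BundleHom B B') (n : ℤ),
          (push u n).comp (H B n) = (H B' n).comp (QHat.map u.f (n + 1)) ∧
          (N B' n).comp (push u n) = (QSym.map u.f n).comp (N B n) ∧
          (J B' n).comp (QSym.map u.f n) = (QHat.map u.f n).comp (J B n)) ∧
        (∀ {B B' : ChainBundle A} (u : BundleHom B B') (n : ℤ), u.IsEquiv →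
          Function.Bijective (push u n) ∧ Function.Bijective (QSym.map u.f n) ∧
          Function.Bijective (QHat.map u.f n)) ∧
        -- the untwisted case
        (∀ (C : Cx A) (hC : FiniteDim C) (n : ℤ),
          ∃ e : QQuad C n ≃+ QTw (ChainBundle.zero C hC) n,
            (∀ ψ : quadCycles C n, ∃ z : SymStr (ChainBundle.zero C hC) n,
              z.φ = onePlusT C ψ ∧ z.θ = quadToHat C n ψ ∧ e (QQuad.mk ψ) = QTw.mk z) ∧
            (∀ θ : QHat C (n + 1), e (QHat.H C n θ) = H (ChainBundle.zero C hC) n θ) ∧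
            (∀ ψ : QQuad C n,
              N (ChainBundle.zero C hC) n (e ψ) = QQuad.symmetrize C n ψ) ∧
            (∀ φ : QSym C n, J (ChainBundle.zero C hC) n φ = QSym.J C n φ)) := by
  refine ⟨fun B n => SymStr.equivalence, fun B n => QTw.addCommGroup, ?_, QTw.H, QTw.N, QTw.J,
    fun u n => QTw.push u n, ?_, ?_, ?_, ?_, ?_, QTw.push_id, QTw.push_comp, ?_, ?_, ?_, ?_⟩
  · exact fun B n x y => ⟨x.add y, rfl, rfl, rfl⟩
  · exact fun B n θ => ⟨SymStr.ofHat θ, rfl, rfl, rfl⟩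
  · exact fun B n x => rfl
  · exact fun B n φ => ⟨QTw.Jcycle B n φ, rfl, rfl⟩
  · exact fun B n => ⟨QTw.exact_H_N B n, QTw.exact_N_J B n, QTw.exact_J_H B n⟩
  · exact fun u n x => ⟨u.push x, rfl, rfl, rfl⟩
  · exact fun u v n h => QTw.push_eq_of_homotopic h n
  · exact fun u n => ⟨QTw.push_H u n, QTw.N_push u n, QTw.J_map u n⟩
  · exact fun u n h => h.bijective n
  · exact fun C hC n => ⟨QTw.quadEquiv C hC n,
      fun ψ => ⟨SymStr.ofQuad hC ψ, rfl, rfl, rfl⟩, QTw.quadHom_H hC, QTw.N_quadHom hC,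
      QTw.J_zero hC⟩
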